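/- **Setting.** Let $\mathcal M=(\mathcal S,\mathcal A,\mathbb P,r,H,d_1)$ be an episodic MDP with horizon $H\ge1$, with $\sigma$-finite reference measures on $\mathcal S$ and $\mathcal A$ (Lebesgue or counting measure, say; "density" refers to them), initial density $d_1$, transition densities $p_h(s'\mid s,a)$ and mean rewards $r_h(s,a)\in[0,1]$. A policy $\pi=(\pi_h)_{h\in[H]}$ is a family of action densities $\pi_h(\cdot\mid s)$; $V^\pi_h$ is its value function and $d^\pi_h(s,a)=d^\pi_h(s)\pi_h(a\mid s)$ its state-action visitation density at step $h$. The MDP is linear for known feature maps $\phi_h:\mathcal S\times\mathcal A\to\mathbb R^d$ with $\|\phi_h(s,a)\|_2\le1$: $r_h(s,a)=\langle\phi_h(s,a),\theta_h\rangle$ and $p_h(s'\mid s,a)=\langle\phi_h(s,a),\psi_h(s')\rangle$ with $\|\theta_h\|_2\le\sqrt d$ and $\|\int\psi_h v\|_2\le\sqrt d\,\|v\|_\infty$ for all bounded measurable $v$. **Data.** $\mathcal D=\{(s^k_h,a^k_h,r^k_h)\}_{h\in[H]}^{k\in[K]}$, $K\ge1$, is collected adaptively: let $\mathcal F_{k-1}$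 be generated by episodes $1,\dots,k-1$. Given $\mathcal F_{k-1}$, episode $k$ is generated in $\mathcal M$ by an $\mathcal F_{k-1}$-measurable policy $\mu^k$ (a fixed behaviour policy is the case $\mu^k\equiv\mu$), with observed rewards in $[0,1]$ of conditional mean $r_h(s^k_h,a^k_h)$. Let $U_h(s)$ be the set of actions $a$ with $\mu^k_h(a\mid s)>0$ for some episode and some history. **Assumptions.** There is an optimal policy $\pi^*$ (maximizing all $V^\pi_h(s)$) with $d^{\pi^*}_h\le1$ such that, for every episode $k$, every history and all $(h,s,a)$, $d^{\pi^*}_h(s,a)>0\Rightarrow d^{\mu^k}_h(s,a)>0$. For every $h\in[H]$, $\kappa_h^{-1}:=\inf\{d^{\mu^k}_h(s,a): d^{\mu^k}_h(s,a)>0\}>0$, the infimum being over all $(s,a)$, episodes and histories. Put $\kappa=\sum_{h=1}^H\kappa_h$ and $\mathrm{SubOpt}(\pi)=\mathbb E_{s_1\sim d_1}[V^{\pi^*}_1(s_1)-V^\pi_1(s_1)]$. **Algorithm (BCP-VI).** For $k=1,\dots,K+1$ put $\hat V^k_{H+1}=0$ and, for $h=H,\dots,1$, with $\Sigma^k_h=I+\sum_{t<k}\phi_h(s^t_h,a^t_h)\phi_h(s^t_h,a^t_h)^\top$,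 $$\hat w^k_h=(\Sigma^k_h)^{-1}\sum_{t<k}\phi_h(s^t_h,a^t_h)\bigl(r^t_h+\hat V^k_{h+1}(s^t_{h+1})\bigr),$$ $$\hat Q^k_h=\max\Bigl\{\min\bigl\{\langle\phi_h,\hat w^k_h\rangle-\beta_k\|\phi_h\|_{(\Sigma^k_h)^{-1}},\,H-h+1\bigr\},\,0\Bigr\},$$ let $\hat\pi^k_h$ maximize $\langle\hat Q^k_h(s,\cdot),\pi_h(\cdot\mid s)\rangle$ at every state $s$ over all $\pi_h$ with $\operatorname{supp}\pi_h(\cdot\mid s)\subseteq U_h(s)$ at all feasible states $s$ (those visited with positive density at step $h$ by some policy), and put $\hat V^k_h(s)=\langle\hat Q^k_h(s,\cdot),\hat\pi^k_h(\cdot\mid s)\rangle$. Here $\beta_k=c_1dH\log(dHk/\delta)$ with $\delta=1/K$. The mixture policy $\hat\pi^{mix}$ draws $k\in[K]$ uniformly and executes $\hat\pi^k$, so that its expected sub-optimality given $\mathcal D$ is $\mathbb E[\mathrm{SubOpt}(\hat\pi^{mix})\mid\mathcal D]=\frac1K\sum_{k=1}^K\mathrm{SubOpt}(\hat\pi^k)$;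 the last-iteration policy is $\hat\pi^{last}=\hat\pi^{K+1}$. **Claim.** There are absolute constants $c_1,C>0$ and $q\in\mathbb N$ such that in every such setting, with $$B:=C\,\frac{\kappa H d^{3/2}}{\sqrt K}\,\bigl(1+\log(dHK)\bigr)^q,$$ with probability at least $1-4/K$ over $\mathcal D$, $$\mathbb E[\mathrm{SubOpt}(\hat\pi^{mix})\mid\mathcal D]\ \vee\ \mathrm{SubOpt}(\hat\pi^{last})\ \le\ B,$$ and also, in expectation over $\mathcal D$, $\mathbb E[\mathrm{SubOpt}(\hat\pi^{mix})]\vee\mathbb E[\mathrm{SubOpt}(\hat\pi^{last})]\le B$. -/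

import Mathlib

open MeasureTheory ProbabilityTheory
open scoped Matrix

universe u v w

namespace BCPVI

/-- An episodic time-inhomogeneous Markov decision process with horizon `H`. Steps are numbered
`1, …, H`; nothing is required at other steps. Initial and transition distributions are given by
densities with respect to the reference measure `ρ` on the state space (Lebesgue measure, or
counting measure for a discrete space); `r h s a` is the mean reward. -/
structure MDP (S A : Type*) [MeasurableSpace S] [MeasurableSpace A] (ρ : Measure S) (H : ℕ) where
  d₁ : S → ℝ
  p : ℕ → S → A → S → ℝ
  r : ℕ → S → A → ℝ
  measurable_d₁ : Measurable d₁
  d₁_nonneg : ∀ s, 0 ≤ d₁ s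
  integral_d₁ : ∫ s, d₁ s ∂ρ = 1
  measurable_p : ∀ h ∈ Set.Icc 1 H, Measurable fun x : S × A × S => p h x.1 x.2.1 x.2.2
  p_nonneg : ∀ h ∈ Set.Icc 1 H, ∀ s a s', 0 ≤ p h s a s'
  integral_p : ∀ h ∈ Set.Icc 1 H, ∀ s a, ∫ s', p h s a s' ∂ρ = 1
  measurable_r : ∀ h ∈ Set.Icc 1 H, Measurable fun x : S × A => r h x.1 x.2
  r_mem : ∀ h ∈ Set.Icc 1 H, ∀ s a, r h s a ∈ Set.Icc (0 : ℝ) 1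

section Policies

variable {S A : Type*} [MeasurableSpace S] [MeasurableSpace A]

/-- A one-step policy: `σ s a` is the density of the action distribution at state `s` with respect
to the reference measure `ν` on the action space (its mass function if `ν` is counting measure). -/
def IsStagePolicy (ν : Measure A) (σ : S → A → ℝ) : Prop :=
  (Measurable fun x : S × A => σ x.1 x.2) ∧ (∀ s a, 0 ≤ σ s a) ∧ ∀ s, ∫ a, σ s a ∂ν = 1

/-- A policy for the `H` steps. -/
def IsPolicy (ν : Measure A) (H : ℕ) (π : ℕ → S → A → ℝ) : Prop :=
  ∀ h ∈ Set.Icc 1 H, IsStagePolicy ν (π h)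

variable {ρ : Measure S} {H : ℕ}

/-- `(T_h V)(s, a) = r_h(s, a) + E_{s' ∼ P_h(· | s, a)} [V(s')]`. -/
noncomputable def MDP.bellman (M : MDP S A ρ H) (V : S → ℝ) (h : ℕ) (s : S) (a : A) : ℝ :=
  M.r h s a + ∫ s', V s' * M.p h s a s' ∂ρ

/-- The value function `V^π_h`, the expected sum of the rewards at steps `h, …, H` under `π`
started from a given state at step `h`, integrated out step by step. -/
noncomputable def MDP.value (M : MDP S A ρ H) (ν : Measure A) (π : ℕ → S → A → ℝ) (h : ℕ) :
    S → ℝ :=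
  if h ≤ H then fun s => ∫ a, M.bellman (M.value ν π (h + 1)) h s a * π h s a ∂ν else fun _ => 0
termination_by H + 1 - h

/-- The state-visitation density `d^π_h(s)`. -/
noncomputable def MDP.stateDensity (M : MDP S A ρ H) (ν : Measure A) (π : ℕ → S → A → ℝ) :
    ℕ → S → ℝ
  | 0 => fun _ => 0
  | 1 => M.d₁
  | h + 2 => fun s' =>
      ∫ s, ∫ a, M.stateDensity ν π (h + 1) s * π (h + 1) s a * M.p (h + 1) s a s' ∂ν ∂ρ

/-- The state-action visitation density `d^π_h(s, a) = d^π_h(s) π_h(a | s)`. -/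
noncomputable def MDP.density (M : MDP S A ρ H) (ν : Measure A) (π : ℕ → S → A → ℝ)
    (h : ℕ) (s : S) (a : A) : ℝ :=
  M.stateDensity ν π h s * π h s a

/-- `s` is a feasible state at step `h`: some policy visits it with positive density. -/
def MDP.Feasible (M : MDP S A ρ H) (ν : Measure A) (h : ℕ) (s : S) : Prop :=
  ∃ π, IsPolicy ν H π ∧ 0 < M.stateDensity ν π h s

/-- `π` maximizes every value function `V_h(s)` over all policies. -/
def MDP.IsOptimal (M : MDP S A ρ H) (ν : Measure A) (π : ℕ → S → A → ℝ) : Prop :=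
  IsPolicy ν H π ∧
    ∀ π', IsPolicy ν H π' → ∀ h ∈ Set.Icc 1 H, ∀ s, M.value ν π' h s ≤ M.value ν π h s

/-- `SubOpt(π) = E_{s₁ ∼ d₁} [V^{π⋆}_1(s₁) - V^π_1(s₁)]`. -/
noncomputable def MDP.subOpt (M : MDP S A ρ H) (ν : Measure A) (πstar π : ℕ → S → A → ℝ) : ℝ :=
  ∫ s, (M.value ν πstar 1 s - M.value ν π 1 s) * M.d₁ s ∂ρ

/-- The MDP is linear with respect to the feature maps `φ h : S → A → ℝ^d`. -/
def MDP.IsLinear (M : MDP S A ρ H) {d : ℕ} (φ : ℕ → S → A → EuclideanSpace ℝ (Fin d)) : Prop :=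
  ∀ h ∈ Set.Icc 1 H,
    (Measurable fun x : S × A => φ h x.1 x.2) ∧ (∀ s a, ‖φ h s a‖ ≤ 1) ∧
    ∃ (θ : EuclideanSpace ℝ (Fin d)) (ψ : S → EuclideanSpace ℝ (Fin d)),
      (∀ s a, M.r h s a = inner ℝ (φ h s a) θ) ∧
      (∀ s a s', M.p h s a s' = inner ℝ (φ h s a) (ψ s')) ∧
      ‖θ‖ ≤ √d ∧ Integrable ψ ρ ∧
      ∀ (v : S → ℝ) (B : ℝ), Measurable v → (∀ s, |v s| ≤ B) → ‖∫ s, v s • ψ s ∂ρ‖ ≤ √d * B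

end Policies

/-- An offline data set: states, actions and rewards by episode `t` and step `h`. Only episodes
`1, …, K` and steps `1, …, H` are meaningful. -/
structure Dataset (S A : Type*) where
  state : ℕ → ℕ → S
  action : ℕ → ℕ → A
  reward : ℕ → ℕ → ℝ

section Algorithm

variable {S A : Type*} {d : ℕ}

/-- `Σ^k_h = ∑_{t < k} φ_h(s^t_h, a^t_h) φ_h(s^t_h, a^t_h)ᵀ + I`  (regularization `λ = 1`). -/
noncomputable def gram (φ : ℕ → S → A → EuclideanSpace ℝ (Fin d)) (D : Dataset S A) (k h : ℕ) :
    Matrix (Fin d) (Fin d) ℝ :=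
  (∑ t ∈ Finset.Ico 1 k, Matrix.vecMulVec (φ h (D.state t h) (D.action t h)).ofLp
    (φ h (D.state t h) (D.action t h)).ofLp) + 1

/-- The least-squares weights `ŵ^k_h`, given the next value estimate `V`. -/
noncomputable def weights (φ : ℕ → S → A → EuclideanSpace ℝ (Fin d)) (D : Dataset S A) (k : ℕ)
    (V : S → ℝ) (h : ℕ) : Fin d → ℝ :=
  (gram φ D k h)⁻¹ *ᵥ ∑ t ∈ Finset.Ico 1 k,
    (D.reward t h + V (D.state t (h + 1))) • (φ h (D.state t h) (D.action t h)).ofLp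

/-- The bonus `b^k_h(s, a) = β_k ‖φ_h(s, a)‖_{(Σ^k_h)⁻¹}`. -/
noncomputable def bonus (φ : ℕ → S → A → EuclideanSpace ℝ (Fin d)) (β : ℕ → ℝ)
    (D : Dataset S A) (k h : ℕ) (s : S) (a : A) : ℝ :=
  β k * √((φ h s a).ofLp ⬝ᵥ ((gram φ D k h)⁻¹ *ᵥ (φ h s a).ofLp))

/-- The pessimistic estimate `Q̂^k_h = min {⟨φ_h, ŵ^k_h⟩ - b^k_h, H - h + 1}⁺`, given the next value
estimate `V`. -/
noncomputable def qEstimate (φ : ℕ → S → A → EuclideanSpace ℝ (Fin d)) (H : ℕ) (β : ℕ → ℝ)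
    (D : Dataset S A) (k : ℕ) (V : S → ℝ) (h : ℕ) (s : S) (a : A) : ℝ :=
  max (min ((φ h s a).ofLp ⬝ᵥ weights φ D k V h - bonus φ β D k h s a) ((H : ℝ) - h + 1)) 0

variable [MeasurableSpace S] [MeasurableSpace A]

/-- The value estimate `V̂^k_h(s) = ⟨Q̂^k_h(s, ·), π_h(· | s)⟩`, with `V̂^k_{H+1} = 0`, when the
policy extracted in the `k`-th pass is `π`. -/
noncomputable def vHat (ν : Measure A) (φ : ℕ → S → A → EuclideanSpace ℝ (Fin d)) (H : ℕ)
    (β : ℕ → ℝ) (D : Dataset S A) (k : ℕ) (π : ℕ → S → A → ℝ) (h : ℕ) : S → ℝ :=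
  if h ≤ H then
    fun s => ∫ a, qEstimate φ H β D k (vHat ν φ H β D k π (h + 1)) h s a * π h s a ∂ν
  else fun _ => 0
termination_by H + 1 - h

/-- The action-value estimate `Q̂^k_h` in the `k`-th pass. -/
noncomputable def qHat (ν : Measure A) (φ : ℕ → S → A → EuclideanSpace ℝ (Fin d)) (H : ℕ)
    (β : ℕ → ℝ) (D : Dataset S A) (k : ℕ) (π : ℕ → S → A → ℝ) (h : ℕ) (s : S) (a : A) : ℝ :=
  qEstimate φ H β D k (vHat ν φ H β D k π (h + 1)) h s a

/-- The class of one-step policies at step `h` that at every feasible state are supported in the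
set `U h s` of actions. -/
def MDP.constrainedPolicies {ρ : Measure S} {H : ℕ} (M : MDP S A ρ H) (ν : Measure A)
    (U : ℕ → S → Set A) (h : ℕ) : Set (S → A → ℝ) :=
  {σ | IsStagePolicy ν σ ∧ ∀ s, M.Feasible ν h s → ∀ a, 0 < σ s a → a ∈ U h s}

/-- `π 1, …, π (K + 1)` is an ensemble output by BCP-VI on the data set `D`: in the `k`-th pass
`π̂^k_h` maximizes `⟨Q̂^k_h(s, ·), σ(· | s)⟩` at every state, among the policies `σ` of the
constrained class. Ties may be broken in any way. -/
def MDP.IsBCPVIEnsemble {ρ : Measure S} {H : ℕ} (M : MDP S A ρ H) (ν : Measure A)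
    (φ : ℕ → S → A → EuclideanSpace ℝ (Fin d)) (U : ℕ → S → Set A) (β : ℕ → ℝ) (K : ℕ)
    (D : Dataset S A) (π : ℕ → ℕ → S → A → ℝ) : Prop :=
  ∀ k ∈ Set.Icc 1 (K + 1), ∀ h ∈ Set.Icc 1 H,
    π k h ∈ M.constrainedPolicies ν U h ∧
    ∀ σ ∈ M.constrainedPolicies ν U h, ∀ s,
      ∫ a, qHat ν φ H β D k (π k) h s a * σ s a ∂ν ≤
        ∫ a, qHat ν φ H β D k (π k) h s a * π k h s a ∂ν

/-- The parameters `β_k(δ) = c₁ d H log (d H k / δ)`. -/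
noncomputable def betaParam (c₁ : ℝ) (d H : ℕ) (δ : ℝ) (k : ℕ) : ℝ :=
  c₁ * (d * H) * Real.log (d * H * k / δ)

/-- Expected sub-optimality, given the data, of the mixture policy that draws `k` uniformly from
`{1, …, K}` and executes `π k` in the whole episode. -/
noncomputable def MDP.subOptMix {ρ : Measure S} {H : ℕ} (M : MDP S A ρ H) (ν : Measure A)
    (πstar : ℕ → S → A → ℝ) (K : ℕ) (π : ℕ → ℕ → S → A → ℝ) : ℝ :=
  (1 / K : ℝ) * ∑ k ∈ Finset.Icc 1 K, M.subOpt ν πstar (π k)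

/-- Sub-optimality of the last-iteration policy `π (K + 1)`. -/
noncomputable def MDP.subOptLast {ρ : Measure S} {H : ℕ} (M : MDP S A ρ H) (ν : Measure A)
    (πstar : ℕ → S → A → ℝ) (K : ℕ) (π : ℕ → ℕ → S → A → ℝ) : ℝ :=
  M.subOpt ν πstar (π (K + 1))

end Algorithm

section Data

variable {S A Ω : Type*} [MeasurableSpace S] [MeasurableSpace A]

/-- The σ-algebra generated by `(s^t_h, a^t_h, r^t_h)`. -/
abbrev obs (D : Ω → Dataset S A) (t h : ℕ) : MeasurableSpace Ω :=
  MeasurableSpace.comap (fun ω => (D ω).state t h) inferInstance ⊔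
  MeasurableSpace.comap (fun ω => (D ω).action t h) inferInstance ⊔
  MeasurableSpace.comap (fun ω => (D ω).reward t h) inferInstance

/-- `F_{k-1}`: the σ-algebra generated by all the episodes before the `k`-th. -/
abbrev past (D : Ω → Dataset S A) (H k : ℕ) : MeasurableSpace Ω :=
  ⨆ t ∈ Set.Ico 1 k, ⨆ h ∈ Set.Icc 1 H, obs D t h

/-- Everything observed up to and including the state at step `h` of episode `k`. -/
abbrev pastState (D : Ω → Dataset S A) (H k h : ℕ) : MeasurableSpace Ω :=
  past D H k ⊔ (⨆ i ∈ Set.Ico 1 h, obs D k i) ⊔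
    MeasurableSpace.comap (fun ω => (D ω).state k h) inferInstance

/-- Everything observed up to and including the action at step `h` of episode `k`. -/
abbrev pastAction (D : Ω → Dataset S A) (H k h : ℕ) : MeasurableSpace Ω :=
  pastState D H k h ⊔ MeasurableSpace.comap (fun ω => (D ω).action k h) inferInstance

/-- The data are collected adaptively in the MDP: in episode `k` the policy `μ k`, which may depend
on the earlier episodes (and on nothing else), is executed. A fixed behaviour policy, with
independent episodes, is the case where `μ k ω` depends neither on `k` nor on `ω`. -/
structure IsAdaptiveData [MeasurableSpace Ω] {ρ : Measure S} {H : ℕ} (M : MDP S A ρ H)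
    (ν : Measure A) (P : Measure Ω) (K : ℕ) (D : Ω → Dataset S A)
    (μ : ℕ → Ω → ℕ → S → A → ℝ) : Prop where
  measurable_state : ∀ k ∈ Set.Icc 1 K, ∀ h ∈ Set.Icc 1 H, Measurable fun ω => (D ω).state k h
  measurable_action : ∀ k ∈ Set.Icc 1 K, ∀ h ∈ Set.Icc 1 H, Measurable fun ω => (D ω).action k h
  measurable_reward : ∀ k ∈ Set.Icc 1 K, ∀ h ∈ Set.Icc 1 H, Measurable fun ω => (D ω).reward k h
  isPolicy : ∀ k ∈ Set.Icc 1 K, ∀ ω, IsPolicy ν H (μ k ω)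
  predictable : ∀ k ∈ Set.Icc 1 K, ∀ h ∈ Set.Icc 1 H,
    Measurable[(past D H k).prod inferInstance] fun x : Ω × S × A => μ k x.1 h x.2.1 x.2.2
  initial : ∀ k ∈ Set.Icc 1 K, ∀ B : Set S, MeasurableSet B →
    P⟦{ω | (D ω).state k 1 ∈ B} | past D H k⟧ =ᵐ[P] fun _ => ∫ s in B, M.d₁ s ∂ρ
  action : ∀ k ∈ Set.Icc 1 K, ∀ h ∈ Set.Icc 1 H, ∀ B : Set A, MeasurableSet B →
    P⟦{ω | (D ω).action k h ∈ B} | pastState D H k h⟧ =ᵐ[P]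
      fun ω => ∫ a in B, μ k ω h ((D ω).state k h) a ∂ν
  reward_mem : ∀ k ∈ Set.Icc 1 K, ∀ h ∈ Set.Icc 1 H,
    ∀ᵐ ω ∂P, (D ω).reward k h ∈ Set.Icc (0 : ℝ) 1
  reward_mean : ∀ k ∈ Set.Icc 1 K, ∀ h ∈ Set.Icc 1 H,
    P[fun ω => (D ω).reward k h | pastAction D H k h] =ᵐ[P]
      fun ω => M.r h ((D ω).state k h) ((D ω).action k h)
  transition : ∀ k ∈ Set.Icc 1 K, ∀ h ∈ Set.Ico 1 H, ∀ B : Set S, MeasurableSet B →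
    P⟦{ω | (D ω).state k (h + 1) ∈ B} | pastAction D H k h⟧ =ᵐ[P]
      fun ω => ∫ s' in B, M.p h ((D ω).state k h) ((D ω).action k h) s' ∂ρ

/-- The support of the behaviour policy: the actions that it plays at `s` in step `h`, in some
episode after some history. -/
def behaviorSupport (K : ℕ) (μ : ℕ → Ω → ℕ → S → A → ℝ) (h : ℕ) (s : S) : Set A :=
  {a | ∃ k ∈ Set.Icc 1 K, ∃ ω, 0 < μ k ω h s a}

/-- Optimal-policy concentrability: `d^{π⋆}_h(s, a) > 0` implies `d^μ_h(s, a) > 0`, whatever the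
episode and the history are. -/
def MDP.OPC {ρ : Measure S} {H : ℕ} (M : MDP S A ρ H) (ν : Measure A) (K : ℕ)
    (μ : ℕ → Ω → ℕ → S → A → ℝ) (πstar : ℕ → S → A → ℝ) : Prop :=
  ∀ k ∈ Set.Icc 1 K, ∀ ω, ∀ h ∈ Set.Icc 1 H, ∀ s a,
    0 < M.density ν πstar h s a → 0 < M.density ν (μ k ω) h s a

/-- `κ_h⁻¹`, the infimum of the positive values of the behaviour density `d^μ_h(s, a)`. -/
noncomputable def MDP.minDensity {ρ : Measure S} {H : ℕ} (M : MDP S A ρ H) (ν : Measure A) (K : ℕ)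
    (μ : ℕ → Ω → ℕ → S → A → ℝ) (h : ℕ) : ℝ :=
  sInf {x | ∃ k ∈ Set.Icc 1 K, ∃ ω s a, x = M.density ν (μ k ω) h s a ∧ 0 < x}

/-- `κ = ∑_h κ_h`. -/
noncomputable def MDP.kappa {ρ : Measure S} {H : ℕ} (M : MDP S A ρ H) (ν : Measure A) (K : ℕ)
    (μ : ℕ → Ω → ℕ → S → A → ℝ) : ℝ :=
  ∑ h ∈ Finset.Icc 1 H, (M.minDensity ν K μ h)⁻¹

end Data

/-- `C · κ H d^{3/2} / √K · (1 + log (d H K))^q`. -/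
noncomputable def rate (C : ℝ) (q : ℕ) (κ : ℝ) (H d K : ℕ) : ℝ :=
  C * (κ * H * (d : ℝ) ^ (3 / 2 : ℝ) / √K) * (1 + Real.log (d * H * K)) ^ q

end BCPVI

/-! The proof combines pessimism with an online-style elliptical potential argument.

Pessimism. Suppose every least-squares estimate is within its bonus of the Bellman backup of `vHat`.
Then `qHat` lies below that backup and at most two bonuses below it. Backward induction gives that
`vHat` underestimates the value of the extracted policy, and telescoping along the optimal policy
bounds the sub-optimality of pass k by twice the mean bonus under the density of `πstar`
(`MDP.subOpt_le_sum_bonus`). Greediness is used only against `πstar` at states that it visits;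
concentrability makes `πstar` admissible there.

Accuracy. The regression error is an inner product with a self-normalized noise sum. For a fixed
next-value function this sum is controlled by a supermartingale (`selfNormalized_bound`). The
estimate `vHat` depends on the data, so a union bound over a finite cover is needed. Although `vHat`
contains a maximization over policies, it is non-expansive in `qHat` (`abs_vHat_sub_le`), and `qHat`
is a function of d + d² bounded numbers, the weights and the inverse Gram matrix
(`exists_vHat_cover`). The logarithm of the size of the cover is of order d² log(dHK), which is why
the bonus scale is dH times a logarithm.

Change of measure. Where the density of `πstar` is positive it is at most 1, hence at most κ_h times
the density of the behaviour policy of any episode t. Elliptical norms decrease as data accumulate,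
so for every t ≤ k the sub-optimality of pass k is at most 2β Σ_h κ_h times the mean elliptical norm
under episode t (`MDP.subOpt_le_sum_meanEllNorm`). The choice t = k, averaged over k, treats the
mixture; the last iterate takes k = K + 1 and averages over all t ≤ K. Both therefore have the same
bound.

Summation. The sum over t of these conditional means is at most twice the sum of the realized norms
plus a logarithm, by a multiplicative supermartingale (`measureReal_sum_condMean_le`). The realized
sum is of order √(dK log K) by the elliptical potential lemma. Multiplying by β/K gives the rate.
The bad event has probability at most 2/K and costs at most H there, which gives the bound in
expectation; for K < 5 the rate exceeds H. -/

namespace BCPVI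

set_option linter.unusedSectionVars false

/-! ### Inverse Gram forms, rank-one updates and the elliptical potential. -/

section LinearAlgebra

variable {d : ℕ}

/-- The bilinear form `uᵀ A⁻¹ v`. -/
noncomputable def invForm (A : Matrix (Fin d) (Fin d) ℝ) (u v : Fin d → ℝ) : ℝ :=
  u ⬝ᵥ (A⁻¹ *ᵥ v)

lemma invForm_add_right (A : Matrix (Fin d) (Fin d) ℝ) (u v v' : Fin d → ℝ) :
    invForm A u (v + v') = invForm A u v + invForm A u v' := by
  simp [invForm, Matrix.mulVec_add, dotProduct_add]

lemma invForm_smul_right (A : Matrix (Fin d) (Fin d) ℝ) (c : ℝ) (u v : Fin d → ℝ) :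
    invForm A u (c • v) = c * invForm A u v := by
  simp [invForm, Matrix.mulVec_smul, dotProduct_smul]

lemma invForm_add_left (A : Matrix (Fin d) (Fin d) ℝ) (u u' v : Fin d → ℝ) :
    invForm A (u + u') v = invForm A u v + invForm A u' v := by
  simp [invForm, add_dotProduct]

lemma invForm_smul_left (A : Matrix (Fin d) (Fin d) ℝ) (c : ℝ) (u v : Fin d → ℝ) :
    invForm A (c • u) v = c * invForm A u v := by
  simp [invForm, smul_dotProduct]

lemma invForm_sum_right {ι : Type*} (A : Matrix (Fin d) (Fin d) ℝ) (s : Finset ι) (u : Fin d → ℝ)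
    (f : ι → Fin d → ℝ) : invForm A u (∑ i ∈ s, f i) = ∑ i ∈ s, invForm A u (f i) := by
  simp [invForm, Matrix.mulVec_sum, dotProduct_sum]

lemma invForm_comm {A : Matrix (Fin d) (Fin d) ℝ} (hA : A.PosDef) (u v : Fin d → ℝ) :
    invForm A u v = invForm A v u := by
  have h : (A⁻¹)ᵀ = A⁻¹ := by simpa using hA.inv.isHermitian.eq
  unfold invForm
  rw [Matrix.dotProduct_mulVec, ← Matrix.mulVec_transpose, h, dotProduct_comm]

lemma invForm_self_nonneg {A : Matrix (Fin d) (Fin d) ℝ} (hA : A.PosDef) (u : Fin d → ℝ) :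
    0 ≤ invForm A u u := by
  simpa [invForm] using hA.inv.posSemidef.dotProduct_mulVec_nonneg u

lemma invForm_sq_le {A : Matrix (Fin d) (Fin d) ℝ} (hA : A.PosDef) (u v : Fin d → ℝ) :
    invForm A u v ^ 2 ≤ invForm A u u * invForm A v v := by
  have key : ∀ x : ℝ, 0 ≤ invForm A v v * (x * x) + 2 * invForm A u v * x + invForm A u u := by
    intro x
    have h := invForm_self_nonneg hA (u + x • v)
    simp only [invForm_add_left, invForm_add_right, invForm_smul_left, invForm_smul_right,
      invForm_comm hA v u] at h
    linarith
  have := discrim_le_zero key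
  unfold discrim at this
  nlinarith

lemma abs_invForm_le {A : Matrix (Fin d) (Fin d) ℝ} (hA : A.PosDef) (u v : Fin d → ℝ) :
    |invForm A u v| ≤ √(invForm A u u) * √(invForm A v v) := by
  rw [← Real.sqrt_mul (invForm_self_nonneg hA u)]
  exact Real.abs_le_sqrt (invForm_sq_le hA u v)

lemma sqrt_invForm_add_le {A : Matrix (Fin d) (Fin d) ℝ} (hA : A.PosDef) (u v : Fin d → ℝ) :
    √(invForm A (u + v) (u + v)) ≤ √(invForm A u u) + √(invForm A v v) := by
  apply Real.sqrt_le_iff.2 ⟨by positivity, ?_⟩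
  have h := (le_abs_self _).trans (abs_invForm_le hA u v)
  have h1 := Real.sq_sqrt (invForm_self_nonneg hA u)
  have h2 := Real.sq_sqrt (invForm_self_nonneg hA v)
  simp only [invForm_add_left, invForm_add_right, invForm_comm hA v u]
  nlinarith

lemma sqrt_invForm_smul (A : Matrix (Fin d) (Fin d) ℝ) (c : ℝ) (u : Fin d → ℝ) :
    √(invForm A (c • u) (c • u)) = |c| * √(invForm A u u) := by
  rw [invForm_smul_left, invForm_smul_right, ← mul_assoc, Real.sqrt_mul (mul_self_nonneg c),
    Real.sqrt_mul_self_eq_abs]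

lemma sqrt_invForm_sum_le {ι : Type*} {A : Matrix (Fin d) (Fin d) ℝ} (hA : A.PosDef)
    (s : Finset ι) (f : ι → Fin d → ℝ) :
    √(invForm A (∑ i ∈ s, f i) (∑ i ∈ s, f i)) ≤ ∑ i ∈ s, √(invForm A (f i) (f i)) := by
  classical
  induction s using Finset.induction_on with
  | empty => simp [invForm]
  | insert i s hi ih =>
    rw [Finset.sum_insert hi, Finset.sum_insert hi]
    exact (sqrt_invForm_add_le hA _ _).trans (by gcongr)

lemma posDef_add_vecMulVec {A : Matrix (Fin d) (Fin d) ℝ} (hA : A.PosDef) (x : Fin d → ℝ) :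
    (A + Matrix.vecMulVec x x).PosDef := by
  have := Matrix.posSemidef_vecMulVec_self_star x
  exact hA.add_posSemidef (by simpa using this)

/-- The Sherman–Morrison formula. -/
lemma inv_add_vecMulVec_mulVec {A : Matrix (Fin d) (Fin d) ℝ} (hA : A.PosDef)
    (x v : Fin d → ℝ) :
    (A + Matrix.vecMulVec x x)⁻¹ *ᵥ v =
      A⁻¹ *ᵥ v - (invForm A x v / (1 + invForm A x x)) • (A⁻¹ *ᵥ x) := by
  have hB := posDef_add_vecMulVec hA x
  have hAu : IsUnit A.det := (Matrix.isUnit_iff_isUnit_det _).1 hA.isUnit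
  have hBu : IsUnit (A + Matrix.vecMulVec x x).det := (Matrix.isUnit_iff_isUnit_det _).1 hB.isUnit
  have hw := invForm_self_nonneg hA x
  have key : (A + Matrix.vecMulVec x x) *ᵥ
      (A⁻¹ *ᵥ v - (invForm A x v / (1 + invForm A x x)) • (A⁻¹ *ᵥ x)) = v := by
    have e : ∀ z, A *ᵥ (A⁻¹ *ᵥ z) = z := fun z => by
      rw [Matrix.mulVec_mulVec, Matrix.mul_nonsing_inv _ hAu, Matrix.one_mulVec]
    rw [Matrix.mulVec_sub, Matrix.mulVec_smul, Matrix.add_mulVec, Matrix.add_mulVec, e, e,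
      Matrix.vecMulVec_mulVec, Matrix.vecMulVec_mulVec]
    change v + MulOpposite.op (invForm A x v) • x -
      (invForm A x v / (1 + invForm A x x)) • (x + MulOpposite.op (invForm A x x) • x) = v
    ext i
    simp
    field_simp
    ring
  conv_lhs => rw [← key]
  rw [Matrix.mulVec_mulVec, Matrix.nonsing_inv_mul _ hBu, Matrix.one_mulVec]

lemma invForm_add_vecMulVec {A : Matrix (Fin d) (Fin d) ℝ} (hA : A.PosDef)
    (x u v : Fin d → ℝ) :
    invForm (A + Matrix.vecMulVec x x) u v =
      invForm A u v - invForm A x u * invForm A x v / (1 + invForm A x x) := by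
  conv_lhs => unfold invForm
  rw [inv_add_vecMulVec_mulVec hA, dotProduct_sub, dotProduct_smul]
  change invForm A u v - _ * invForm A u x = _
  rw [invForm_comm hA u x]
  ring

/-- One step of the recursion for `‖S‖²` in the inverse norm of the regularized Gram matrix. -/
lemma invForm_update {A : Matrix (Fin d) (Fin d) ℝ} (hA : A.PosDef) (x S : Fin d → ℝ) (η : ℝ) :
    invForm (A + Matrix.vecMulVec x x) (S + η • x) (S + η • x) =
      invForm A S S + (2 * η * invForm A x S - invForm A x S ^ 2 + η ^ 2 * invForm A x x) /
        (1 + invForm A x x) := by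
  have hw := invForm_self_nonneg hA x
  rw [invForm_add_vecMulVec hA]
  simp only [invForm_add_left, invForm_add_right, invForm_smul_left, invForm_smul_right,
    invForm_comm hA S x]
  field_simp
  ring

/-- The matrix determinant lemma; it turns the potential into a telescoping log-determinant. -/
lemma det_add_vecMulVec {A : Matrix (Fin d) (Fin d) ℝ} (hA : A.PosDef) (x : Fin d → ℝ) :
    (A + Matrix.vecMulVec x x).det = A.det * (1 + invForm A x x) := by
  have hAu : IsUnit A.det := (Matrix.isUnit_iff_isUnit_det _).1 hA.isUnit
  rw [Matrix.vecMulVec_eq Unit, Matrix.det_add_replicateCol_mul_replicateRow hAu]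
  congr 1
  rw [Matrix.det_unique]
  simp [invForm, Matrix.add_apply, Matrix.mul_assoc, Matrix.mul_apply, Matrix.mulVec, dotProduct]

/-- The regularized Gram matrix of `x 1, …, x (k - 1)`. -/
noncomputable def regGram (x : ℕ → Fin d → ℝ) (k : ℕ) : Matrix (Fin d) (Fin d) ℝ :=
  (∑ t ∈ Finset.Ico 1 k, Matrix.vecMulVec (x t) (x t)) + 1

lemma regGram_one (x : ℕ → Fin d → ℝ) : regGram x 1 = 1 := by simp [regGram]

lemma regGram_succ (x : ℕ → Fin d → ℝ) {k : ℕ} (hk : 1 ≤ k) :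
    regGram x (k + 1) = regGram x k + Matrix.vecMulVec (x k) (x k) := by
  rw [regGram, regGram, Finset.sum_Ico_succ_top hk, add_right_comm]

lemma regGram_posDef (x : ℕ → Fin d → ℝ) (k : ℕ) : (regGram x k).PosDef := by
  unfold regGram
  rw [add_comm]
  refine Matrix.PosDef.one.add_posSemidef (Matrix.posSemidef_sum _ fun t _ => ?_)
  simpa using Matrix.posSemidef_vecMulVec_self_star (x t)

/-- By Sherman–Morrison, each new observation subtracts a nonnegative term. This monotonicity later
lets any earlier episode bound the bonus of pass k. -/
lemma invForm_regGram_antitone (x : ℕ → Fin d → ℝ) {k l : ℕ} (hk : 1 ≤ k) (hl : k ≤ l)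
    (v : Fin d → ℝ) : invForm (regGram x l) v v ≤ invForm (regGram x k) v v := by
  induction l, hl using Nat.le_induction with
  | base => rfl
  | succ l hl ih =>
    refine le_trans ?_ ih
    have hA := regGram_posDef x l
    have := invForm_self_nonneg hA (x l)
    rw [regGram_succ x (hk.trans hl), invForm_add_vecMulVec hA]
    have : 0 ≤ invForm (regGram x l) (x l) v * invForm (regGram x l) (x l) v /
      (1 + invForm (regGram x l) (x l) (x l)) := div_nonneg (mul_self_nonneg _) (by linarith)
    linarith

lemma invForm_regGram_le (x : ℕ → Fin d → ℝ) {k : ℕ} (hk : 1 ≤ k) (v : Fin d → ℝ) :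
    invForm (regGram x k) v v ≤ v ⬝ᵥ v := by
  refine (invForm_regGram_antitone x le_rfl hk v).trans ?_
  simp [regGram_one, invForm]

/-- Each eigenvalue is a Rayleigh quotient at a unit vector: k - 1 rank-one terms, each at most 1 by
Cauchy–Schwarz, plus 1 from the identity. -/
lemma det_regGram_le {x : ℕ → Fin d → ℝ} {k : ℕ} (hk : 1 ≤ k)
    (hx : ∀ t ∈ Finset.Ico 1 k, x t ⬝ᵥ x t ≤ 1) : (regGram x k).det ≤ (k : ℝ) ^ d := by
  have hH := (regGram_posDef x k).isHermitian
  rw [hH.det_eq_prod_eigenvalues]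
  have hle : ∀ i, hH.eigenvalues i ≤ k := by
    intro i
    set v := (hH.eigenvectorBasis i).ofLp with hv
    have hv1 : v ⬝ᵥ v = 1 := by
      have h1 : ‖hH.eigenvectorBasis i‖ = 1 := hH.eigenvectorBasis.orthonormal.1 i
      have h2 := EuclideanSpace.real_norm_sq_eq (hH.eigenvectorBasis i)
      rw [h1] at h2
      simp only [dotProduct, hv]
      calc _ = ∑ j, (hH.eigenvectorBasis i).ofLp j ^ 2 := by simp [sq]
        _ = 1 := by rw [← h2]; norm_num
    rw [hH.eigenvalues_eq i]
    simp only [star_trivial, RCLike.re_to_real]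
    rw [← hv, regGram, Matrix.add_mulVec, Matrix.sum_mulVec, dotProduct_add, Matrix.one_mulVec,
      hv1, dotProduct_sum]
    have : ∑ t ∈ Finset.Ico 1 k, v ⬝ᵥ Matrix.vecMulVec (x t) (x t) *ᵥ v
        ≤ ∑ t ∈ Finset.Ico 1 k, (1 : ℝ) := by
      apply Finset.sum_le_sum
      intro t ht
      have h1 : v ⬝ᵥ Matrix.vecMulVec (x t) (x t) *ᵥ v = (x t ⬝ᵥ v) ^ 2 := by
        rw [Matrix.vecMulVec_mulVec]
        simp [dotProduct_comm v (x t), sq]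
      have h2 : (x t ⬝ᵥ v) ^ 2 ≤ (x t ⬝ᵥ x t) * (v ⬝ᵥ v) := by
        simpa [dotProduct, sq] using
          Finset.sum_mul_sq_le_sq_mul_sq Finset.univ (x t) v
      rw [h1]
      nlinarith [hx t ht]
    rw [Finset.sum_const, Nat.card_Ico, nsmul_eq_mul, mul_one, Nat.cast_sub hk] at this
    push_cast at this
    linarith
  calc ∏ i, ((hH.eigenvalues i : ℝ) : ℝ) ≤ ∏ _i : Fin d, (k : ℝ) :=
        Finset.prod_le_prod (fun i _ => (regGram_posDef x k).posSemidef.eigenvalues_nonneg i)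
          (fun i _ => hle i)
    _ = _ := by simp

/-- The elliptical potential lemma. -/
lemma sum_potential_le {x : ℕ → Fin d → ℝ} {k : ℕ} (hk : 1 ≤ k)
    (hx : ∀ t ∈ Finset.Ico 1 k, x t ⬝ᵥ x t ≤ 1) :
    ∑ t ∈ Finset.Ico 1 k, invForm (regGram x t) (x t) (x t) /
      (1 + invForm (regGram x t) (x t) (x t)) ≤ d * Real.log k := by
  have h : ∀ l, 1 ≤ l → ∑ t ∈ Finset.Ico 1 l, invForm (regGram x t) (x t) (x t) /
      (1 + invForm (regGram x t) (x t) (x t)) ≤ Real.log (regGram x l).det := by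
    intro l hl
    induction l, hl using Nat.le_induction with
    | base => simp [regGram_one]
    | succ l hl ih =>
      have hA := regGram_posDef x l
      have hw := invForm_self_nonneg hA (x l)
      rw [Finset.sum_Ico_succ_top hl, regGram_succ x hl, det_add_vecMulVec hA,
        Real.log_mul hA.det_pos.ne' (by positivity)]
      refine add_le_add ih ?_
      -- With w the new squared norm, w / (1 + w) = 1 - (1 + w)⁻¹ ≤ log (1 + w), the increment of
      -- the log-determinant.
      have h1 := Real.one_sub_inv_le_log_of_pos (x := 1 + invForm (regGram x l) (x l) (x l))
        (by positivity)
      refine le_trans (le_of_eq ?_) h1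
      rw [div_eq_iff (by positivity), sub_mul, inv_mul_cancel₀ (by positivity)]
      ring
  refine (h k hk).trans ?_
  rw [← Real.log_pow]
  exact Real.log_le_log (regGram_posDef x k).det_pos (det_regGram_le hk hx)

/-- Cauchy–Schwarz reduces this to the sum of squared norms w. Since the Gram matrix dominates the
identity, w ≤ 1, so w ≤ 2w / (1 + w) and the potential lemma applies at the cost of a factor 2. -/
lemma sum_sqrt_invForm_le {x : ℕ → Fin d → ℝ} {k : ℕ} (hk : 1 ≤ k)
    (hx : ∀ t ∈ Finset.Ico 1 k, x t ⬝ᵥ x t ≤ 1) :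
    ∑ t ∈ Finset.Ico 1 k, √(invForm (regGram x t) (x t) (x t)) ≤ √(2 * k * d * Real.log k) := by
  apply Real.le_sqrt_of_sq_le
  have h1 := sq_sum_le_card_mul_sum_sq (s := Finset.Ico 1 k)
    (f := fun t => √(invForm (regGram x t) (x t) (x t)))
  have h2 : ∑ t ∈ Finset.Ico 1 k, √(invForm (regGram x t) (x t) (x t)) ^ 2 ≤
      2 * (d * Real.log k) := by
    refine le_trans ?_ (mul_le_mul_of_nonneg_left (sum_potential_le hk hx) zero_le_two)
    rw [Finset.mul_sum]
    refine Finset.sum_le_sum fun t ht => ?_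
    have hw := invForm_self_nonneg (regGram_posDef x t) (x t)
    have hw1 := (invForm_regGram_le x (Finset.mem_Ico.1 ht).1 (x t)).trans (hx t ht)
    rw [Real.sq_sqrt hw, ← mul_div_assoc, le_div_iff₀ (by positivity)]
    nlinarith
  refine h1.trans ?_
  have h3 : (0:ℝ) ≤ ∑ t ∈ Finset.Ico 1 k, √(invForm (regGram x t) (x t) (x t)) ^ 2 :=
    Finset.sum_nonneg fun _ _ => sq_nonneg _
  have h4 : ((Finset.Ico 1 k).card : ℝ) ≤ k := by
    rw [Nat.card_Ico]; exact_mod_cast Nat.sub_le _ _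
  calc _ ≤ (k:ℝ) * (2 * (d * Real.log k)) := by gcongr
    _ = _ := by ring

end LinearAlgebra

/-! ### Measurability of inverse Gram forms. -/

section Measurability

variable {d : ℕ} {X : Type*} {mX : MeasurableSpace X}

lemma measurable_invForm {A : X → Matrix (Fin d) (Fin d) ℝ} (hA : ∀ i j, Measurable fun x => A x i j)
    {u v : X → Fin d → ℝ} (hu : ∀ i, Measurable fun x => u x i)
    (hv : ∀ i, Measurable fun x => v x i) : Measurable fun x => invForm (A x) (u x) (v x) := by
  have hA' : Measurable fun x => (fun i j => A x i j : Fin d → Fin d → ℝ) :=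
    measurable_pi_lambda _ fun i => measurable_pi_lambda _ fun j => hA i j
  have hdet : Measurable fun x => (A x).det :=
    have hc : Continuous fun B : Fin d → Fin d → ℝ => (Matrix.of B).det :=
      Continuous.matrix_det continuous_id
    hc.measurable.comp hA'
  have hadj : ∀ i j, Measurable fun x => (A x).adjugate i j := fun i j =>
    have hc : Continuous fun B : Fin d → Fin d → ℝ => (Matrix.of B).adjugate i j :=
      (Continuous.matrix_adjugate continuous_id).matrix_elem i j
    hc.measurable.comp hA'
  -- Inversion is not continuous at singular matrices, but it is a continuous adjugate divided by a
  -- determinant, with 0⁻¹ = 0.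
  have hinv : ∀ i j, Measurable fun x => (A x)⁻¹ i j := by
    intro i j
    simp only [Matrix.inv_def, Ring.inverse_eq_inv', Matrix.smul_apply, smul_eq_mul]
    exact hdet.inv.mul (hadj i j)
  unfold invForm
  simp only [dotProduct, Matrix.mulVec]
  exact Finset.measurable_fun_sum _ fun i _ => (hu i).mul
    (Finset.measurable_fun_sum _ fun j _ => (hinv i j).mul (hv j))

lemma measurable_regGram {x : ℕ → X → Fin d → ℝ} {k : ℕ}
    (hx : ∀ t ∈ Finset.Ico 1 k, ∀ i, Measurable fun y => x t y i) (i j : Fin d) :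
    Measurable fun y => regGram (fun t => x t y) k i j := by
  simp only [regGram, Matrix.add_apply, Matrix.sum_apply, Matrix.vecMulVec_apply]
  exact (Finset.measurable_fun_sum _ fun t ht => (hx t ht i).mul (hx t ht j)).add_const _

end Measurability

/-! ### Integration against conditional densities. -/

section Disintegration

variable {Ω Ω' E : Type*} [MeasurableSpace Ω'] [MeasurableSpace E] {m mΩ : MeasurableSpace Ω}

/-- If `X` has conditional density `q (Y ω)` given `m`, where `Y` is `m`-measurable, then functions
of `(Y, X)` are integrated by integrating out `X` first. -/
lemma lintegral_of_condLaw (hm : m ≤ mΩ) {P : Measure Ω} [IsProbabilityMeasure P]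
    {lam : Measure E} [SigmaFinite lam] {Y : Ω → Ω'} (hY : Measurable[m] Y)
    {X : Ω → E} (hX : Measurable X) {q : Ω' → E → ℝ}
    (hq : Measurable fun z : Ω' × E => q z.1 z.2)
    (hq0 : ∀ ω e, 0 ≤ q (Y ω) e) (hq1 : ∀ ω, ∫ e, q (Y ω) e ∂lam = 1)
    (hc : ∀ B, MeasurableSet B →
      P⟦{ω | X ω ∈ B} | m⟧ =ᵐ[P] fun ω => ∫ e in B, q (Y ω) e ∂lam)
    {F : Ω' × E → ENNReal} (hF : Measurable F) :
    ∫⁻ ω, F (Y ω, X ω) ∂P = ∫⁻ ω, ∫⁻ e, F (Y ω, e) * ENNReal.ofReal (q (Y ω) e) ∂lam ∂P := by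
  have hY' : Measurable Y := hY.mono hm le_rfl
  have hqe : Measurable fun z : Ω' × E => ENNReal.ofReal (q z.1 z.2) := hq.ennreal_ofReal
  have hint : ∀ ω, Integrable (fun e => q (Y ω) e) lam := fun ω =>
    integrable_of_integral_eq_one (hq1 ω)
  -- The joint law has density `q` with respect to the law of `Y` times `lam`. Rectangles suffice,
  -- and on them the claim is the defining property of the conditional probability.
  have key : P.map (fun ω => (Y ω, X ω)) =
      ((P.map Y).prod lam).withDensity fun z => ENNReal.ofReal (q z.1 z.2) := by
    have hYX : Measurable fun ω => (Y ω, X ω) := hY'.prodMk hX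
    have : IsProbabilityMeasure (P.map fun ω => (Y ω, X ω)) :=
      Measure.isProbabilityMeasure_map hYX.aemeasurable
    refine Measure.ext_prod fun {s t} hs ht => ?_
    have hG : MeasurableSet[m] (Y ⁻¹' s) := hY hs
    rw [Measure.map_apply hYX (hs.prod ht), withDensity_apply _ (hs.prod ht),
      ← Measure.prod_restrict, lintegral_prod _ hqe.aemeasurable,
      setLIntegral_map hs hqe.lintegral_prod_right' hY']
    have h1 : ∀ ω, ∫⁻ e in t, ENNReal.ofReal (q (Y ω) e) ∂lam =
        ENNReal.ofReal (∫ e in t, q (Y ω) e ∂lam) := fun ω =>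
      (ofReal_integral_eq_lintegral_ofReal (hint ω).integrableOn
        (Filter.Eventually.of_forall (hq0 ω))).symm
    simp only [h1]
    have hi : Integrable (fun ω => ∫ e in t, q (Y ω) e ∂lam) P :=
      integrable_condExp.congr (hc t ht)
    rw [← ofReal_integral_eq_lintegral_ofReal hi.integrableOn
      (Filter.Eventually.of_forall fun ω => integral_nonneg (hq0 ω)),
      ← setIntegral_congr_ae (hm _ hG) ((hc t ht).mono fun ω h _ => h)]
    have hXt : MeasurableSet {ω | X ω ∈ t} := hX ht
    rw [setIntegral_condExp hm ((integrable_const _).indicator hXt) hG,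
      integral_indicator hXt, Measure.restrict_restrict hXt]
    simp only [integral_const, smul_eq_mul, mul_one, measureReal_restrict_apply_univ]
    rw [Measure.real, ENNReal.ofReal_toReal (measure_ne_top _ _), Set.inter_comm]
    rfl
  have h2 := lintegral_map hF (hY'.prodMk hX) (μ := P)
  rw [← h2, key, lintegral_withDensity_eq_lintegral_mul _ hqe hF,
    lintegral_prod _ (hqe.mul hF).aemeasurable,
    lintegral_map (hqe.mul hF).lintegral_prod_right' hY']
  simp [mul_comm]

lemma condExp_of_condLaw (hm : m ≤ mΩ) {P : Measure Ω} [IsProbabilityMeasure P]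
    {lam : Measure E} [SigmaFinite lam] {Y : Ω → Ω'} (hY : Measurable[m] Y)
    {X : Ω → E} (hX : Measurable X) {q : Ω' → E → ℝ}
    (hq : Measurable fun z : Ω' × E => q z.1 z.2)
    (hq0 : ∀ ω e, 0 ≤ q (Y ω) e) (hq1 : ∀ ω, ∫ e, q (Y ω) e ∂lam = 1)
    (hc : ∀ B, MeasurableSet B →
      P⟦{ω | X ω ∈ B} | m⟧ =ᵐ[P] fun ω => ∫ e in B, q (Y ω) e ∂lam)
    {V : E → ℝ} (hV : Measurable V) (hV0 : ∀ e, 0 ≤ V e) {B : ℝ} (hVB : ∀ e, V e ≤ B) :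
    P[fun ω => V (X ω) | m] =ᵐ[P] fun ω => ∫ e, V e * q (Y ω) e ∂lam := by
  have hint : ∀ ω, Integrable (fun e => q (Y ω) e) lam := fun ω =>
    integrable_of_integral_eq_one (hq1 ω)
  have hVq : ∀ ω, Integrable (fun e => V e * q (Y ω) e) lam := fun ω =>
    (hint ω).bdd_mul hV.aestronglyMeasurable
      (c := B) (Filter.Eventually.of_forall fun e => by
        rw [Real.norm_eq_abs, abs_of_nonneg (hV0 e)]; exact hVB e)
  have hVX : Integrable (fun ω => V (X ω)) P :=
    Integrable.of_bound (hV.comp hX).aestronglyMeasurable B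
      (Filter.Eventually.of_forall fun ω => by
        rw [Real.norm_eq_abs, abs_of_nonneg (hV0 _)]; exact hVB _)
  have hsm : Measurable[m] fun ω => ∫ e, V e * q (Y ω) e ∂lam := by
    have h0 : StronglyMeasurable fun y => ∫ e, V e * q y e ∂lam :=
      StronglyMeasurable.integral_prod_right'
        (f := fun z : Ω' × E => V z.2 * q z.1 z.2)
        ((hV.comp measurable_snd).mul hq).stronglyMeasurable
    exact h0.measurable.comp hY
  have h0 : ∀ ω, 0 ≤ ∫ e, V e * q (Y ω) e ∂lam := fun ω =>
    integral_nonneg fun e => mul_nonneg (hV0 e) (hq0 ω e)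
  have hle : ∀ ω, ∫ e, V e * q (Y ω) e ∂lam ≤ B := fun ω => by
    calc _ ≤ ∫ e, B * q (Y ω) e ∂lam :=
          integral_mono (hVq ω) ((hint ω).const_mul B)
            fun e => mul_le_mul_of_nonneg_right (hVB e) (hq0 ω e)
      _ = B := by rw [integral_const_mul, hq1, mul_one]
  have hi : Integrable (fun ω => ∫ e, V e * q (Y ω) e ∂lam) P :=
    Integrable.of_bound (hsm.mono hm le_rfl).aestronglyMeasurable B
      (Filter.Eventually.of_forall fun ω => by
        rw [Real.norm_eq_abs, abs_of_nonneg (h0 ω)]; exact hle ω)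
  refine (ae_eq_condExp_of_forall_setIntegral_eq hm hVX (fun s _ _ => hi.integrableOn) ?_
    hsm.stronglyMeasurable.aestronglyMeasurable).symm
  intro G hG _
  have hG' := hm _ hG
  have hF : @Measurable _ _ (m.prod inferInstance) _ fun z : Ω × E =>
      G.indicator (fun _ => (1 : ENNReal)) z.1 * ENNReal.ofReal (V z.2) := by
    refine Measurable.mul ?_ ?_
    · exact (Measurable.indicator measurable_const hG).comp (@measurable_fst _ _ m _)
    · exact hV.ennreal_ofReal.comp (@measurable_snd _ _ m _)
  -- The conditioning variable is now the identity into (Ω, m), so that the indicator of an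
  -- arbitrary m-measurable `G` is an admissible test function.
  have h1 := @lintegral_of_condLaw Ω Ω E m _ m mΩ hm P _ lam _ id (@measurable_id _ m) X hX
    (fun ω e => q (Y ω) e)
    (hq.comp ((hY.comp (@measurable_fst _ _ m _)).prodMk (@measurable_snd _ _ m _)))
    hq0 hq1 hc _ hF
  simp only [id] at h1
  rw [← integral_indicator hG', ← integral_indicator hG',
    integral_eq_lintegral_of_nonneg_ae
      (Filter.Eventually.of_forall fun ω => Set.indicator_nonneg (fun _ _ => h0 _) _)
      (hi.indicator hG').aestronglyMeasurable,
    integral_eq_lintegral_of_nonneg_ae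
      (Filter.Eventually.of_forall fun ω => Set.indicator_nonneg (fun _ _ => hV0 _) _)
      (hVX.indicator hG').aestronglyMeasurable]
  congr 1
  have e1 : ∀ ω, ENNReal.ofReal (G.indicator (fun ω => V (X ω)) ω) =
      G.indicator (fun _ => (1 : ENNReal)) ω * ENNReal.ofReal (V (X ω)) := by
    intro ω; by_cases h : ω ∈ G <;> simp [h]
  have e2 : ∀ ω, ENNReal.ofReal (G.indicator (fun ω => ∫ e, V e * q (Y ω) e ∂lam) ω) =
      ∫⁻ e, G.indicator (fun _ => (1 : ENNReal)) ω * ENNReal.ofReal (V e) *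
        ENNReal.ofReal (q (Y ω) e) ∂lam := by
    intro ω
    by_cases h : ω ∈ G
    · simp only [h, Set.indicator_of_mem, one_mul]
      rw [ofReal_integral_eq_lintegral_ofReal (hVq ω)
        (Filter.Eventually.of_forall fun e => mul_nonneg (hV0 e) (hq0 ω e))]
      exact lintegral_congr fun e => ENNReal.ofReal_mul (hV0 e)
    · simp [h]
  simp only [e1, e2]
  exact h1.symm

end Disintegration

/-! ### A self-normalized concentration inequality for bounded noise. -/

section SelfNormalized

variable {d : ℕ} {Ω : Type*} {mΩ : MeasurableSpace Ω}

/-- The right side is the chord of exp over [-a, a]. It is affine in η, so noise of conditional mean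
zero removes the sinh term. -/
lemma exp_mul_le_cosh_add {η : ℝ} (hη : |η| ≤ 1) (a : ℝ) :
    Real.exp (η * a) ≤ Real.cosh a + η * Real.sinh a := by
  have h := abs_le.1 hη
  have hc := convexOn_exp.2 (Set.mem_univ (-a)) (Set.mem_univ a)
    (by linarith : 0 ≤ (1 - η) / 2) (by linarith : 0 ≤ (1 + η) / 2) (by ring)
  have e : ((1 - η) / 2) • (-a) + ((1 + η) / 2) • a = η * a := by simp; ring
  rw [e] at hc
  refine hc.trans (le_of_eq ?_)
  rw [Real.cosh_eq, Real.sinh_eq]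
  simp
  ring

lemma integral_mul_eq_zero_of_condExp {Ω : Type*} {m mΩ : MeasurableSpace Ω} (hm : m ≤ mΩ) {P : Measure Ω}
    [IsProbabilityMeasure P] {f η : Ω → ℝ} (hf : Measurable[m] f) (hfη : Integrable (f * η) P)
    (hη : Integrable η P) (h0 : P[η | m] =ᵐ[P] 0) : ∫ ω, f ω * η ω ∂P = 0 := by
  have h := condExp_mul_of_stronglyMeasurable_left hf.stronglyMeasurable hfη hη
  calc ∫ ω, f ω * η ω ∂P = ∫ ω, (P[f * η | m]) ω ∂P := (integral_condExp (f := f * η) hm).symm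
    _ = ∫ ω, (0 : ℝ) ∂P := by
        refine integral_congr_ae ?_
        filter_upwards [h, h0] with ω h1 h2
        rw [h1, Pi.mul_apply, h2]; simp
    _ = 0 := by simp

/-- The vector-valued martingale `∑_{t < k} η_t x_t`. -/
def noiseSum (x : ℕ → Fin d → ℝ) (η : ℕ → ℝ) (k : ℕ) : Fin d → ℝ :=
  ∑ t ∈ Finset.Ico 1 k, η t • x t

lemma noiseSum_succ (x : ℕ → Fin d → ℝ) (η : ℕ → ℝ) {k : ℕ} (hk : 1 ≤ k) :
    noiseSum x η (k + 1) = noiseSum x η k + η k • x k := by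
  rw [noiseSum, noiseSum, Finset.sum_Ico_succ_top hk]

/-- The exponent of the self-normalized supermartingale. -/
noncomputable def selfNormExponent (x : ℕ → Fin d → ℝ) (η : ℕ → ℝ) (k : ℕ) : ℝ :=
  (invForm (regGram x k) (noiseSum x η k) (noiseSum x η k) -
    ∑ t ∈ Finset.Ico 1 k, invForm (regGram x t) (x t) (x t) /
      (1 + invForm (regGram x t) (x t) (x t))) / 2

/-- By the rank-one update, with a = y / (1 + w), the exponent grows by at most ηa - a²/2: the term
y² / (1 + w) dominates a², and η²w / (1 + w) is absorbed by the compensator. The number a is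
predictable, so E exp(ηa) ≤ cosh a ≤ exp(a²/2) will close the supermartingale step without a mixture
over directions. -/
lemma exp_selfNormExponent_succ_le (x : ℕ → Fin d → ℝ) (η : ℕ → ℝ) {k : ℕ} (hk : 1 ≤ k)
    (hη : |η k| ≤ 1) :
    ∃ a : ℝ, a = invForm (regGram x k) (x k) (noiseSum x η k) /
        (1 + invForm (regGram x k) (x k) (x k)) ∧
      Real.exp (selfNormExponent x η (k + 1)) ≤
        Real.exp (selfNormExponent x η k) *
          (Real.exp (-(a ^ 2 / 2)) * (Real.cosh a + η k * Real.sinh a)) := by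
  refine ⟨_, rfl, ?_⟩
  have hA := regGram_posDef x k
  set w := invForm (regGram x k) (x k) (x k) with hw
  have hw0 : 0 ≤ w := invForm_self_nonneg hA (x k)
  set y := invForm (regGram x k) (x k) (noiseSum x η k) with hy
  have hstep : selfNormExponent x η (k + 1) ≤
      selfNormExponent x η k + (-((y / (1 + w)) ^ 2 / 2) + η k * (y / (1 + w))) := by
    unfold selfNormExponent
    rw [regGram_succ x hk, noiseSum_succ x η hk, invForm_update hA, Finset.sum_Ico_succ_top hk,
      ← hw, ← hy]
    have hη2 : η k ^ 2 ≤ 1 := (sq_le_one_iff_abs_le_one _).2 hη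
    have h1 : (2 * η k * y - y ^ 2 + η k ^ 2 * w) / (1 + w) ≤
        2 * (η k * (y / (1 + w))) - (y / (1 + w)) ^ 2 + w / (1 + w) := by
      have h2 : (y / (1 + w)) ^ 2 ≤ y ^ 2 / (1 + w) := by
        rw [div_pow]
        exact div_le_div_of_nonneg_left (sq_nonneg y) (by positivity) (by nlinarith)
      have h3 : η k ^ 2 * w / (1 + w) ≤ w / (1 + w) := by
        gcongr
        nlinarith
      have h4 : (2 * η k * y - y ^ 2 + η k ^ 2 * w) / (1 + w) =
        2 * (η k * (y / (1 + w))) - y ^ 2 / (1 + w) + η k ^ 2 * w / (1 + w) := by ring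
      linarith
    linarith
  calc _ ≤ Real.exp (selfNormExponent x η k +
        (-((y / (1 + w)) ^ 2 / 2) + η k * (y / (1 + w)))) := Real.exp_le_exp.2 hstep
    _ = Real.exp (selfNormExponent x η k) *
        (Real.exp (-((y / (1 + w)) ^ 2 / 2)) * Real.exp (η k * (y / (1 + w)))) := by
      rw [Real.exp_add, Real.exp_add]
    _ ≤ _ := by gcongr; exact exp_mul_le_cosh_add hη _

variable {P : Measure Ω} [IsProbabilityMeasure P] {𝒢 : ℕ → MeasurableSpace Ω}
  {x : ℕ → Ω → Fin d → ℝ} {η : ℕ → Ω → ℝ} {n : ℕ}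

lemma measurable_noiseSum {m : MeasurableSpace Ω} {k : ℕ}
    (hx : ∀ t ∈ Finset.Ico 1 k, ∀ i, Measurable[m] fun ω => x t ω i)
    (hη : ∀ t ∈ Finset.Ico 1 k, Measurable[m] (η t)) (i : Fin d) :
    Measurable[m] fun ω => noiseSum (fun t => x t ω) (fun t => η t ω) k i := by
  simp only [noiseSum, Finset.sum_apply, Pi.smul_apply, smul_eq_mul]
  exact Finset.measurable_fun_sum _ fun t ht => (hη t ht).mul (hx t ht i)

lemma measurable_selfNormExponent {m : MeasurableSpace Ω} {k : ℕ}
    (hx : ∀ t ∈ Finset.Ico 1 k, ∀ i, Measurable[m] fun ω => x t ω i)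
    (hη : ∀ t ∈ Finset.Ico 1 k, Measurable[m] (η t)) :
    Measurable[m] fun ω => selfNormExponent (fun t => x t ω) (fun t => η t ω) k := by
  unfold selfNormExponent
  refine Measurable.div_const (Measurable.sub ?_ ?_) _
  · exact measurable_invForm (measurable_regGram hx) (measurable_noiseSum hx hη)
      (measurable_noiseSum hx hη)
  · refine Finset.measurable_fun_sum _ fun t ht => ?_
    have h : Measurable[m] fun ω => invForm (regGram (fun t => x t ω) t) (x t ω) (x t ω) :=
      measurable_invForm (measurable_regGram fun s hs =>
        hx s (Finset.Ico_subset_Ico_right (Finset.mem_Ico.1 ht).2.le hs)) (hx t ht) (hx t ht)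
    exact h.div (h.const_add 1)

/-- The exponential of `selfNormExponent` is integrable with integral at most `1`. -/
lemma integral_exp_selfNormExponent_le
    (h𝒢 : ∀ t ∈ Finset.Ico 1 n, 𝒢 t ≤ mΩ)
    (hx : ∀ t ∈ Finset.Ico 1 n, ∀ k ∈ Finset.Ico 1 n, t ≤ k → ∀ i, Measurable[𝒢 k] fun ω => x t ω i)
    (hη : ∀ t ∈ Finset.Ico 1 n, ∀ k ∈ Finset.Ico 1 n, t < k → Measurable[𝒢 k] (η t))
    (hηm : ∀ t ∈ Finset.Ico 1 n, Measurable (η t))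
    (hη1 : ∀ t ∈ Finset.Ico 1 n, ∀ᵐ ω ∂P, |η t ω| ≤ 1)
    (hη0 : ∀ t ∈ Finset.Ico 1 n, P[η t | 𝒢 t] =ᵐ[P] 0) (k : ℕ) (hk : 1 ≤ k) (hkn : k ≤ n) :
    Integrable (fun ω => Real.exp (selfNormExponent (fun t => x t ω) (fun t => η t ω) k)) P ∧
    ∫ ω, Real.exp (selfNormExponent (fun t => x t ω) (fun t => η t ω) k) ∂P ≤ 1 := by
  induction k, hk using Nat.le_induction with
  | base => simp [selfNormExponent, noiseSum, invForm]
  | succ k hk ih =>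
    obtain ⟨ihi, ih1⟩ := ih (by omega)
    have hkm : k ∈ Finset.Ico 1 n := Finset.mem_Ico.2 ⟨hk, hkn⟩
    have hsub : ∀ t ∈ Finset.Ico 1 k, t ∈ Finset.Ico 1 n ∧ t < k := fun t ht => by
      simp only [Finset.mem_Ico] at ht ⊢; omega
    have hxk : ∀ t ∈ Finset.Ico 1 k, ∀ i, Measurable[𝒢 k] fun ω => x t ω i := fun t ht =>
      hx t (hsub t ht).1 k hkm (hsub t ht).2.le
    have hηk : ∀ t ∈ Finset.Ico 1 k, Measurable[𝒢 k] (η t) := fun t ht =>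
      hη t (hsub t ht).1 k hkm (hsub t ht).2
    have hxkk : ∀ i, Measurable[𝒢 k] fun ω => x k ω i := hx k hkm k hkm le_rfl
    set M : Ω → ℝ := fun ω =>
      Real.exp (selfNormExponent (fun t => x t ω) (fun t => η t ω) k) with hM
    set a : Ω → ℝ := fun ω =>
      invForm (regGram (fun t => x t ω) k) (x k ω) (noiseSum (fun t => x t ω) (fun t => η t ω) k) /
        (1 + invForm (regGram (fun t => x t ω) k) (x k ω) (x k ω)) with ha
    have hMm : Measurable[𝒢 k] M := (measurable_selfNormExponent hxk hηk).exp
    have ham : Measurable[𝒢 k] a := by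
      have h1 : Measurable[𝒢 k] fun ω => invForm (regGram (fun t => x t ω) k) (x k ω) (x k ω) :=
        measurable_invForm (measurable_regGram hxk) hxkk hxkk
      exact (measurable_invForm (measurable_regGram hxk) hxkk
        (measurable_noiseSum hxk hηk)).div (h1.const_add 1)
    -- The next exponential is at most c + s·η. Here c ≤ M because cosh a ≤ exp(a²/2), and s·η has
    -- mean zero; |s| ≤ c ≤ M gives its integrability.
    set c : Ω → ℝ := fun ω => M ω * (Real.exp (-(a ω ^ 2 / 2)) * Real.cosh (a ω)) with hc
    set s : Ω → ℝ := fun ω => M ω * (Real.exp (-(a ω ^ 2 / 2)) * Real.sinh (a ω)) with hs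
    have hexp : Measurable fun b : ℝ => Real.exp (-(b ^ 2 / 2)) := by fun_prop
    have hcosh : Measurable fun b : ℝ => Real.exp (-(b ^ 2 / 2)) * Real.cosh b :=
      hexp.mul Real.measurable_cosh
    have hsinh : Measurable fun b : ℝ => Real.exp (-(b ^ 2 / 2)) * Real.sinh b :=
      hexp.mul Real.measurable_sinh
    have hcm : Measurable[𝒢 k] c := hMm.mul (hcosh.comp ham)
    have hsm : Measurable[𝒢 k] s := hMm.mul (hsinh.comp ham)
    have hM0 : ∀ ω, 0 < M ω := fun ω => Real.exp_pos _
    have hcle : ∀ ω, Real.exp (-(a ω ^ 2 / 2)) * Real.cosh (a ω) ≤ 1 := fun ω => by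
      rw [Real.exp_neg, inv_mul_le_iff₀ (Real.exp_pos _), mul_one]
      exact Real.cosh_le_exp_half_sq _
    have hcM : ∀ ω, c ω ≤ M ω := fun ω => mul_le_of_le_one_right (hM0 ω).le (hcle ω)
    have hc0 : ∀ ω, 0 ≤ c ω := fun ω =>
      mul_nonneg (hM0 ω).le (mul_nonneg (Real.exp_pos _).le (Real.cosh_pos _).le)
    have hsc : ∀ ω, |s ω| ≤ c ω := fun ω => by
      rw [hs, hc]
      simp only [abs_mul, abs_of_pos (hM0 ω), abs_of_pos (Real.exp_pos _)]
      gcongr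
      · rw [abs_le, Real.cosh_eq, Real.sinh_eq]
        constructor <;> linarith [Real.exp_pos (a ω), Real.exp_pos (-a ω)]
    have hle := h𝒢 k hkm
    have hci : Integrable c P := ihi.mono' (hcm.mono hle le_rfl).aestronglyMeasurable
      (Filter.Eventually.of_forall fun ω => by
        rw [Real.norm_eq_abs, abs_of_nonneg (hc0 ω)]; exact hcM ω)
    have hsηi : Integrable (s * η k) P := ihi.mono'
      ((hsm.mono hle le_rfl).mul (hηm k hkm)).aestronglyMeasurable (by
        filter_upwards [hη1 k hkm] with ω h
        rw [Pi.mul_apply, norm_mul, Real.norm_eq_abs, Real.norm_eq_abs]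
        calc _ ≤ c ω * 1 := mul_le_mul (hsc ω) h (abs_nonneg _) (hc0 ω)
          _ ≤ _ := by rw [mul_one]; exact hcM ω)
    have hηi : Integrable (η k) P := Integrable.of_bound (hηm k hkm).aestronglyMeasurable 1 (hη1 k hkm)
    have hzero := integral_mul_eq_zero_of_condExp (P := P) (f := s) (η := η k) hle hsm hsηi hηi (hη0 k hkm)
    have hpt : ∀ᵐ ω ∂P, Real.exp (selfNormExponent (fun t => x t ω) (fun t => η t ω) (k + 1)) ≤
        c ω + s ω * η k ω := by
      filter_upwards [hη1 k hkm] with ω h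
      obtain ⟨b, hb, hle⟩ := exp_selfNormExponent_succ_le (fun t => x t ω) (fun t => η t ω) hk h
      refine hle.trans (le_of_eq ?_)
      have : b = a ω := hb
      rw [this]
      simp only [hc, hs, hM]
      ring
    have hnm : Measurable fun ω =>
        Real.exp (selfNormExponent (fun t => x t ω) (fun t => η t ω) (k + 1)) := by
      refine (measurable_selfNormExponent (fun t ht i => ?_) (fun t ht => ?_)).exp
      · have ht' : t ∈ Finset.Ico 1 n := by simp only [Finset.mem_Ico] at ht ⊢; omega
        exact (hx t ht' t ht' le_rfl i).mono (h𝒢 t ht') le_rfl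
      · exact hηm t (by simp only [Finset.mem_Ico] at ht ⊢; omega)
    have hdom : Integrable (fun ω => c ω + s ω * η k ω) P := hci.add hsηi
    have hni := hdom.mono' hnm.aestronglyMeasurable (hpt.mono fun ω h => by
      rw [Real.norm_eq_abs, abs_of_pos (Real.exp_pos _)]; exact h)
    refine ⟨hni, ?_⟩
    calc _ ≤ ∫ ω, (c ω + s ω * η k ω) ∂P := integral_mono_ae hni hdom hpt
      _ = ∫ ω, c ω ∂P := by
        have h := integral_add hci hsηi
        simp only [Pi.mul_apply] at h
        rw [h, hzero, add_zero]
      _ ≤ ∫ ω, M ω ∂P := integral_mono hci ihi hcM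
      _ ≤ 1 := ih1

/-- Chernoff's bound for a random variable whose exponential has mean at most one. -/
lemma measureReal_exp_bound {f : Ω → ℝ} (hf : Integrable (fun ω => Real.exp (f ω)) P)
    (h1 : ∫ ω, Real.exp (f ω) ∂P ≤ 1) (u : ℝ) : P.real {ω | u < f ω} ≤ Real.exp (-u) := by
  have h := mul_meas_ge_le_integral_of_nonneg (μ := P)
    (Filter.Eventually.of_forall fun ω => (Real.exp_pos (f ω)).le) hf (Real.exp u)
  have h2 : P.real {ω | u < f ω} ≤ P.real {ω | Real.exp u ≤ Real.exp (f ω)} :=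
    measureReal_mono fun ω hω => Real.exp_le_exp.2 (le_of_lt hω)
  rw [Real.exp_neg, ← one_div, le_div_iff₀ (Real.exp_pos u), mul_comm]
  calc _ ≤ _ := mul_le_mul_of_nonneg_left h2 (Real.exp_pos u).le
    _ ≤ _ := h
    _ ≤ 1 := h1

/-- The self-normalized bound for vector-valued martingales with bounded noise. -/
lemma selfNormalized_bound {R : ℝ} (hR : 0 < R)
    (hn : 1 ≤ n)
    (h𝒢 : ∀ t ∈ Finset.Ico 1 n, 𝒢 t ≤ mΩ)
    (hx : ∀ t ∈ Finset.Ico 1 n, ∀ k ∈ Finset.Ico 1 n, t ≤ k → ∀ i, Measurable[𝒢 k] fun ω => x t ω i)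
    (hx1 : ∀ t ∈ Finset.Ico 1 n, ∀ ω, x t ω ⬝ᵥ x t ω ≤ 1)
    (hη : ∀ t ∈ Finset.Ico 1 n, ∀ k ∈ Finset.Ico 1 n, t < k → Measurable[𝒢 k] (η t))
    (hηm : ∀ t ∈ Finset.Ico 1 n, Measurable (η t))
    (hηR : ∀ t ∈ Finset.Ico 1 n, ∀ᵐ ω ∂P, |η t ω| ≤ R)
    (hη0 : ∀ t ∈ Finset.Ico 1 n, P[η t | 𝒢 t] =ᵐ[P] 0) (u : ℝ) :
    P.real {ω | R ^ 2 * (d * Real.log n + 2 * u) <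
      invForm (regGram (fun t => x t ω) n) (noiseSum (fun t => x t ω) (fun t => η t ω) n)
        (noiseSum (fun t => x t ω) (fun t => η t ω) n)} ≤ Real.exp (-u) := by
  -- Rescaling to noise bounded by 1; the quadratic form then picks up the factor R².
  set η' : ℕ → Ω → ℝ := fun t ω => R⁻¹ * η t ω with hη'
  obtain ⟨hi, h1⟩ := integral_exp_selfNormExponent_le (P := P) (𝒢 := 𝒢) (x := x) (η := η') (n := n)
    h𝒢 hx (fun t ht k hk htk => (hη t ht k hk htk).const_mul _)
    (fun t ht => (hηm t ht).const_mul _)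
    (fun t ht => (hηR t ht).mono fun ω h => by
      simp only [hη', abs_mul, abs_inv, abs_of_pos hR]
      rwa [inv_mul_le_iff₀ hR, mul_one])
    (fun t ht => by
      have h := condExp_smul (μ := P) R⁻¹ (η t) (𝒢 t)
      filter_upwards [h, hη0 t ht] with ω h1 h2
      have e : η' t = R⁻¹ • η t := rfl
      rw [e, h1, Pi.smul_apply, h2]; simp) n hn le_rfl
  refine le_trans (measureReal_mono ?_) (measureReal_exp_bound hi h1 u)
  intro ω hω
  simp only [Set.mem_ofPred_eq] at hω ⊢
  -- The random compensator is bounded pathwise by d log n, which leaves a deterministic threshold.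
  have hpot := sum_potential_le (x := fun t => x t ω) hn (fun t ht => hx1 t ht ω)
  have hsum : noiseSum (fun t => x t ω) (fun t => η t ω) n =
      R • noiseSum (fun t => x t ω) (fun t => η' t ω) n := by
    simp only [noiseSum, Finset.smul_sum, smul_smul, hη']
    refine Finset.sum_congr rfl fun t _ => ?_
    rw [← mul_assoc, mul_inv_cancel₀ hR.ne', one_mul]
  rw [hsum, invForm_smul_left, invForm_smul_right, ← mul_assoc, ← sq] at hω
  have := lt_of_mul_lt_mul_left hω (by positivity)
  unfold selfNormExponent
  linarith

end SelfNormalized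

/-! ### Averages of bounded functions against probability densities. -/

section Densities

variable {E : Type*} [MeasurableSpace E] {lam : Measure E} {g : E → ℝ}

/-- An integral equal to 1 already forces integrability, since a non-integrable function has Bochner
integral 0. -/
lemma integrable_bdd_mul_density (hg : ∫ e, g e ∂lam = 1) {f : E → ℝ} (hf : Measurable f) {B : ℝ}
    (hB : ∀ e, |f e| ≤ B) : Integrable (fun e => f e * g e) lam :=
  (integrable_of_integral_eq_one hg).bdd_mul hf.aestronglyMeasurable
    (Filter.Eventually.of_forall hB)

lemma integral_mul_density_mono (hg : ∫ e, g e ∂lam = 1) (hg0 : ∀ e, 0 ≤ g e) {f f' : E → ℝ}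
    (hf : Measurable f) (hf' : Measurable f') {B : ℝ} (hB : ∀ e, |f e| ≤ B)
    (hB' : ∀ e, |f' e| ≤ B) (h : ∀ e, f e ≤ f' e) :
    ∫ e, f e * g e ∂lam ≤ ∫ e, f' e * g e ∂lam :=
  integral_mono (integrable_bdd_mul_density hg hf hB) (integrable_bdd_mul_density hg hf' hB')
    fun e => mul_le_mul_of_nonneg_right (h e) (hg0 e)

lemma integral_mul_density_mem (hg : ∫ e, g e ∂lam = 1) (hg0 : ∀ e, 0 ≤ g e) {f : E → ℝ}
    (hf : Measurable f) {B : ℝ} (h : ∀ e, f e ∈ Set.Icc 0 B) :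
    ∫ e, f e * g e ∂lam ∈ Set.Icc 0 B := by
  refine ⟨integral_nonneg fun e => mul_nonneg (h e).1 (hg0 e), ?_⟩
  calc _ ≤ ∫ e, B * g e ∂lam :=
        integral_mono (integrable_bdd_mul_density hg hf fun e => by
          rw [abs_of_nonneg (h e).1]; exact (h e).2)
          ((integrable_of_integral_eq_one hg).const_mul B)
          fun e => mul_le_mul_of_nonneg_right (h e).2 (hg0 e)
    _ = B := by rw [integral_const_mul, hg, mul_one]

end Densities

/-! ### Values and visitation densities of the linear MDP. -/

section Model

variable {S A X : Type*} [MeasurableSpace S] [MeasurableSpace A] [MeasurableSpace X]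
  {ρ : Measure S} {ν : Measure A} {H d : ℕ} {M : MDP S A ρ H}
  {φ : ℕ → S → A → EuclideanSpace ℝ (Fin d)}

lemma MDP.value_of_le (M : MDP S A ρ H) (ν : Measure A) (π : ℕ → S → A → ℝ) {h : ℕ} (hh : h ≤ H)
    (s : S) : M.value ν π h s = ∫ a, M.bellman (M.value ν π (h + 1)) h s a * π h s a ∂ν := by
  rw [MDP.value, if_pos hh]

lemma MDP.value_of_lt (M : MDP S A ρ H) (ν : Measure A) (π : ℕ → S → A → ℝ) {h : ℕ} (hh : H < h)
    (s : S) : M.value ν π h s = 0 := by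
  rw [MDP.value, if_neg (by omega)]

lemma MDP.stateDensity_succ (M : MDP S A ρ H) (ν : Measure A) (π : ℕ → S → A → ℝ) {h : ℕ}
    (hh : 1 ≤ h) (s' : S) : M.stateDensity ν π (h + 1) s' =
      ∫ s, ∫ a, M.stateDensity ν π h s * π h s a * M.p h s a s' ∂ν ∂ρ := by
  obtain ⟨h, rfl⟩ := Nat.exists_eq_add_of_le' hh
  rfl

section Sigma

variable [SigmaFinite ρ] [SigmaFinite ν]

lemma MDP.measurable_bellman (M : MDP S A ρ H) {h : ℕ} (hh : h ∈ Set.Icc 1 H) {V : X → S → ℝ}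
    (hV : Measurable fun z : X × S => V z.1 z.2) :
    Measurable fun z : X × S × A => M.bellman (V z.1) h z.2.1 z.2.2 := by
  unfold MDP.bellman
  refine ((M.measurable_r h hh).comp measurable_snd).add ?_
  refine (StronglyMeasurable.integral_prod_right'
    (f := fun z : (X × S × A) × S => V z.1.1 z.2 * M.p h z.1.2.1 z.1.2.2 z.2) ?_).measurable
  refine Measurable.stronglyMeasurable (Measurable.mul ?_ ?_)
  · exact hV.comp ((measurable_fst.comp measurable_fst).prodMk measurable_snd)
  · exact (M.measurable_p h hh).comp
      ((measurable_fst.comp (measurable_snd.comp measurable_fst)).prodMk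
        ((measurable_snd.comp (measurable_snd.comp measurable_fst)).prodMk measurable_snd))

lemma MDP.measurable_bellman' (M : MDP S A ρ H) {h : ℕ} (hh : h ∈ Set.Icc 1 H) {V : S → ℝ}
    (hV : Measurable V) : Measurable fun z : S × A => M.bellman V h z.1 z.2 :=
  (M.measurable_bellman (X := Unit) hh (V := fun _ => V) (hV.comp measurable_snd)).comp
    (measurable_const.prodMk measurable_id : Measurable fun z : S × A => ((), z))

lemma measurable_integral_action {Q : X → S → A → ℝ} {σ : X → S → A → ℝ}
    (hQ : Measurable fun z : X × S × A => Q z.1 z.2.1 z.2.2)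
    (hσ : Measurable fun z : X × S × A => σ z.1 z.2.1 z.2.2) :
    Measurable fun z : X × S => ∫ a, Q z.1 z.2 a * σ z.1 z.2 a ∂ν := by
  refine (StronglyMeasurable.integral_prod_right'
    (f := fun z : (X × S) × A => Q z.1.1 z.1.2 z.2 * σ z.1.1 z.1.2 z.2) ?_).measurable
  have : Measurable fun z : (X × S) × A => (z.1.1, z.1.2, z.2) :=
    (measurable_fst.comp measurable_fst).prodMk
      ((measurable_snd.comp measurable_fst).prodMk measurable_snd)
  exact ((hQ.comp this).mul (hσ.comp this)).stronglyMeasurable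

lemma measurable_integral_action' {Q σ : S → A → ℝ} (hQ : Measurable fun z : S × A => Q z.1 z.2)
    (hσ : Measurable fun z : S × A => σ z.1 z.2) :
    Measurable fun s => ∫ a, Q s a * σ s a ∂ν :=
  (measurable_integral_action (X := Unit) (ν := ν) (Q := fun _ => Q) (σ := fun _ => σ)
    (hQ.comp measurable_snd) (hσ.comp measurable_snd)).comp
    (measurable_const.prodMk measurable_id : Measurable fun z : S => ((), z))

/-- Joint measurability in a parameter of the policy is needed because the learned policies depend
on ω. -/
lemma MDP.measurable_value (M : MDP S A ρ H) {π : X → ℕ → S → A → ℝ}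
    (hπ : ∀ h ∈ Set.Icc 1 H, Measurable fun z : X × S × A => π z.1 h z.2.1 z.2.2)
    {h : ℕ} (h1 : 1 ≤ h) : Measurable fun z : X × S => M.value ν (π z.1) h z.2 := by
  by_cases hh : H < h
  · simp only [M.value_of_lt ν _ hh, measurable_const]
  · have h2 : h ≤ H := not_lt.1 hh
    have ih := M.measurable_value hπ (h := h + 1) (by omega)
    simp only [M.value_of_le ν _ h2]
    exact measurable_integral_action (ν := ν)
      (Q := fun x s a => M.bellman (M.value ν (π x) (h + 1)) h s a) (σ := fun x s a => π x h s a)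
      (M.measurable_bellman (V := fun x => M.value ν (π x) (h + 1)) ⟨h1, h2⟩ ih) (hπ h ⟨h1, h2⟩)
termination_by H + 1 - h

lemma MDP.measurable_value' (M : MDP S A ρ H) {π : ℕ → S → A → ℝ} (hπ : IsPolicy ν H π)
    {h : ℕ} (h1 : 1 ≤ h) : Measurable fun s => M.value ν π h s :=
  (M.measurable_value (X := Unit) (ν := ν) (π := fun _ => π)
    (fun h hh => (hπ h hh).1.comp measurable_snd) h1).comp
    (measurable_const.prodMk measurable_id : Measurable fun z : S => ((), z))

lemma MDP.bellman_mem (M : MDP S A ρ H) {h : ℕ} (hh : h ∈ Set.Icc 1 H) {V : S → ℝ}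
    (hV : Measurable V) {B : ℝ} (hB : ∀ s, V s ∈ Set.Icc 0 B) (s : S) (a : A) :
    M.bellman V h s a ∈ Set.Icc 0 (B + 1) := by
  have h1 := integral_mul_density_mem (M.integral_p h hh s a) (M.p_nonneg h hh s a) hV hB
  have h2 := M.r_mem h hh s a
  unfold MDP.bellman
  exact ⟨add_nonneg h2.1 h1.1, by linarith [h1.2, h2.2]⟩

lemma MDP.bellman_mono (M : MDP S A ρ H) {h : ℕ} (hh : h ∈ Set.Icc 1 H) {V V' : S → ℝ}
    (hV : Measurable V) (hV' : Measurable V') {B : ℝ} (hB : ∀ s, V s ∈ Set.Icc 0 B)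
    (hB' : ∀ s, V' s ∈ Set.Icc 0 B) (hle : ∀ s, V s ≤ V' s) (s : S) (a : A) :
    M.bellman V h s a ≤ M.bellman V' h s a := by
  unfold MDP.bellman
  have := integral_mul_density_mono (M.integral_p h hh s a) (M.p_nonneg h hh s a) hV hV'
    (fun s => by rw [abs_of_nonneg (hB s).1]; exact (hB s).2)
    (fun s => by rw [abs_of_nonneg (hB' s).1]; exact (hB' s).2) hle
  linarith

lemma IsStagePolicy.measurable_action {σ : S → A → ℝ} (hσ : IsStagePolicy ν σ) (s : S) :
    Measurable (σ s) := hσ.1.comp measurable_prodMk_left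

lemma MDP.value_mem (M : MDP S A ρ H) {π : ℕ → S → A → ℝ} (hπ : IsPolicy ν H π)
    {h : ℕ} (h1 : 1 ≤ h) (h2 : h ≤ H + 1) (s : S) :
    M.value ν π h s ∈ Set.Icc (0 : ℝ) (H - h + 1) := by
  by_cases hh : H < h
  · rw [M.value_of_lt ν _ hh]
    have : h = H + 1 := by omega
    subst this
    simp
  · have h3 : h ≤ H := not_lt.1 hh
    have hm : h ∈ Set.Icc 1 H := ⟨h1, h3⟩
    have ih := M.value_mem hπ (h := h + 1) (by omega) (by omega)
    have hv := M.measurable_value' hπ (h := h + 1) (by omega)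
    rw [M.value_of_le ν _ h3]
    refine integral_mul_density_mem ((hπ h hm).2.2 s) ((hπ h hm).2.1 s)
      ((M.measurable_bellman' hm hv).comp measurable_prodMk_left) fun a => ?_
    have := M.bellman_mem hm hv ih s a
    push_cast at this
    have e : (H : ℝ) - h + 1 = H - (h + 1) + 1 + 1 := by ring
    rw [e]
    exact this
termination_by H + 1 - h

lemma MDP.stateDensity_nonneg (M : MDP S A ρ H) {π : ℕ → S → A → ℝ} (hπ : IsPolicy ν H π)
    {h : ℕ} (hh : h ∈ Set.Icc 1 H) (s : S) : 0 ≤ M.stateDensity ν π h s := by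
  obtain ⟨h1, h2⟩ := hh
  induction h, h1 using Nat.le_induction generalizing s with
  | base => exact M.d₁_nonneg s
  | succ h h1 ih =>
    have hm : h ∈ Set.Icc 1 H := ⟨h1, by omega⟩
    rw [M.stateDensity_succ ν π h1]
    exact integral_nonneg fun s' => integral_nonneg fun a =>
      mul_nonneg (mul_nonneg (ih s' hm.2) ((hπ h hm).2.1 s' a)) (M.p_nonneg h hm s' a s)

lemma MDP.density_nonneg (M : MDP S A ρ H) {π : ℕ → S → A → ℝ} (hπ : IsPolicy ν H π)
    {h : ℕ} (hh : h ∈ Set.Icc 1 H) (s : S) (a : A) : 0 ≤ M.density ν π h s a :=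
  mul_nonneg (M.stateDensity_nonneg hπ hh s) ((hπ h hh).2.1 s a)

lemma MDP.measurable_stateDensity (M : MDP S A ρ H) {π : X → ℕ → S → A → ℝ}
    (hπ : ∀ h ∈ Set.Icc 1 H, Measurable fun z : X × S × A => π z.1 h z.2.1 z.2.2)
    {h : ℕ} (hh : h ∈ Set.Icc 1 H) :
    Measurable fun z : X × S => M.stateDensity ν (π z.1) h z.2 := by
  obtain ⟨h1, h2⟩ := hh
  induction h, h1 using Nat.le_induction with
  | base => exact M.measurable_d₁.comp measurable_snd
  | succ h h1 ih =>
    have hm : h ∈ Set.Icc 1 H := ⟨h1, by omega⟩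
    simp only [M.stateDensity_succ ν _ h1]
    refine (StronglyMeasurable.integral_prod_right'
      (f := fun z : (X × S) × S => ∫ a, M.stateDensity ν (π z.1.1) h z.2 * π z.1.1 h z.2 a *
        M.p h z.2 a z.1.2 ∂ν) ?_).measurable
    refine StronglyMeasurable.integral_prod_right'
      (f := fun z : ((X × S) × S) × A => M.stateDensity ν (π z.1.1.1) h z.1.2 *
        π z.1.1.1 h z.1.2 z.2 * M.p h z.1.2 z.2 z.1.1.2) ?_
    refine Measurable.stronglyMeasurable (Measurable.mul (Measurable.mul ?_ ?_) ?_)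
    · exact (ih hm.2).comp (g := fun z : X × S => M.stateDensity ν (π z.1) h z.2)
        (f := fun z : ((X × S) × S) × A => (z.1.1.1, z.1.2)) (by fun_prop)
    · exact (hπ h hm).comp (f := fun z : ((X × S) × S) × A => (z.1.1.1, z.1.2, z.2)) (by fun_prop)
    · exact (M.measurable_p h hm).comp
        (f := fun z : ((X × S) × S) × A => (z.1.2, z.2, z.1.1.2)) (by fun_prop)

lemma MDP.measurable_density (M : MDP S A ρ H) {π : X → ℕ → S → A → ℝ}
    (hπ : ∀ h ∈ Set.Icc 1 H, Measurable fun z : X × S × A => π z.1 h z.2.1 z.2.2)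
    {h : ℕ} (hh : h ∈ Set.Icc 1 H) :
    Measurable fun z : X × S × A => M.density ν (π z.1) h z.2.1 z.2.2 :=
  ((M.measurable_stateDensity hπ hh).comp
    (f := fun z : X × S × A => (z.1, z.2.1)) (by fun_prop)).mul (hπ h hh)

lemma MDP.measurable_stateDensity' (M : MDP S A ρ H) {π : ℕ → S → A → ℝ} (hπ : IsPolicy ν H π)
    {h : ℕ} (hh : h ∈ Set.Icc 1 H) : Measurable fun s => M.stateDensity ν π h s :=
  (M.measurable_stateDensity (X := Unit) (ν := ν) (π := fun _ => π)
    (fun h hh => (hπ h hh).1.comp measurable_snd) hh).comp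
    (measurable_const.prodMk measurable_id : Measurable fun z : S => ((), z))

lemma MDP.measurable_density' (M : MDP S A ρ H) {π : ℕ → S → A → ℝ} (hπ : IsPolicy ν H π)
    {h : ℕ} (hh : h ∈ Set.Icc 1 H) : Measurable fun z : S × A => M.density ν π h z.1 z.2 :=
  ((M.measurable_stateDensity' hπ hh).comp measurable_fst).mul (hπ h hh).1

/-- A bound uniform in (s, a) for each fixed s' makes the Bochner integrals in `MDP.stateDensity`
converge at every s', instead of possibly taking the default value 0. -/
lemma MDP.IsLinear.p_le (hM : M.IsLinear φ) {h : ℕ} (hh : h ∈ Set.Icc 1 H) (s' : S) :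
    ∃ c : ℝ, ∀ s a, M.p h s a s' ≤ c := by
  obtain ⟨-, hφ, θ, ψ, -, hp, -⟩ := hM h hh
  refine ⟨‖ψ s'‖, fun s a => ?_⟩
  rw [hp]
  calc _ ≤ ‖φ h s a‖ * ‖ψ s'‖ := real_inner_le_norm _ _
    _ ≤ 1 * ‖ψ s'‖ := by gcongr; exact hφ s a
    _ = _ := one_mul _

lemma MDP.ofReal_stateDensity_succ (hM : M.IsLinear φ) {π : ℕ → S → A → ℝ}
    (hπ : IsPolicy ν H π) {h : ℕ} (hh : h ∈ Set.Icc 1 H)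
    (hd : Integrable (fun s => M.stateDensity ν π h s) ρ) (s' : S) :
    ENNReal.ofReal (M.stateDensity ν π (h + 1) s') =
      ∫⁻ z, ENNReal.ofReal (M.p h z.1 z.2 s') * ENNReal.ofReal (M.density ν π h z.1 z.2)
        ∂(ρ.prod ν) := by
  obtain ⟨c, hc⟩ := hM.p_le hh s'
  have hpm : Measurable fun z : S × A => M.p h z.1 z.2 s' :=
    (M.measurable_p h hh).comp (f := fun z : S × A => (z.1, z.2, s')) (by fun_prop)
  have hdm := M.measurable_density' hπ hh
  have hd0 := fun s => M.stateDensity_nonneg hπ hh s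
  have hπ0 := (hπ h hh).2.1
  have hp0 := fun s a => M.p_nonneg h hh s a s'
  have hin : ∀ s, Integrable (fun a => M.stateDensity ν π h s * π h s a * M.p h s a s') ν := by
    intro s
    have h1 := ((integrable_bdd_mul_density ((hπ h hh).2.2 s)
      (hpm.comp (measurable_prodMk_left (x := s))) (B := c) (fun a => by
        simp only [Function.comp]
        rw [abs_of_nonneg (hp0 s a)]; exact hc s a)).const_mul (M.stateDensity ν π h s))
    refine h1.congr (Filter.Eventually.of_forall fun a => ?_)
    simp only [Function.comp]
    ring
  -- The inner integral is at most c times the state density, whose integrability is assumed.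
  have hout : Integrable (fun s => ∫ a, M.stateDensity ν π h s * π h s a * M.p h s a s' ∂ν) ρ := by
    refine (hd.const_mul c).mono' ?_ (Filter.Eventually.of_forall fun s => ?_)
    · refine (measurable_integral_action' (ν := ν)
        (Q := fun s a => M.stateDensity ν π h s * π h s a) (σ := fun s a => M.p h s a s')
        hdm hpm).aestronglyMeasurable
    · rw [Real.norm_eq_abs, abs_of_nonneg (integral_nonneg fun a =>
        mul_nonneg (mul_nonneg (hd0 s) (hπ0 s a)) (hp0 s a))]
      calc _ ≤ ∫ a, c * M.stateDensity ν π h s * π h s a ∂ν := by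
            refine integral_mono (hin s)
              ((integrable_of_integral_eq_one ((hπ h hh).2.2 s)).const_mul _) fun a => ?_
            have := mul_le_mul_of_nonneg_left (hc s a) (mul_nonneg (hd0 s) (hπ0 s a))
            simp only
            linarith
        _ = _ := by rw [integral_const_mul, (hπ h hh).2.2 s, mul_one]
  rw [M.stateDensity_succ ν π hh.1, ofReal_integral_eq_lintegral_ofReal hout
    (Filter.Eventually.of_forall fun s => integral_nonneg fun a =>
      mul_nonneg (mul_nonneg (hd0 s) (hπ0 s a)) (hp0 s a)),
    lintegral_prod (fun z : S × A => ENNReal.ofReal (M.p h z.1 z.2 s') *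
      ENNReal.ofReal (M.density ν π h z.1 z.2))
      (hpm.ennreal_ofReal.mul hdm.ennreal_ofReal).aemeasurable]
  refine lintegral_congr fun s => ?_
  rw [ofReal_integral_eq_lintegral_ofReal (hin s) (Filter.Eventually.of_forall fun a =>
      mul_nonneg (mul_nonneg (hd0 s) (hπ0 s a)) (hp0 s a))]
  refine lintegral_congr fun a => ?_
  rw [← ENNReal.ofReal_mul (hp0 s a), mul_comm]
  rfl

lemma MDP.lintegral_stateDensity_succ (hM : M.IsLinear φ) {π : ℕ → S → A → ℝ}
    (hπ : IsPolicy ν H π) {h : ℕ} (hh : h ∈ Set.Icc 1 H)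
    (hd : Integrable (fun s => M.stateDensity ν π h s) ρ) {g : S → ENNReal} (hg : Measurable g) :
    ∫⁻ s', g s' * ENNReal.ofReal (M.stateDensity ν π (h + 1) s') ∂ρ =
      ∫⁻ z, (∫⁻ s', g s' * ENNReal.ofReal (M.p h z.1 z.2 s') ∂ρ) *
        ENNReal.ofReal (M.density ν π h z.1 z.2) ∂(ρ.prod ν) := by
  have hdm := (M.measurable_density' hπ hh).ennreal_ofReal
  have hpm : Measurable fun z : S × S × A => ENNReal.ofReal (M.p h z.2.1 z.2.2 z.1) :=
    ((M.measurable_p h hh).comp (f := fun z : S × S × A => (z.2.1, z.2.2, z.1))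
      (by fun_prop)).ennreal_ofReal
  have hpm' : ∀ s', Measurable fun z : S × A => ENNReal.ofReal (M.p h z.1 z.2 s') := fun s' =>
    hpm.comp (measurable_prodMk_left (x := s'))
  have hpm'' : ∀ z : S × A, Measurable fun s' => ENNReal.ofReal (M.p h z.1 z.2 s') := fun z =>
    hpm.comp (f := fun s' => (s', z)) (by fun_prop)
  simp only [MDP.ofReal_stateDensity_succ hM hπ hh hd]
  calc _ = ∫⁻ s', ∫⁻ z, g s' * (ENNReal.ofReal (M.p h z.1 z.2 s') *
          ENNReal.ofReal (M.density ν π h z.1 z.2)) ∂(ρ.prod ν) ∂ρ :=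
        lintegral_congr fun s' => (lintegral_const_mul _ ((hpm' s').mul hdm)).symm
    _ = ∫⁻ z, ∫⁻ s', g s' * (ENNReal.ofReal (M.p h z.1 z.2 s') *
          ENNReal.ofReal (M.density ν π h z.1 z.2)) ∂ρ ∂(ρ.prod ν) := by
        refine lintegral_lintegral_swap (Measurable.aemeasurable ?_)
        exact (hg.comp measurable_fst).mul (hpm.mul (hdm.comp measurable_snd))
    _ = _ := by
        refine lintegral_congr fun z => ?_
        refine Eq.trans ?_ (lintegral_mul_const _ (hg.mul (hpm'' z)))
        exact lintegral_congr fun s' => (mul_assoc _ _ _).symm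

lemma MDP.lintegral_p (M : MDP S A ρ H) {h : ℕ} (hh : h ∈ Set.Icc 1 H) (s : S) (a : A) :
    ∫⁻ s', ENNReal.ofReal (M.p h s a s') ∂ρ = 1 := by
  rw [← ofReal_integral_eq_lintegral_ofReal
    (integrable_of_integral_eq_one (M.integral_p h hh s a))
    (Filter.Eventually.of_forall (M.p_nonneg h hh s a)), M.integral_p h hh, ENNReal.ofReal_one]

lemma MDP.lintegral_action {π : ℕ → S → A → ℝ}
    (hπ : IsPolicy ν H π) {h : ℕ} (hh : h ∈ Set.Icc 1 H) (s : S) :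
    ∫⁻ a, ENNReal.ofReal (π h s a) ∂ν = 1 := by
  rw [← ofReal_integral_eq_lintegral_ofReal
    (integrable_of_integral_eq_one ((hπ h hh).2.2 s))
    (Filter.Eventually.of_forall ((hπ h hh).2.1 s)), (hπ h hh).2.2, ENNReal.ofReal_one]

lemma MDP.lintegral_density (M : MDP S A ρ H) {π : ℕ → S → A → ℝ}
    (hπ : IsPolicy ν H π) {h : ℕ} (hh : h ∈ Set.Icc 1 H) {f : S × A → ENNReal}
    (hf : Measurable f) :
    ∫⁻ z, f z * ENNReal.ofReal (M.density ν π h z.1 z.2) ∂(ρ.prod ν) =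
      ∫⁻ s, (∫⁻ a, f (s, a) * ENNReal.ofReal (π h s a) ∂ν) *
        ENNReal.ofReal (M.stateDensity ν π h s) ∂ρ := by
  have hdm := (M.measurable_density' hπ hh).ennreal_ofReal
  rw [lintegral_prod (fun z : S × A => f z * ENNReal.ofReal (M.density ν π h z.1 z.2))
    (hf.mul hdm).aemeasurable]
  refine lintegral_congr fun s => ?_
  rw [← lintegral_mul_const]
  · refine lintegral_congr fun a => ?_
    rw [MDP.density, ENNReal.ofReal_mul (M.stateDensity_nonneg hπ hh s)]
    ring
  · exact (hf.comp measurable_prodMk_left).mul ((hπ h hh).measurable_action s).ennreal_ofReal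

/-- Total mass and integrability are proved together, since the recursion for the next density needs
integrability of the current one. -/
lemma MDP.lintegral_stateDensity_eq_one (hM : M.IsLinear φ) {π : ℕ → S → A → ℝ}
    (hπ : IsPolicy ν H π) {h : ℕ} (hh : h ∈ Set.Icc 1 H) :
    ∫⁻ s, ENNReal.ofReal (M.stateDensity ν π h s) ∂ρ = 1 ∧
      Integrable (fun s => M.stateDensity ν π h s) ρ := by
  have hfin : ∀ h ∈ Set.Icc 1 H, ∫⁻ s, ENNReal.ofReal (M.stateDensity ν π h s) ∂ρ = 1 →
      Integrable (fun s => M.stateDensity ν π h s) ρ := fun h hh h1 => by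
    refine ⟨(M.measurable_stateDensity' hπ hh).aestronglyMeasurable, ?_⟩
    rw [hasFiniteIntegral_iff_ofReal
      (Filter.Eventually.of_forall (M.stateDensity_nonneg hπ hh)), h1]
    exact ENNReal.one_lt_top
  obtain ⟨h1, h2⟩ := hh
  induction h, h1 using Nat.le_induction with
  | base =>
    have hi := integrable_of_integral_eq_one M.integral_d₁
    refine ⟨?_, hi⟩
    have h3 := ofReal_integral_eq_lintegral_ofReal hi (Filter.Eventually.of_forall M.d₁_nonneg)
    rw [M.integral_d₁, ENNReal.ofReal_one] at h3
    exact h3.symm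
  | succ h h1 ih =>
    have hm : h ∈ Set.Icc 1 H := ⟨h1, by omega⟩
    obtain ⟨ih1, ihi⟩ := ih hm.2
    have hone : ∫⁻ s, ENNReal.ofReal (M.stateDensity ν π (h + 1) s) ∂ρ = 1 := by
      have := MDP.lintegral_stateDensity_succ hM hπ hm ihi (g := fun _ => 1) measurable_const
      simp only [one_mul, M.lintegral_p hm] at this
      rw [this]
      have h3 := M.lintegral_density hπ hm (f := fun _ => 1) measurable_const
      simp only [one_mul, MDP.lintegral_action hπ hm, ih1] at h3
      exact h3
    exact ⟨hone, hfin _ ⟨by omega, h2⟩ hone⟩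

lemma MDP.integral_stateDensity (hM : M.IsLinear φ) {π : ℕ → S → A → ℝ}
    (hπ : IsPolicy ν H π) {h : ℕ} (hh : h ∈ Set.Icc 1 H) :
    ∫ s, M.stateDensity ν π h s ∂ρ = 1 := by
  obtain ⟨h1, hi⟩ := MDP.lintegral_stateDensity_eq_one hM hπ hh
  rw [integral_eq_lintegral_of_nonneg_ae
    (Filter.Eventually.of_forall (M.stateDensity_nonneg hπ hh)) hi.aestronglyMeasurable, h1]
  simp

lemma MDP.integral_density (hM : M.IsLinear φ) {π : ℕ → S → A → ℝ}
    (hπ : IsPolicy ν H π) {h : ℕ} (hh : h ∈ Set.Icc 1 H) :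
    ∫ z, M.density ν π h z.1 z.2 ∂(ρ.prod ν) = 1 := by
  obtain ⟨h1, hi⟩ := MDP.lintegral_stateDensity_eq_one hM hπ hh
  have h3 := M.lintegral_density hπ hh (f := fun _ => 1) measurable_const
  simp only [one_mul, MDP.lintegral_action hπ hh, h1] at h3
  rw [integral_eq_lintegral_of_nonneg_ae (f := fun z : S × A => M.density ν π h z.1 z.2)
    (Filter.Eventually.of_forall fun z => M.density_nonneg hπ hh z.1 z.2)
    (M.measurable_density' hπ hh).aestronglyMeasurable, h3]
  simp

/-- Integrating out the action. -/
lemma MDP.integral_action_mul_stateDensity (hM : M.IsLinear φ) {π : ℕ → S → A → ℝ}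
    (hπ : IsPolicy ν H π) {h : ℕ} (hh : h ∈ Set.Icc 1 H) {f : S → A → ℝ}
    (hf : Measurable fun z : S × A => f z.1 z.2) {B : ℝ} (hB : ∀ s a, |f s a| ≤ B) :
    ∫ s, (∫ a, f s a * π h s a ∂ν) * M.stateDensity ν π h s ∂ρ =
      ∫ z, f z.1 z.2 * M.density ν π h z.1 z.2 ∂(ρ.prod ν) := by
  have hi := integrable_bdd_mul_density (MDP.integral_density hM hπ hh) hf
    (fun z => hB z.1 z.2)
  rw [integral_prod _ hi]
  refine integral_congr_ae (Filter.Eventually.of_forall fun s => ?_)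
  simp only
  rw [← integral_mul_const]
  refine integral_congr_ae (Filter.Eventually.of_forall fun a => ?_)
  simp only [MDP.density]
  ring

/-- Integrating out the next state. -/
lemma MDP.integral_mul_stateDensity_succ (hM : M.IsLinear φ) {π : ℕ → S → A → ℝ}
    (hπ : IsPolicy ν H π) {h : ℕ} (hh : h ∈ Set.Ico 1 H) {V : S → ℝ} (hV : Measurable V) {B : ℝ}
    (hB : ∀ s, V s ∈ Set.Icc 0 B) :
    ∫ s, V s * M.stateDensity ν π (h + 1) s ∂ρ =
      ∫ z, (∫ s', V s' * M.p h z.1 z.2 s' ∂ρ) * M.density ν π h z.1 z.2 ∂(ρ.prod ν) := by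
  have hm : h ∈ Set.Icc 1 H := ⟨hh.1, hh.2.le⟩
  have hm' : h + 1 ∈ Set.Icc 1 H := ⟨by omega, hh.2⟩
  have hi := (MDP.lintegral_stateDensity_eq_one hM hπ hm).2
  have hVa : ∀ s, |V s| ≤ B := fun s => by rw [abs_of_nonneg (hB s).1]; exact (hB s).2
  have hPm : Measurable fun z : S × A => ∫ s', V s' * M.p h z.1 z.2 s' ∂ρ := by
    have h1 := (M.measurable_bellman' hm hV).sub (M.measurable_r h hm)
    convert h1 using 1
    funext z
    simp [MDP.bellman]
  have hP := fun z : S × A =>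
    integral_mul_density_mem (M.integral_p h hm z.1 z.2) (M.p_nonneg h hm z.1 z.2) hV hB
  rw [integral_eq_lintegral_of_nonneg_ae
      (Filter.Eventually.of_forall fun s =>
        mul_nonneg (hB s).1 (M.stateDensity_nonneg hπ hm' s))
      (hV.mul (M.measurable_stateDensity' hπ hm')).aestronglyMeasurable,
    integral_eq_lintegral_of_nonneg_ae
      (Filter.Eventually.of_forall fun z =>
        mul_nonneg (hP z).1 (M.density_nonneg hπ hm z.1 z.2))
      (hPm.mul (M.measurable_density' hπ hm)).aestronglyMeasurable]
  congr 1
  have := MDP.lintegral_stateDensity_succ hM hπ hm hi (g := fun s => ENNReal.ofReal (V s))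
    hV.ennreal_ofReal
  simp only [ENNReal.ofReal_mul (hB _).1, ENNReal.ofReal_mul (hP _).1]
  rw [this]
  refine lintegral_congr fun z => ?_
  rw [ofReal_integral_eq_lintegral_ofReal
    (integrable_bdd_mul_density (M.integral_p h hm z.1 z.2) hV hVa)
    (Filter.Eventually.of_forall fun s => mul_nonneg (hB s).1 (M.p_nonneg h hm z.1 z.2 s))]
  simp only [ENNReal.ofReal_mul (hB _).1]

end Sigma

end Model

/-! ### Sub-optimality of pessimistic greedy policies. -/

section SubOptimality

variable {S A : Type*} [MeasurableSpace S] [MeasurableSpace A]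
  {ρ : Measure S} {ν : Measure A} {H d : ℕ} {M : MDP S A ρ H}
  {φ : ℕ → S → A → EuclideanSpace ℝ (Fin d)} [SigmaFinite ρ] [SigmaFinite ν]

lemma MDP.abs_subOpt_le (M : MDP S A ρ H) (hH : 1 ≤ H) {πstar π : ℕ → S → A → ℝ}
    (hπs : IsPolicy ν H πstar) (hπ : IsPolicy ν H π) : |M.subOpt ν πstar π| ≤ H := by
  have h1 := fun s => M.value_mem hπs le_rfl (by omega) s
  have h2 := fun s => M.value_mem hπ le_rfl (by omega) s
  have hi := integrable_of_integral_eq_one M.integral_d₁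
  unfold MDP.subOpt
  calc _ ≤ ∫ s, H * M.d₁ s ∂ρ := by
        rw [← Real.norm_eq_abs]
        refine norm_integral_le_of_norm_le (hi.const_mul (H : ℝ))
          (Filter.Eventually.of_forall fun s => ?_)
        rw [norm_mul, Real.norm_eq_abs, Real.norm_eq_abs, abs_of_nonneg (M.d₁_nonneg s)]
        refine mul_le_mul_of_nonneg_right ?_ (M.d₁_nonneg s)
        have h3 := h1 s
        have h4 := h2 s
        simp only [Set.mem_Icc, Nat.cast_one, sub_add_cancel] at h3 h4
        exact abs_le.2 ⟨by linarith, by linarith⟩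
    _ = H := by rw [integral_const_mul, M.integral_d₁, mul_one]

lemma MDP.integral_bellman_mul_density (hM : M.IsLinear φ) {π : ℕ → S → A → ℝ}
    (hπ : IsPolicy ν H π) {h : ℕ} (hh : h ∈ Set.Icc 1 H) {V : S → ℝ} (hV : Measurable V) {B : ℝ}
    (hB : ∀ s, V s ∈ Set.Icc 0 B) :
    ∫ z, M.bellman V h z.1 z.2 * M.density ν π h z.1 z.2 ∂(ρ.prod ν) =
      ∫ z, M.r h z.1 z.2 * M.density ν π h z.1 z.2 ∂(ρ.prod ν) +
      ∫ z, (∫ s', V s' * M.p h z.1 z.2 s' ∂ρ) * M.density ν π h z.1 z.2 ∂(ρ.prod ν) := by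
  have hd := MDP.integral_density hM hπ hh
  have hr := integrable_bdd_mul_density hd (M.measurable_r h hh) (B := 1) fun z => by
    rw [abs_of_nonneg (M.r_mem h hh z.1 z.2).1]; exact (M.r_mem h hh z.1 z.2).2
  have hT := integrable_bdd_mul_density hd (M.measurable_bellman' hh hV) (B := B + 1) fun z => by
    have := M.bellman_mem hh hV hB z.1 z.2
    rw [abs_of_nonneg this.1]; exact this.2
  have hP : Integrable (fun z : S × A =>
      (∫ s', V s' * M.p h z.1 z.2 s' ∂ρ) * M.density ν π h z.1 z.2) (ρ.prod ν) := by
    refine (hT.sub hr).congr (Filter.Eventually.of_forall fun z => ?_)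
    simp only [Pi.sub_apply, MDP.bellman]
    ring
  rw [← integral_add hr hP]
  refine integral_congr_ae (Filter.Eventually.of_forall fun z => ?_)
  simp only [MDP.bellman]
  ring

/-- Pessimistic, greedy value estimates bound the sub-optimality by the mean bonus under `πstar`. -/
lemma MDP.subOpt_le_sum_bonus (hM : M.IsLinear φ) (hH : 1 ≤ H) {πstar π : ℕ → S → A → ℝ}
    (hπs : IsPolicy ν H πstar) (hπ : IsPolicy ν H π)
    {Q b : ℕ → S → A → ℝ} {V : ℕ → S → ℝ}
    (hVQ : ∀ h ∈ Set.Icc 1 H, ∀ s, V h s = ∫ a, Q h s a * π h s a ∂ν)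
    (hV0 : ∀ s, V (H + 1) s = 0)
    (hQm : ∀ h ∈ Set.Icc 1 H, Measurable fun z : S × A => Q h z.1 z.2)
    (hQB : ∀ h ∈ Set.Icc 1 H, ∀ s a, Q h s a ∈ Set.Icc (0 : ℝ) (H - h + 1))
    (hbm : ∀ h ∈ Set.Icc 1 H, Measurable fun z : S × A => b h z.1 z.2)
    {Bb : ℝ} (hbB : ∀ h ∈ Set.Icc 1 H, ∀ s a, |b h s a| ≤ Bb)
    (hlow : ∀ h ∈ Set.Icc 1 H, ∀ s a, Q h s a ≤ M.bellman (V (h + 1)) h s a)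
    (hup : ∀ h ∈ Set.Icc 1 H, ∀ s a, M.bellman (V (h + 1)) h s a ≤ Q h s a + 2 * b h s a)
    (hgreedy : ∀ h ∈ Set.Icc 1 H, ∀ s, 0 < M.stateDensity ν πstar h s →
      ∫ a, Q h s a * πstar h s a ∂ν ≤ V h s) :
    M.subOpt ν πstar π ≤
      2 * ∑ h ∈ Finset.Icc 1 H, ∫ z, b h z.1 z.2 * M.density ν πstar h z.1 z.2 ∂(ρ.prod ν) := by
  have hVm : ∀ h, 1 ≤ h → h ≤ H + 1 → Measurable (V h) := by
    intro h h1 h2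
    by_cases hh : h = H + 1
    · subst hh
      rw [show V (H + 1) = fun _ => 0 from funext hV0]
      exact measurable_const
    · have hm : h ∈ Set.Icc 1 H := ⟨h1, by omega⟩
      rw [show V h = fun s => ∫ a, Q h s a * π h s a ∂ν from funext (hVQ h hm)]
      exact measurable_integral_action' (hQm h hm) (hπ h hm).1
  have hVB : ∀ h, 1 ≤ h → h ≤ H + 1 → ∀ s, V h s ∈ Set.Icc (0 : ℝ) (H - h + 1) := by
    intro h h1 h2 s
    by_cases hh : h = H + 1
    · subst hh
      rw [hV0]; simp
    · have hm : h ∈ Set.Icc 1 H := ⟨h1, by omega⟩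
      rw [hVQ h hm]
      exact integral_mul_density_mem ((hπ h hm).2.2 s) ((hπ h hm).2.1 s)
        ((hQm h hm).comp measurable_prodMk_left) fun a => hQB h hm s a
  have hvm := fun h (h1 : 1 ≤ h) => M.measurable_value' hπ h1
  have hvm' := fun h (h1 : 1 ≤ h) => M.measurable_value' hπs h1
  -- Pessimism, by backward induction: Q lies below the backup of V, which lies below the backup of
  -- the true value of π by monotonicity.
  have hpess : ∀ j, ∀ h, 1 ≤ h → h + j = H + 1 → ∀ s, V h s ≤ M.value ν π h s := by
    intro j
    induction j with
    | zero =>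
      intro h h1 h2 s
      obtain rfl : h = H + 1 := by omega
      rw [hV0, M.value_of_lt ν π (by omega)]
    | succ j ih =>
      intro h h1 h2 s
      have hm : h ∈ Set.Icc 1 H := ⟨h1, by omega⟩
      rw [hVQ h hm, M.value_of_le ν π hm.2]
      have hT := M.bellman_mem hm (hvm (h + 1) (by omega))
        (M.value_mem hπ (by omega) (by omega))
      refine integral_mul_density_mono ((hπ h hm).2.2 s) ((hπ h hm).2.1 s)
        (f := fun a => Q h s a) (B := H - h + 1)
        ((hQm h hm).comp measurable_prodMk_left)
        (f' := fun a => M.bellman (M.value ν π (h + 1)) h s a)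
        ((M.measurable_bellman' hm (hvm (h + 1) (by omega))).comp measurable_prodMk_left)
        (fun a => ?_) (fun a => ?_) (fun a => ?_)
      · rw [abs_of_nonneg (hQB h hm s a).1]; exact (hQB h hm s a).2
      · rw [abs_of_nonneg (hT s a).1]
        have := (hT s a).2
        push_cast at this
        linarith
      · refine (hlow h hm s a).trans ?_
        exact M.bellman_mono hm (hVm _ (by omega) (by omega)) (hvm _ (by omega))
          (hVB _ (by omega) (by omega)) (M.value_mem hπ (by omega) (by omega))
          (ih (h + 1) (by omega) (by omega)) s a
  have hgap : ∀ j, ∀ h, 1 ≤ h → h + j = H →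
      ∫ s, M.value ν πstar h s * M.stateDensity ν πstar h s ∂ρ -
        ∫ s, V h s * M.stateDensity ν πstar h s ∂ρ ≤
      2 * ∑ i ∈ Finset.Icc h H,
        ∫ z, b i z.1 z.2 * M.density ν πstar i z.1 z.2 ∂(ρ.prod ν) := by
    -- One step of the telescoping under `πstar`: rewards cancel, greediness replaces V by the mean
    -- of Q under `πstar`, and Q loses at most 2b against the backup. The remainder is the same gap
    -- one step later.
    have hstep : ∀ h, h ∈ Set.Icc 1 H →
      ∫ s, M.value ν πstar h s * M.stateDensity ν πstar h s ∂ρ -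
        ∫ s, V h s * M.stateDensity ν πstar h s ∂ρ ≤
      2 * ∫ z, b h z.1 z.2 * M.density ν πstar h z.1 z.2 ∂(ρ.prod ν) +
      (∫ z, (∫ s', M.value ν πstar (h + 1) s' * M.p h z.1 z.2 s' ∂ρ) *
          M.density ν πstar h z.1 z.2 ∂(ρ.prod ν) -
        ∫ z, (∫ s', V (h + 1) s' * M.p h z.1 z.2 s' ∂ρ) *
          M.density ν πstar h z.1 z.2 ∂(ρ.prod ν)) := by
      intro h hm
      obtain ⟨h1, h2⟩ := hm
      have hm : h ∈ Set.Icc 1 H := ⟨h1, h2⟩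
      have hd := MDP.integral_density hM hπs hm
      have hds := MDP.integral_stateDensity hM hπs hm
      have hds0 := M.stateDensity_nonneg hπs hm
      have hv1 := M.value_mem hπs (h := h + 1) (by omega) (by omega)
      have hV1 := hVB (h + 1) (by omega) (by omega)
      have hT := fun s a => M.bellman_mem hm (hvm' (h + 1) (by omega)) hv1 s a
      have hTV := fun s a => M.bellman_mem hm (hVm (h + 1) (by omega) (by omega)) hV1 s a
      have e1 : ∫ s, M.value ν πstar h s * M.stateDensity ν πstar h s ∂ρ =
          ∫ z, M.bellman (M.value ν πstar (h + 1)) h z.1 z.2 *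
            M.density ν πstar h z.1 z.2 ∂(ρ.prod ν) := by
        rw [← MDP.integral_action_mul_stateDensity hM hπs hm
          (f := fun s a => M.bellman (M.value ν πstar (h + 1)) h s a)
          (M.measurable_bellman' hm (hvm' (h + 1) (by omega)))
          (fun s a => by rw [abs_of_nonneg (hT s a).1]; exact (hT s a).2)]
        simp only [M.value_of_le ν πstar h2]
      have e2 : ∫ z, Q h z.1 z.2 * M.density ν πstar h z.1 z.2 ∂(ρ.prod ν) ≤
          ∫ s, V h s * M.stateDensity ν πstar h s ∂ρ := by
        have hQa : ∀ s a, |Q h s a| ≤ (H : ℝ) - h + 1 := fun s a => by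
          rw [abs_of_nonneg (hQB h hm s a).1]; exact (hQB h hm s a).2
        rw [← MDP.integral_action_mul_stateDensity hM hπs hm (hQm h hm) hQa]
        refine integral_mono ?_ ?_ fun s => ?_
        · refine integrable_bdd_mul_density hds
            (measurable_integral_action' (hQm h hm) (hπs h hm).1) (B := (H : ℝ) - h + 1) fun s => ?_
          have := integral_mul_density_mem ((hπs h hm).2.2 s) ((hπs h hm).2.1 s)
            ((hQm h hm).comp measurable_prodMk_left) (fun a => hQB h hm s a)
          exact (abs_of_nonneg this.1).trans_le this.2
        · refine integrable_bdd_mul_density hds (hVm h h1 (by omega)) (B := (H : ℝ) - h + 1)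
            fun s => ?_
          have := hVB h h1 (by omega) s
          rw [abs_of_nonneg this.1]; exact this.2
        -- States that `πstar` does not visit have weight zero, so greediness is needed only
        -- elsewhere.
        · rcases (hds0 s).eq_or_lt with h0 | h0
          · simp [← h0]
          · exact mul_le_mul_of_nonneg_right (hgreedy h hm s h0) (hds0 s)
      have e3 : ∫ z, M.bellman (V (h + 1)) h z.1 z.2 * M.density ν πstar h z.1 z.2 ∂(ρ.prod ν) ≤
          ∫ z, Q h z.1 z.2 * M.density ν πstar h z.1 z.2 ∂(ρ.prod ν) +
          2 * ∫ z, b h z.1 z.2 * M.density ν πstar h z.1 z.2 ∂(ρ.prod ν) := by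
        have hiQ := integrable_bdd_mul_density hd (hQm h hm) (B := (H : ℝ) - h + 1) fun z => by
          rw [abs_of_nonneg (hQB h hm z.1 z.2).1]; exact (hQB h hm z.1 z.2).2
        have hib := integrable_bdd_mul_density hd (hbm h hm) (B := Bb) fun z => hbB h hm z.1 z.2
        rw [← integral_const_mul, ← integral_add hiQ (hib.const_mul 2)]
        refine integral_mono ?_ (hiQ.add (hib.const_mul 2)) fun z => ?_
        · exact integrable_bdd_mul_density hd
            (M.measurable_bellman' hm (hVm (h + 1) (by omega) (by omega))) fun z => by
              rw [abs_of_nonneg (hTV z.1 z.2).1]; exact (hTV z.1 z.2).2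
        · have := mul_le_mul_of_nonneg_right (hup h hm z.1 z.2) (M.density_nonneg hπs hm z.1 z.2)
          simp only
          linarith
      have e4 := MDP.integral_bellman_mul_density hM hπs hm (hvm' (h + 1) (by omega)) hv1
      have e5 := MDP.integral_bellman_mul_density hM hπs hm
        (hVm (h + 1) (by omega) (by omega)) hV1
      linarith
    intro j
    induction j with
    | zero =>
      intro h h1 h2
      obtain rfl : h = H := by omega
      have := hstep h ⟨h1, le_rfl⟩
      simp only [hV0, M.value_of_lt ν πstar (Nat.lt_succ_self h), zero_mul, integral_zero,
        sub_zero, add_zero] at this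
      simpa using this
    | succ j ih =>
      intro h h1 h2
      have := hstep h ⟨h1, by omega⟩
      have hm : h ∈ Set.Ico 1 H := ⟨h1, by omega⟩
      rw [← MDP.integral_mul_stateDensity_succ hM hπs hm (hvm' (h + 1) (by omega))
          (M.value_mem hπs (by omega) (by omega)),
        ← MDP.integral_mul_stateDensity_succ hM hπs hm (hVm (h + 1) (by omega) (by omega))
          (hVB (h + 1) (by omega) (by omega))] at this
      have h3 := ih (h + 1) (by omega) (by omega)
      rw [← Finset.insert_Icc_succ_left_eq_Icc (by omega), Finset.sum_insert (by simp), mul_add]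
      simp only [Order.succ_eq_add_one] at *
      linarith
  refine le_trans ?_ (hgap (H - 1) 1 le_rfl (by omega))
  have hB1 : ∀ {f : S → ℝ}, Measurable f → (∀ s, f s ∈ Set.Icc (0 : ℝ) (H - (1 : ℕ) + 1)) →
      Integrable (fun s => f s * M.d₁ s) ρ := fun hf hfB =>
    integrable_bdd_mul_density M.integral_d₁ hf fun s => by
      rw [abs_of_nonneg (hfB s).1]; exact (hfB s).2
  have hi1 := hB1 (hvm' 1 le_rfl) (M.value_mem hπs le_rfl (by omega))
  have hi2 := hB1 (hvm 1 le_rfl) (M.value_mem hπ le_rfl (by omega))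
  have hi3 := hB1 (hVm 1 le_rfl (by omega)) (hVB 1 le_rfl (by omega))
  have hle : ∫ s, V 1 s * M.d₁ s ∂ρ ≤ ∫ s, M.value ν π 1 s * M.d₁ s ∂ρ :=
    integral_mono hi3 hi2 fun s => mul_le_mul_of_nonneg_right
      (hpess H 1 le_rfl (by omega) s) (M.d₁_nonneg s)
  unfold MDP.subOpt
  simp only [sub_mul]
  rw [integral_sub hi1 hi2]
  change _ ≤ ∫ s, M.value ν πstar 1 s * M.d₁ s ∂ρ - ∫ s, V 1 s * M.d₁ s ∂ρ
  linarith

end SubOptimality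

/-! ### The law of a state-action pair within an episode. -/

section Law

variable {S A Ω Ω' : Type*} [MeasurableSpace S] [MeasurableSpace A] [MeasurableSpace Ω']
  [MeasurableSpace Ω] {P : Measure Ω}
  {ρ : Measure S} {ν : Measure A} {H d : ℕ} {M : MDP S A ρ H}
  {φ : ℕ → S → A → EuclideanSpace ℝ (Fin d)} [SigmaFinite ρ] [SigmaFinite ν]

/-- The joint law of `Y` and of the state-action pair at step `h` of an episode in which the policy
`μ (Y ω)` is executed. -/
lemma MDP.lintegral_state_action (hM : M.IsLinear φ) {μ : Ω' → ℕ → S → A → ℝ}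
    (hμm : ∀ h ∈ Set.Icc 1 H, Measurable fun z : Ω' × S × A => μ z.1 h z.2.1 z.2.2)
    {Y : Ω → Ω'} (hμ : ∀ ω, IsPolicy ν H (μ (Y ω))) {s : ℕ → Ω → S} {a : ℕ → Ω → A}
    (hinit : ∀ F : Ω' × S → ENNReal, Measurable F → ∫⁻ ω, F (Y ω, s 1 ω) ∂P =
      ∫⁻ ω, ∫⁻ y, F (Y ω, y) * ENNReal.ofReal (M.d₁ y) ∂ρ ∂P)
    (hact : ∀ h ∈ Set.Icc 1 H, ∀ F : (Ω' × S) × A → ENNReal, Measurable F →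
      ∫⁻ ω, F ((Y ω, s h ω), a h ω) ∂P =
      ∫⁻ ω, ∫⁻ x, F ((Y ω, s h ω), x) * ENNReal.ofReal (μ (Y ω) h (s h ω) x) ∂ν ∂P)
    (htr : ∀ h ∈ Set.Ico 1 H, ∀ F : (Ω' × S × A) × S → ENNReal, Measurable F →
      ∫⁻ ω, F ((Y ω, s h ω, a h ω), s (h + 1) ω) ∂P =
      ∫⁻ ω, ∫⁻ y, F ((Y ω, s h ω, a h ω), y) *
        ENNReal.ofReal (M.p h (s h ω) (a h ω) y) ∂ρ ∂P)
    {h : ℕ} (hh : h ∈ Set.Icc 1 H) {F : Ω' × S × A → ENNReal} (hF : Measurable F) :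
    ∫⁻ ω, F (Y ω, s h ω, a h ω) ∂P =
      ∫⁻ ω, ∫⁻ z, F (Y ω, z) * ENNReal.ofReal (M.density ν (μ (Y ω)) h z.1 z.2)
        ∂(ρ.prod ν) ∂P := by
  -- The law of the state at a step gives that of the state-action pair; the induction below passes
  -- from the pair to the next state through the transition density.
  have hstep : ∀ h ∈ Set.Icc 1 H, (∀ F : Ω' × S → ENNReal, Measurable F →
      ∫⁻ ω, F (Y ω, s h ω) ∂P =
        ∫⁻ ω, ∫⁻ y, F (Y ω, y) * ENNReal.ofReal (M.stateDensity ν (μ (Y ω)) h y) ∂ρ ∂P) →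
      ∀ F : Ω' × S × A → ENNReal, Measurable F →
      ∫⁻ ω, F (Y ω, s h ω, a h ω) ∂P =
      ∫⁻ ω, ∫⁻ z, F (Y ω, z) * ENNReal.ofReal (M.density ν (μ (Y ω)) h z.1 z.2)
        ∂(ρ.prod ν) ∂P := by
    intro h hh hs F hF
    have h1 := hact h hh (fun z => F (z.1.1, z.1.2, z.2)) (hF.comp (by fun_prop))
    have hG : Measurable fun z : Ω' × S =>
        ∫⁻ x, F (z.1, z.2, x) * ENNReal.ofReal (μ z.1 h z.2 x) ∂ν := by
      refine Measurable.lintegral_prod_right' (f := fun z : (Ω' × S) × A =>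
        F (z.1.1, z.1.2, z.2) * ENNReal.ofReal (μ z.1.1 h z.1.2 z.2)) ?_
      exact (hF.comp (by fun_prop)).mul ((hμm h hh).comp
        (f := fun z : (Ω' × S) × A => (z.1.1, z.1.2, z.2)) (by fun_prop)).ennreal_ofReal
    rw [h1, hs _ hG]
    refine lintegral_congr fun ω => ?_
    exact (M.lintegral_density (hμ ω) hh (f := fun z => F (Y ω, z))
      (hF.comp measurable_prodMk_left)).symm
  refine hstep h hh ?_ F hF
  obtain ⟨h1, h2⟩ := hh
  induction h, h1 using Nat.le_induction with
  | base => exact hinit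
  | succ h h1 ih =>
    intro F hF
    have hm : h ∈ Set.Icc 1 H := ⟨h1, by omega⟩
    have h3 := htr h ⟨h1, h2⟩ (fun z => F (z.1.1, z.2)) (hF.comp (by fun_prop))
    have hG : Measurable fun z : Ω' × S × A =>
        ∫⁻ y, F (z.1, y) * ENNReal.ofReal (M.p h z.2.1 z.2.2 y) ∂ρ := by
      refine Measurable.lintegral_prod_right' (f := fun z : (Ω' × S × A) × S =>
        F (z.1.1, z.2) * ENNReal.ofReal (M.p h z.1.2.1 z.1.2.2 z.2)) ?_
      exact (hF.comp (by fun_prop)).mul ((M.measurable_p h hm).comp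
        (f := fun z : (Ω' × S × A) × S => (z.1.2.1, z.1.2.2, z.2)) (by fun_prop)).ennreal_ofReal
    rw [h3, hstep h hm (ih hm.2) _ hG]
    refine lintegral_congr fun ω => ?_
    exact (MDP.lintegral_stateDensity_succ hM (hμ ω) hm
      (MDP.lintegral_stateDensity_eq_one hM (hμ ω) hm).2 (g := fun y => F (Y ω, y))
      (hF.comp measurable_prodMk_left)).symm

end Law

/-! ### A multiplicative bound for sums of conditional means. -/

section SumBound

variable {Ω : Type*} {mΩ : MeasurableSpace Ω} {P : Measure Ω} [IsProbabilityMeasure P]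
  {𝒢 : ℕ → MeasurableSpace Ω} {g Z : ℕ → Ω → ℝ} {n : ℕ}

/-- A multiplicative bound for sums of conditional means of `[0, 1]`-valued random variables. -/
lemma measureReal_sum_condMean_le (hn : 1 ≤ n)
    (h𝒢 : ∀ k ∈ Finset.Ico 1 n, 𝒢 k ≤ mΩ)
    (hg : ∀ t ∈ Finset.Ico 1 n, ∀ k ∈ Finset.Ico 1 n, t ≤ k → Measurable[𝒢 k] (g t))
    (hZ : ∀ t ∈ Finset.Ico 1 n, ∀ k ∈ Finset.Ico 1 n, t < k → Measurable[𝒢 k] (Z t))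
    (hZm : ∀ t ∈ Finset.Ico 1 n, Measurable (Z t))
    (hstep : ∀ k ∈ Finset.Ico 1 n, ∀ W : Ω → ENNReal, Measurable[𝒢 k] W →
      ∫⁻ ω, W ω * ENNReal.ofReal (Real.exp (-Z k ω)) ∂P ≤
        ∫⁻ ω, W ω * ENNReal.ofReal (Real.exp (-(g k ω / 2))) ∂P) (u : ℝ) :
    P.real {ω | 2 * ∑ t ∈ Finset.Ico 1 n, Z t ω + 2 * u < ∑ t ∈ Finset.Ico 1 n, g t ω} ≤
      Real.exp (-u) := by
  -- exp Σ (g/2 - Z) is a supermartingale. The hypothesis `hstep` says E[exp(-Z_k) | 𝒢_k] ≤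
  -- exp(-g_k/2), tested against 𝒢_k-measurable weights.
  have hsum : ∀ k, 1 ≤ k → k ≤ n → ∫⁻ ω, ENNReal.ofReal
      (Real.exp (∑ t ∈ Finset.Ico 1 k, (g t ω / 2 - Z t ω))) ∂P ≤ 1 := by
    intro k hk hkn
    induction k, hk using Nat.le_induction with
    | base => simp
    | succ k hk ih =>
      refine le_trans ?_ (ih (by omega))
      have hkm : k ∈ Finset.Ico 1 n := Finset.mem_Ico.2 ⟨hk, hkn⟩
      have hsub : ∀ t ∈ Finset.Ico 1 k, t ∈ Finset.Ico 1 n ∧ t < k := fun t ht => by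
        simp only [Finset.mem_Ico] at ht ⊢; omega
      have hS : Measurable[𝒢 k] fun ω => ∑ t ∈ Finset.Ico 1 k, (g t ω / 2 - Z t ω) :=
        Finset.measurable_fun_sum _ fun t ht =>
          ((hg t (hsub t ht).1 k hkm (hsub t ht).2.le).div_const 2).sub
            (hZ t (hsub t ht).1 k hkm (hsub t ht).2)
      have hW : Measurable[𝒢 k] fun ω => ENNReal.ofReal (Real.exp
          (∑ t ∈ Finset.Ico 1 k, (g t ω / 2 - Z t ω) + g k ω / 2)) :=
        (hS.add ((hg k hkm k hkm le_rfl).div_const 2)).exp.ennreal_ofReal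
      calc _ = ∫⁻ ω, ENNReal.ofReal (Real.exp
            (∑ t ∈ Finset.Ico 1 k, (g t ω / 2 - Z t ω) + g k ω / 2)) *
              ENNReal.ofReal (Real.exp (-Z k ω)) ∂P := by
            refine lintegral_congr fun ω => ?_
            rw [← ENNReal.ofReal_mul (Real.exp_pos _).le, ← Real.exp_add,
              Finset.sum_Ico_succ_top hk]
            ring_nf
        _ ≤ _ := hstep k hkm _ hW
        _ = _ := by
            refine lintegral_congr fun ω => ?_
            rw [← ENNReal.ofReal_mul (Real.exp_pos _).le, ← Real.exp_add]
            ring_nf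
  have hm : Measurable fun ω => Real.exp (∑ t ∈ Finset.Ico 1 n, (g t ω / 2 - Z t ω)) := by
    refine (Finset.measurable_fun_sum _ fun t ht => ?_).exp
    exact (((hg t ht t ht le_rfl).mono (h𝒢 t ht) le_rfl).div_const 2).sub (hZm t ht)
  have h1 := hsum n hn le_rfl
  have h0 : ∀ᵐ ω ∂P, 0 ≤ Real.exp (∑ t ∈ Finset.Ico 1 n, (g t ω / 2 - Z t ω)) :=
    Filter.Eventually.of_forall fun ω => (Real.exp_pos _).le
  have hi : Integrable (fun ω => Real.exp (∑ t ∈ Finset.Ico 1 n, (g t ω / 2 - Z t ω))) P :=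
    ⟨hm.aestronglyMeasurable, by
      rw [hasFiniteIntegral_iff_ofReal h0]; exact h1.trans_lt ENNReal.one_lt_top⟩
  have hle : ∫ ω, Real.exp (∑ t ∈ Finset.Ico 1 n, (g t ω / 2 - Z t ω)) ∂P ≤ 1 := by
    rw [integral_eq_lintegral_of_nonneg_ae h0 hm.aestronglyMeasurable]
    exact ENNReal.toReal_le_of_le_ofReal zero_le_one (by simpa using h1)
  refine le_trans (measureReal_mono ?_) (measureReal_exp_bound hi hle u)
  intro ω hω
  simp only [Set.mem_ofPred_eq] at hω ⊢
  rw [Finset.sum_sub_distrib, ← Finset.sum_div]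
  linarith

lemma exp_neg_le_one_sub_half {x : ℝ} (h0 : 0 ≤ x) (h1 : x ≤ 1) :
    Real.exp (-x) ≤ 1 - x / 2 := by
  rw [Real.exp_neg, inv_le_comm₀ (Real.exp_pos x) (by linarith)]
  refine le_trans ?_ (Real.add_one_le_exp x)
  rw [inv_le_iff_one_le_mul₀ (by linarith)]
  nlinarith

/-- The one-step condition of `measureReal_sum_condMean_le`, from exp(-x) ≤ 1 - x/2 on [0, 1]
followed by 1 - y ≤ exp(-y). -/
lemma lintegral_exp_neg_mul_density_le {E : Type*} [MeasurableSpace E] {lam : Measure E}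
    {q f : E → ℝ} (hq1 : ∫ e, q e ∂lam = 1) (hq0 : ∀ e, 0 ≤ q e) (hf : Measurable f)
    (hf01 : ∀ e, f e ∈ Set.Icc (0 : ℝ) 1) :
    ∫⁻ e, ENNReal.ofReal (Real.exp (-f e)) * ENNReal.ofReal (q e) ∂lam ≤
      ENNReal.ofReal (Real.exp (-((∫ e, f e * q e ∂lam) / 2))) := by
  have hfq := integrable_bdd_mul_density hq1 hf (B := 1) fun e => by
    rw [abs_of_nonneg (hf01 e).1]; exact (hf01 e).2
  have heq : Integrable (fun e => Real.exp (-f e) * q e) lam :=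
    integrable_bdd_mul_density hq1 hf.neg.exp (B := 1) fun e => by
      rw [abs_of_pos (Real.exp_pos _)]
      exact Real.exp_le_one_iff.2 (neg_nonpos.2 (hf01 e).1)
  simp only [← ENNReal.ofReal_mul (Real.exp_pos _).le]
  rw [← ofReal_integral_eq_lintegral_ofReal heq (Filter.Eventually.of_forall fun e =>
    mul_nonneg (Real.exp_pos _).le (hq0 e))]
  apply ENNReal.ofReal_le_ofReal
  have hqi := integrable_of_integral_eq_one hq1
  calc _ ≤ ∫ e, (q e - f e * q e / 2) ∂lam := by
        refine integral_mono heq (hqi.sub (hfq.div_const 2)) fun e => ?_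
        have := mul_le_mul_of_nonneg_right
          (exp_neg_le_one_sub_half (hf01 e).1 (hf01 e).2) (hq0 e)
        linarith
    _ = 1 - (∫ e, f e * q e ∂lam) / 2 := by
        rw [integral_sub hqi (hfq.div_const 2), hq1, integral_div]
    _ ≤ _ := Real.one_sub_le_exp_neg _

end SumBound

/-! ### The σ-algebras of the data. -/

section DataSigma

variable {S A Ω : Type*} [MeasurableSpace S] [MeasurableSpace A]
  (D : Ω → Dataset S A) {H k t h : ℕ}

lemma measurable_state_obs (t h : ℕ) : Measurable[obs D t h] fun ω => (D ω).state t h :=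
  Measurable.of_comap_le (le_sup_left.trans le_sup_left)

lemma measurable_action_obs (t h : ℕ) : Measurable[obs D t h] fun ω => (D ω).action t h :=
  Measurable.of_comap_le (le_sup_right.trans le_sup_left)

lemma measurable_reward_obs (t h : ℕ) : Measurable[obs D t h] fun ω => (D ω).reward t h :=
  Measurable.of_comap_le le_sup_right

lemma obs_le_past (ht : t ∈ Set.Ico 1 k) (hh : h ∈ Set.Icc 1 H) : obs D t h ≤ past D H k :=
  (le_iSup₂ (f := fun h (_ : h ∈ Set.Icc 1 H) => obs D t h) h hh).trans
    (le_iSup₂ (f := fun t (_ : t ∈ Set.Ico 1 k) => ⨆ h ∈ Set.Icc 1 H, obs D t h) t ht)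

lemma past_mono (H : ℕ) {k l : ℕ} (hkl : k ≤ l) : past D H k ≤ past D H l :=
  iSup₂_le fun _ ht => iSup₂_le fun _ hh => obs_le_past D ⟨ht.1, ht.2.trans_le hkl⟩ hh

lemma past_le_pastState : past D H k ≤ pastState D H k h := le_sup_left.trans le_sup_left

lemma measurable_state_pastState : Measurable[pastState D H k h] fun ω => (D ω).state k h :=
  Measurable.of_comap_le le_sup_right

lemma pastState_le_pastAction : pastState D H k h ≤ pastAction D H k h := le_sup_left

lemma measurable_state_pastAction : Measurable[pastAction D H k h] fun ω => (D ω).state k h :=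
  (measurable_state_pastState D).mono (pastState_le_pastAction D) le_rfl

lemma measurable_action_pastAction : Measurable[pastAction D H k h] fun ω => (D ω).action k h :=
  Measurable.of_comap_le le_sup_right

lemma pastAction_le_past (hk : 1 ≤ k) (hh : h ∈ Set.Icc 1 H) {l : ℕ} (hl : k < l) :
    pastAction D H k h ≤ past D H l := by
  have hobs := obs_le_past D (⟨hk, hl⟩ : k ∈ Set.Ico 1 l) hh
  refine sup_le (sup_le (sup_le (past_mono D H hl.le) ?_) ?_) ?_
  · exact iSup₂_le fun i hi => obs_le_past D ⟨hk, hl⟩ ⟨hi.1, hi.2.le.trans hh.2⟩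
  · exact ((measurable_state_obs D k h).mono hobs le_rfl).comap_le
  · exact ((measurable_action_obs D k h).mono hobs le_rfl).comap_le

/-- With the step fixed and the episode varying, these σ-algebras form the filtration of the
regression at that step. -/
lemma pastAction_mono (hk : 1 ≤ k) (hh : h ∈ Set.Icc 1 H) {l : ℕ} (hl : k ≤ l) :
    pastAction D H k h ≤ pastAction D H l h := by
  rcases hl.eq_or_lt with rfl | hl
  · rfl
  · exact (pastAction_le_past D hk hh hl).trans
      ((past_le_pastState D).trans (pastState_le_pastAction D))

end DataSigma

/-! ### Regression noise and mean elliptical norms along the data. -/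

section Data

variable {S A Ω : Type*} [MeasurableSpace S] [MeasurableSpace A] [mΩ : MeasurableSpace Ω]
  {P : Measure Ω} [IsProbabilityMeasure P]
  {ρ : Measure S} {ν : Measure A} {H d K : ℕ} {M : MDP S A ρ H}
  {φ : ℕ → S → A → EuclideanSpace ℝ (Fin d)} [SigmaFinite ρ] [SigmaFinite ν]
  {D : Ω → Dataset S A} {μ : ℕ → Ω → ℕ → S → A → ℝ}

lemma IsAdaptiveData.obs_le (hD : IsAdaptiveData M ν P K D μ) {k h : ℕ} (hk : k ∈ Set.Icc 1 K)
    (hh : h ∈ Set.Icc 1 H) : obs D k h ≤ mΩ :=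
  sup_le (sup_le (hD.measurable_state k hk h hh).comap_le
    (hD.measurable_action k hk h hh).comap_le) (hD.measurable_reward k hk h hh).comap_le

lemma IsAdaptiveData.past_le (hD : IsAdaptiveData M ν P K D μ) {k : ℕ} (hk : k ≤ K + 1) :
    past D H k ≤ mΩ :=
  iSup₂_le fun _ ht => iSup₂_le fun _ hh => hD.obs_le ⟨ht.1, by have := ht.2; omega⟩ hh

lemma IsAdaptiveData.pastAction_le (hD : IsAdaptiveData M ν P K D μ) {k h : ℕ}
    (hk : k ∈ Set.Icc 1 K) (hh : h ∈ Set.Icc 1 H) : pastAction D H k h ≤ mΩ :=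
  (pastAction_le_past D hk.1 hh (Nat.lt_succ_self k)).trans (hD.past_le (Nat.succ_le_succ hk.2))

/-- Given the past, the state-action pair at step `h` of episode `k` has the visitation density of
the behaviour policy. -/
lemma IsAdaptiveData.lintegral_state_action (hD : IsAdaptiveData M ν P K D μ)
    (hM : M.IsLinear φ) {k h : ℕ} (hk : k ∈ Set.Icc 1 K) (hh : h ∈ Set.Icc 1 H)
    {F : Ω × S × A → ENNReal} (hF : Measurable[(past D H k).prod inferInstance] F) :
    ∫⁻ ω, F (ω, (D ω).state k h, (D ω).action k h) ∂P =
      ∫⁻ ω, ∫⁻ z, F (ω, z) * ENNReal.ofReal (M.density ν (μ k ω) h z.1 z.2)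
        ∂(ρ.prod ν) ∂P := by
  have hpast := hD.past_le (hk.2.trans (Nat.le_succ K))
  -- The parameter is ω itself, with Ω carrying the σ-algebra of the past; the behaviour policy is
  -- measurable for it.
  refine @MDP.lintegral_state_action S A Ω Ω _ _ (past D H k) mΩ P ρ ν H d M φ _ _ hM
    (fun ω => μ k ω) (fun h hh => hD.predictable k hk h hh) id (fun ω => hD.isPolicy k hk ω)
    (fun h ω => (D ω).state k h) (fun h ω => (D ω).action k h) ?_ ?_ ?_ h hh F hF
  · intro F hF
    by_cases hH : 1 ≤ H
    · exact @lintegral_of_condLaw Ω Ω S (past D H k) _ (past D H k) mΩ hpast P _ ρ _ id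
        (@measurable_id _ (past D H k)) _ (hD.measurable_state k hk 1 ⟨le_rfl, hH⟩)
        (fun _ y => M.d₁ y) (M.measurable_d₁.comp (@measurable_snd _ _ (past D H k) _))
        (fun _ y => M.d₁_nonneg y) (fun _ => M.integral_d₁) (hD.initial k hk) F hF
    · exact absurd (hh.1.trans hh.2) hH
  · intro i hi F hF
    have hY : @Measurable _ _ (pastState D H k i) ((past D H k).prod inferInstance)
        fun ω => (ω, (D ω).state k i) :=
      @Measurable.prodMk _ (pastState D H k i) _ _ (past D H k) _ _ _
        (measurable_id.mono (past_le_pastState D) le_rfl) (measurable_state_pastState D)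
    have hq : Measurable[((past D H k).prod inferInstance).prod inferInstance]
        fun z : (Ω × S) × A => μ k z.1.1 i z.1.2 z.2 := by
      refine (hD.predictable k hk i hi).comp (f := fun z : (Ω × S) × A => (z.1.1, z.1.2, z.2)) ?_
      let _ : MeasurableSpace Ω := past D H k
      fun_prop
    exact @lintegral_of_condLaw Ω (Ω × S) A ((past D H k).prod inferInstance) _
      (pastState D H k i) mΩ
      ((pastState_le_pastAction D).trans (hD.pastAction_le hk hi)) P _ ν _ _ hY _
      (hD.measurable_action k hk i hi) (fun y x => μ k y.1 i y.2 x) hq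
      (fun ω x => (hD.isPolicy k hk ω i hi).2.1 _ x)
      (fun ω => (hD.isPolicy k hk ω i hi).2.2 _) (hD.action k hk i hi) F hF
  · intro i hi F hF
    have hi' : i ∈ Set.Icc 1 H := ⟨hi.1, hi.2.le⟩
    have hY : @Measurable _ _ (pastAction D H k i) ((past D H k).prod inferInstance)
        fun ω => (ω, (D ω).state k i, (D ω).action k i) :=
      @Measurable.prodMk _ (pastAction D H k i) _ _ (past D H k) _ _ _
        (measurable_id.mono ((past_le_pastState D).trans (pastState_le_pastAction D)) le_rfl)
        ((measurable_state_pastAction D).prodMk (measurable_action_pastAction D))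
    have hq : Measurable[((past D H k).prod inferInstance).prod inferInstance]
        fun z : (Ω × S × A) × S => M.p i z.1.2.1 z.1.2.2 z.2 := by
      refine (M.measurable_p i hi').comp
        (f := fun z : (Ω × S × A) × S => (z.1.2.1, z.1.2.2, z.2)) ?_
      let _ : MeasurableSpace Ω := past D H k
      fun_prop
    exact @lintegral_of_condLaw Ω (Ω × S × A) S ((past D H k).prod inferInstance) _
      (pastAction D H k i) mΩ (hD.pastAction_le hk hi') P _ ρ _ _ hY _
      (hD.measurable_state k hk (i + 1) ⟨by omega, hi.2⟩)
      (fun y x => M.p i y.2.1 y.2.2 x) hq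
      (fun ω x => M.p_nonneg i hi' _ _ x)
      (fun ω => M.integral_p i hi' _ _) (hD.transition k hk i hi) F hF

/-- The regression noise in episode `t` at step `h`, for the next-value function `V`. -/
noncomputable def MDP.noise (M : MDP S A ρ H) (D : Dataset S A) (V : S → ℝ) (h t : ℕ) : ℝ :=
  D.reward t h + V (D.state t (h + 1)) - M.bellman V h (D.state t h) (D.action t h)

/-- At h = H the state at step H + 1 is not part of the data and need not be measurable; the next
value then vanishes identically. -/
lemma measurable_next_value (D : Ω → Dataset S A) {h : ℕ}
    (hh : h ∈ Set.Icc 1 H) {V : S → ℝ} (hV : Measurable V) (hVH : h = H → ∀ s, V s = 0)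
    {t k : ℕ} (ht : 1 ≤ t) (hk : t < k) :
    Measurable[past D H k] fun ω => V ((D ω).state t (h + 1)) := by
  by_cases hhH : h = H
  · simp only [hVH hhH, measurable_const]
  · refine hV.comp ((measurable_state_obs D t (h + 1)).mono (obs_le_past D ⟨ht, hk⟩ ?_) le_rfl)
    have := hh.2
    exact ⟨by omega, by omega⟩

lemma MDP.measurable_noise (M : MDP S A ρ H) (D : Ω → Dataset S A) {h : ℕ}
    (hh : h ∈ Set.Icc 1 H) {V : S → ℝ} (hV : Measurable V) (hVH : h = H → ∀ s, V s = 0)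
    {t k : ℕ} (ht : 1 ≤ t) (hk : t < k) :
    Measurable[past D H k] fun ω => M.noise (D ω) V h t := by
  have hobs := obs_le_past D (⟨ht, hk⟩ : t ∈ Set.Ico 1 k) hh
  have hs := (measurable_state_obs D t h).mono hobs le_rfl
  have ha := (measurable_action_obs D t h).mono hobs le_rfl
  have hr := (measurable_reward_obs D t h).mono hobs le_rfl
  exact (hr.add (measurable_next_value D hh hV hVH ht hk)).sub
    ((M.measurable_bellman' hh hV).comp (hs.prodMk ha))

lemma IsAdaptiveData.abs_noise_le (hD : IsAdaptiveData M ν P K D μ) {h : ℕ}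
    (hh : h ∈ Set.Icc 1 H) {V : S → ℝ} (hV : Measurable V) {B : ℝ}
    (hB : ∀ s, V s ∈ Set.Icc 0 B) {t : ℕ} (ht : t ∈ Set.Icc 1 K) :
    ∀ᵐ ω ∂P, |M.noise (D ω) V h t| ≤ B + 1 := by
  filter_upwards [hD.reward_mem t ht h hh] with ω hr
  have h1 := M.bellman_mem hh hV hB ((D ω).state t h) ((D ω).action t h)
  have h2 := hB ((D ω).state t (h + 1))
  simp only [Set.mem_Icc] at *
  unfold MDP.noise
  exact abs_le.2 ⟨by linarith, by linarith⟩

lemma IsAdaptiveData.condExp_noise (hD : IsAdaptiveData M ν P K D μ) {h : ℕ}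
    (hh : h ∈ Set.Icc 1 H) {V : S → ℝ} (hV : Measurable V) (hVH : h = H → ∀ s, V s = 0) {B : ℝ}
    (hB : ∀ s, V s ∈ Set.Icc 0 B) {t : ℕ} (ht : t ∈ Set.Icc 1 K) :
    P[fun ω => M.noise (D ω) V h t | pastAction D H t h] =ᵐ[P] 0 := by
  have hle := hD.pastAction_le ht hh
  have hVa : ∀ s, |V s| ≤ B := fun s => by rw [abs_of_nonneg (hB s).1]; exact (hB s).2
  have hri : Integrable (fun ω => (D ω).reward t h) P :=
    Integrable.of_bound (hD.measurable_reward t ht h hh).aestronglyMeasurable 1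
      ((hD.reward_mem t ht h hh).mono fun ω hω => by
        rw [Real.norm_eq_abs, abs_of_nonneg hω.1]; exact hω.2)
  have hVi : Integrable (fun ω => V ((D ω).state t (h + 1))) P :=
    Integrable.of_bound ((measurable_next_value D hh hV hVH ht.1 (Nat.lt_succ_self t)).mono
      (hD.past_le (Nat.succ_le_succ ht.2)) le_rfl).aestronglyMeasurable B
      (Filter.Eventually.of_forall fun ω => hVa _)
  have hbm : Measurable[pastAction D H t h]
      fun ω => M.bellman V h ((D ω).state t h) ((D ω).action t h) :=
    (M.measurable_bellman' hh hV).comp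
      ((measurable_state_pastAction D).prodMk (measurable_action_pastAction D))
  have hbi : Integrable (fun ω => M.bellman V h ((D ω).state t h) ((D ω).action t h)) P :=
    Integrable.of_bound (hbm.mono hle le_rfl).aestronglyMeasurable (B + 1)
      (Filter.Eventually.of_forall fun ω => by
        have := M.bellman_mem hh hV hB ((D ω).state t h) ((D ω).action t h)
        rw [Real.norm_eq_abs, abs_of_nonneg this.1]; exact this.2)
  have hVc : P[fun ω => V ((D ω).state t (h + 1)) | pastAction D H t h] =ᵐ[P]
      fun ω => ∫ s', V s' * M.p h ((D ω).state t h) ((D ω).action t h) s' ∂ρ := by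
    by_cases hhH : h = H
    · simp only [hVH hhH, zero_mul, integral_zero]
      exact (condExp_const hle 0).eventuallyEq
    · have hh' : h ∈ Set.Ico 1 H := ⟨hh.1, lt_of_le_of_ne hh.2 hhH⟩
      exact condExp_of_condLaw hle
        (Y := fun ω => ((D ω).state t h, (D ω).action t h))
        ((measurable_state_pastAction D).prodMk (measurable_action_pastAction D))
        (hD.measurable_state t ht (h + 1) ⟨by omega, hh'.2⟩)
        (q := fun y s' => M.p h y.1 y.2 s')
        ((M.measurable_p h hh).comp
          (f := fun z : (S × A) × S => (z.1.1, z.1.2, z.2)) (by fun_prop))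
        (fun ω s' => M.p_nonneg h hh _ _ s') (fun ω => M.integral_p h hh _ _)
        (hD.transition t ht h hh') hV (fun s => (hB s).1) (fun s => (hB s).2)
  have h1 := condExp_sub (hri.add hVi) hbi (pastAction D H t h)
  have h2 := condExp_add hri hVi (pastAction D H t h)
  have h3 := condExp_of_stronglyMeasurable hle hbm.stronglyMeasurable hbi
  have e : (fun ω => M.noise (D ω) V h t) =
      ((fun ω => (D ω).reward t h) + fun ω => V ((D ω).state t (h + 1))) -
        fun ω => M.bellman V h ((D ω).state t h) ((D ω).action t h) := rfl
  rw [e]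
  filter_upwards [h1, h2, hVc, hD.reward_mean t ht h hh] with ω e1 e2 e3 e4
  rw [e1, Pi.sub_apply, e2, Pi.add_apply, e3, e4, h3]
  simp [MDP.bellman]

/-- The features observed at step `h`. -/
def features (φ : ℕ → S → A → EuclideanSpace ℝ (Fin d)) (D : Dataset S A) (h t : ℕ) : Fin d → ℝ :=
  (φ h (D.state t h) (D.action t h)).ofLp

lemma gram_eq_regGram (φ : ℕ → S → A → EuclideanSpace ℝ (Fin d)) (D : Dataset S A) (k h : ℕ) :
    gram φ D k h = regGram (features φ D h) k := rfl

lemma MDP.IsLinear.dotProduct_self_le (hM : M.IsLinear φ) {h : ℕ} (hh : h ∈ Set.Icc 1 H)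
    (s : S) (a : A) : (φ h s a).ofLp ⬝ᵥ (φ h s a).ofLp ≤ 1 := by
  have h1 := (hM h hh).2.1 s a
  have h2 := EuclideanSpace.real_norm_sq_eq (φ h s a)
  have h3 : (φ h s a).ofLp ⬝ᵥ (φ h s a).ofLp = ‖φ h s a‖ ^ 2 := by
    rw [h2]; simp [dotProduct, sq]
  rw [h3]
  exact pow_le_one₀ (norm_nonneg _) h1

lemma MDP.IsLinear.measurable_coord (hM : M.IsLinear φ) {h : ℕ} (hh : h ∈ Set.Icc 1 H)
    (i : Fin d) : Measurable fun z : S × A => (φ h z.1 z.2).ofLp i :=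
  (EuclideanSpace.proj (𝕜 := ℝ) i).measurable.comp (hM h hh).1

lemma measurable_features (hM : M.IsLinear φ) {h : ℕ} (hh : h ∈ Set.Icc 1 H) {t : ℕ}
    {m : MeasurableSpace Ω} (hs : Measurable[m] fun ω => (D ω).state t h)
    (ha : Measurable[m] fun ω => (D ω).action t h) (i : Fin d) :
    Measurable[m] fun ω => features φ (D ω) h t i :=
  (hM.measurable_coord hh i).comp (hs.prodMk ha)

/-- Concentration of the regression noise for a fixed next-value function. -/
lemma IsAdaptiveData.noise_concentration (hD : IsAdaptiveData M ν P K D μ)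
    (hM : M.IsLinear φ) {h : ℕ} (hh : h ∈ Set.Icc 1 H) {V : S → ℝ} (hV : Measurable V)
    (hVH : h = H → ∀ s, V s = 0) {B : ℝ} (hB0 : 0 ≤ B)
    (hB : ∀ s, V s ∈ Set.Icc 0 B) {k : ℕ} (hk : k ∈ Set.Icc 1 (K + 1)) (u : ℝ) :
    P.real {ω | (B + 1) ^ 2 * (d * Real.log k + 2 * u) <
      invForm (gram φ (D ω) k h)
        (noiseSum (features φ (D ω) h) (M.noise (D ω) V h) k)
        (noiseSum (features φ (D ω) h) (M.noise (D ω) V h) k)} ≤ Real.exp (-u) := by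
  have hmem : ∀ t ∈ Finset.Ico 1 k, t ∈ Set.Icc 1 K := fun t ht => by
    have h1 := hk.2
    rw [Finset.mem_Ico] at ht
    exact ⟨ht.1, by omega⟩
  refine selfNormalized_bound (P := P) (𝒢 := fun t => pastAction D H t h)
    (x := fun t ω => features φ (D ω) h t) (η := fun t ω => M.noise (D ω) V h t)
    (by linarith) hk.1 (fun t ht => hD.pastAction_le (hmem t ht) hh) ?_
    (fun t ht ω => hM.dotProduct_self_le hh _ _) ?_ ?_
    (fun t ht => hD.abs_noise_le hh hV hB (hmem t ht))
    (fun t ht => hD.condExp_noise hh hV hVH hB (hmem t ht)) u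
  · intro t ht l hl htl i
    exact (measurable_features hM hh (measurable_state_pastAction D)
      (measurable_action_pastAction D) i).mono (pastAction_mono D (hmem t ht).1 hh htl) le_rfl
  · intro t ht l hl htl
    exact (M.measurable_noise D hh hV hVH (hmem t ht).1 htl).mono
      ((past_le_pastState D).trans (pastState_le_pastAction D)) le_rfl
  · intro t ht
    exact (M.measurable_noise D hh hV hVH (hmem t ht).1 (Nat.lt_succ_self t)).mono
      (hD.past_le (Nat.succ_le_succ (hmem t ht).2)) le_rfl

/-- The elliptical norm of the features at `(s, a)`. -/
noncomputable def ellNorm (φ : ℕ → S → A → EuclideanSpace ℝ (Fin d)) (D : Dataset S A) (k h : ℕ)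
    (s : S) (a : A) : ℝ :=
  √(invForm (gram φ D k h) (φ h s a).ofLp (φ h s a).ofLp)

lemma bonus_eq (φ : ℕ → S → A → EuclideanSpace ℝ (Fin d)) (β : ℕ → ℝ) (D : Dataset S A)
    (k h : ℕ) (s : S) (a : A) : bonus φ β D k h s a = β k * ellNorm φ D k h s a := rfl

lemma ellNorm_mem (hM : M.IsLinear φ) {h : ℕ} (hh : h ∈ Set.Icc 1 H) (D : Dataset S A) {k : ℕ}
    (hk : 1 ≤ k) (s : S) (a : A) : ellNorm φ D k h s a ∈ Set.Icc (0 : ℝ) 1 := by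
  refine ⟨Real.sqrt_nonneg _, Real.sqrt_le_one.2 ?_⟩
  exact (invForm_regGram_le _ hk _).trans (hM.dotProduct_self_le hh s a)

lemma ellNorm_antitone (D : Dataset S A) {k l h : ℕ} (hk : 1 ≤ k) (hl : k ≤ l) (s : S) (a : A) :
    ellNorm φ D l h s a ≤ ellNorm φ D k h s a :=
  Real.sqrt_le_sqrt (invForm_regGram_antitone _ hk hl _)

lemma measurable_ellNorm (hM : M.IsLinear φ) {h : ℕ} (hh : h ∈ Set.Icc 1 H) (D : Dataset S A)
    (k : ℕ) : Measurable fun z : S × A => ellNorm φ D k h z.1 z.2 :=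
  (measurable_invForm (A := fun _ => gram φ D k h) (fun _ _ => measurable_const)
    (hM.measurable_coord hh) (hM.measurable_coord hh)).sqrt

lemma measurable_ellNorm_past (hM : M.IsLinear φ) {h : ℕ} (hh : h ∈ Set.Icc 1 H) (k : ℕ) :
    Measurable[(past D H k).prod inferInstance]
      fun x : Ω × S × A => ellNorm φ (D x.1) k h x.2.1 x.2.2 := by
  let _ : MeasurableSpace Ω := past D H k
  refine (measurable_invForm (X := Ω × S × A) (A := fun x => gram φ (D x.1) k h)
    (measurable_regGram (x := fun t (x : Ω × S × A) => features φ (D x.1) h t) fun t ht i => ?_)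
    (fun i => (hM.measurable_coord hh i).comp measurable_snd)
    (fun i => (hM.measurable_coord hh i).comp measurable_snd)).sqrt
  have hobs := obs_le_past D (Finset.mem_Ico.1 ht : t ∈ Set.Ico 1 k) hh
  exact (measurable_features (D := D) hM hh ((measurable_state_obs D t h).mono hobs le_rfl)
    ((measurable_action_obs D t h).mono hobs le_rfl) i).comp measurable_fst

/-- The mean of `ellNorm` at step `h` of episode `k`, given the past. -/
noncomputable def MDP.meanEllNorm (M : MDP S A ρ H) (ν : Measure A)
    (φ : ℕ → S → A → EuclideanSpace ℝ (Fin d))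
    (D : Dataset S A) (π : ℕ → S → A → ℝ) (k h : ℕ) : ℝ :=
  ∫ z, ellNorm φ D k h z.1 z.2 * M.density ν π h z.1 z.2 ∂(ρ.prod ν)

lemma IsAdaptiveData.measurable_meanEllNorm (hD : IsAdaptiveData M ν P K D μ)
    (hM : M.IsLinear φ) {k h : ℕ} (hk : k ∈ Set.Icc 1 K) (hh : h ∈ Set.Icc 1 H) :
    Measurable[past D H k] fun ω => M.meanEllNorm ν φ (D ω) (μ k ω) k h := by
  have h1 := measurable_ellNorm_past (D := D) hM hh k
  have h2 := @MDP.measurable_density S A Ω _ _ (past D H k) ρ ν H _ _ M (fun ω => μ k ω)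
    (fun h hh => hD.predictable k hk h hh) h hh
  let _ : MeasurableSpace Ω := past D H k
  exact (StronglyMeasurable.integral_prod_right' (ν := ρ.prod ν)
    (f := fun x : Ω × S × A => ellNorm φ (D x.1) k h x.2.1 x.2.2 *
      M.density ν (μ k x.1) h x.2.1 x.2.2) (h1.mul h2).stronglyMeasurable).measurable

lemma measurable_ellNorm_data (hM : M.IsLinear φ) {h : ℕ} (hh : h ∈ Set.Icc 1 H) {t k : ℕ}
    (ht : 1 ≤ t) (htk : t < k) : Measurable[past D H k]
      fun ω => ellNorm φ (D ω) t h ((D ω).state t h) ((D ω).action t h) := by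
  have hobs := obs_le_past D (⟨ht, htk⟩ : t ∈ Set.Ico 1 k) hh
  have hf := fun i => measurable_features (φ := φ) (D := D) hM hh
    ((measurable_state_obs D t h).mono hobs le_rfl)
    ((measurable_action_obs D t h).mono hobs le_rfl) i
  refine Measurable.sqrt (measurable_invForm (mX := past D H k) (A := fun ω => gram φ (D ω) t h)
    (measurable_regGram (mX := past D H k) (x := fun t ω => features φ (D ω) h t)
      fun s hs i => ?_) hf hf)
  have hobs := obs_le_past D (⟨(Finset.mem_Ico.1 hs).1, (Finset.mem_Ico.1 hs).2.trans htk⟩ :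
    s ∈ Set.Ico 1 k) hh
  exact measurable_features hM hh ((measurable_state_obs D s h).mono hobs le_rfl)
    ((measurable_action_obs D s h).mono hobs le_rfl) i

/-- The sum of the conditional means of `ellNorm` along the data. -/
lemma IsAdaptiveData.sum_meanEllNorm (hD : IsAdaptiveData M ν P K D μ)
    (hM : M.IsLinear φ) {h : ℕ} (hh : h ∈ Set.Icc 1 H) (u : ℝ) :
    P.real {ω | 2 * √(2 * ↑(K + 1) * d * Real.log ↑(K + 1)) + 2 * u <
      ∑ t ∈ Finset.Ico 1 (K + 1), M.meanEllNorm ν φ (D ω) (μ t ω) t h} ≤ Real.exp (-u) := by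
  have hmem : ∀ t ∈ Finset.Ico 1 (K + 1), t ∈ Set.Icc 1 K := fun t ht => by
    rw [Finset.mem_Ico] at ht
    exact ⟨ht.1, by omega⟩
  refine le_trans (measureReal_mono ?_) (measureReal_sum_condMean_le (P := P)
    (𝒢 := fun k => past D H k) (g := fun t ω => M.meanEllNorm ν φ (D ω) (μ t ω) t h)
    (Z := fun t ω => ellNorm φ (D ω) t h ((D ω).state t h) ((D ω).action t h)) (n := K + 1)
    (by omega) (fun k hk => hD.past_le (by have := (Finset.mem_Ico.1 hk).2; omega))
    (fun t ht k _ htk => (hD.measurable_meanEllNorm hM (hmem t ht) hh).mono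
      (past_mono D H htk) le_rfl)
    (fun t ht k _ htk => measurable_ellNorm_data hM hh (hmem t ht).1 htk)
    (fun t ht => (measurable_ellNorm_data hM hh (hmem t ht).1 (Nat.lt_succ_self t)).mono
      (hD.past_le (Nat.succ_le_succ (hmem t ht).2)) le_rfl) ?_ u)
  · intro ω hω
    simp only [Set.mem_ofPred_eq] at hω ⊢
    have h1 := sum_sqrt_invForm_le (x := features φ (D ω) h) (k := K + 1) (by omega)
      (fun t _ => hM.dotProduct_self_le hh _ _)
    have h2 : ∑ t ∈ Finset.Ico 1 (K + 1),
        ellNorm φ (D ω) t h ((D ω).state t h) ((D ω).action t h) ≤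
          √(2 * ↑(K + 1) * d * Real.log ↑(K + 1)) := h1
    linarith
  -- Given the past, the pair visited at step h has the behaviour density, so the one-step condition
  -- reduces to an integral against that density.
  · intro k hk W hW
    have hF : Measurable[(past D H k).prod inferInstance] fun x : Ω × S × A =>
        W x.1 * ENNReal.ofReal (Real.exp (-ellNorm φ (D x.1) k h x.2.1 x.2.2)) :=
      (hW.comp (@measurable_fst _ _ (past D H k) _)).mul
        (measurable_ellNorm_past (D := D) hM hh k).neg.exp.ennreal_ofReal
    have h1 := hD.lintegral_state_action hM (hmem k hk) hh hF
    simp only at h1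
    rw [h1]
    refine lintegral_mono fun ω => ?_
    have hμ := hD.isPolicy k (hmem k hk) ω
    have hen := measurable_ellNorm (φ := φ) hM hh (D ω) k
    simp only [mul_assoc]
    refine (lintegral_const_mul (W ω) (hen.neg.exp.ennreal_ofReal.mul
      (M.measurable_density' hμ hh).ennreal_ofReal)).trans_le (mul_le_mul_right ?_ _)
    exact lintegral_exp_neg_mul_density_le (MDP.integral_density hM hμ hh)
      (fun z => M.density_nonneg hμ hh z.1 z.2) hen
      (fun z => ellNorm_mem hM hh (D ω) (hmem k hk).1 z.1 z.2)

end Data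

/-! ### Finite internal covers. -/

section Cover

/-- A bounded family of vectors, up to `1 / m` in every coordinate, takes at most
`(2 m R + 1) ^ card ι` values, all of them attained. -/
lemma exists_finite_cover {Ω ι : Type*} [Nonempty Ω] [Fintype ι] (s : Set Ω) (f : Ω → ι → ℝ)
    {m R : ℕ} (hm : 1 ≤ m) (hf : ∀ ω ∈ s, ∀ i, |f ω i| ≤ R) :
    ∃ T : Finset Ω, T.card ≤ (2 * m * R + 1) ^ Fintype.card ι ∧
      ∀ ω ∈ s, ∃ ω' ∈ T, ∀ i, |f ω i - f ω' i| ≤ 1 / m := by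
  classical
  have hm0 : (0 : ℝ) < m := by exact_mod_cast hm
  -- Points with equal integer parts differ by less than 1/m in each coordinate. One point of `s` is
  -- kept per occupied cell, so every centre is a value that f attains.
  let cell : Ω → ι → ℤ := fun ω i => ⌊m * f ω i⌋
  let G : Finset (ι → ℤ) :=
    Fintype.piFinset fun _ => Finset.Icc (-((m * R : ℕ) : ℤ)) ((m * R : ℕ) : ℤ)
  have hG : G.card = (2 * m * R + 1) ^ Fintype.card ι := by
    simp only [G, Fintype.card_piFinset, Int.card_Icc, Finset.prod_const, Finset.card_univ]
    congr 1
    have e : (((m * R : ℕ) : ℤ) + 1 - -((m * R : ℕ) : ℤ)) = ((2 * m * R + 1 : ℕ) : ℤ) := by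
      push_cast; ring
    rw [e, Int.toNat_natCast]
  refine ⟨G.image (Function.invFunOn cell s), Finset.card_image_le.trans hG.le, fun ω hω => ?_⟩
  have hmem : cell ω ∈ G := by
    refine Fintype.mem_piFinset.2 fun i => Finset.mem_Icc.2 ?_
    have h1 := abs_le.1 (hf ω hω i)
    constructor
    · rw [Int.le_floor]
      push_cast
      nlinarith
    · have h2 : ((⌊m * f ω i⌋ : ℤ) : ℝ) ≤ ((m * R : ℕ) : ℤ) := by
        refine (Int.floor_le _).trans ?_
        push_cast
        nlinarith
      exact_mod_cast h2
  refine ⟨_, Finset.mem_image_of_mem _ hmem, fun i => ?_⟩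
  have heq : cell (Function.invFunOn cell s (cell ω)) = cell ω :=
    Function.invFunOn_eq ⟨ω, hω, rfl⟩
  have h1 := congrFun heq i
  simp only [cell] at h1
  have h2 := Int.abs_sub_lt_one_of_floor_eq_floor h1
  rw [abs_sub_comm, ← mul_sub, abs_mul, abs_of_pos hm0] at h2
  rw [le_div_iff₀ hm0, mul_comm]
  exact h2.le

end Cover

/-! ### Least-squares error and its stability in the next-value function. -/

section Regression

variable {S A : Type*} [MeasurableSpace S] [MeasurableSpace A]
  {ρ : Measure S} {ν : Measure A} {H d : ℕ} {M : MDP S A ρ H}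
  {φ : ℕ → S → A → EuclideanSpace ℝ (Fin d)} [SigmaFinite ρ] [SigmaFinite ν]
  {D : Dataset S A}

lemma inner_eq_dotProduct (x y : EuclideanSpace ℝ (Fin d)) :
    inner ℝ x y = x.ofLp ⬝ᵥ y.ofLp := by
  rw [EuclideanSpace.inner_eq_star_dotProduct, star_trivial, dotProduct_comm]

lemma dotProduct_self_eq_norm_sq (x : EuclideanSpace ℝ (Fin d)) :
    x.ofLp ⬝ᵥ x.ofLp = ‖x‖ ^ 2 := by
  rw [← inner_eq_dotProduct, real_inner_self_eq_norm_sq]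

/-- In a linear MDP, Bellman backups of bounded functions are linear in the features. -/
lemma MDP.IsLinear.exists_bellman_eq (hM : M.IsLinear φ) {h : ℕ} (hh : h ∈ Set.Icc 1 H)
    {V : S → ℝ} (hV : Measurable V) {B : ℝ} (hB : ∀ s, V s ∈ Set.Icc 0 B) :
    ∃ w : Fin d → ℝ, (∀ s a, M.bellman V h s a = (φ h s a).ofLp ⬝ᵥ w) ∧
      √(w ⬝ᵥ w) ≤ √d * (B + 1) := by
  obtain ⟨-, -, θ, ψ, hr, hp, hθ, hψ, hψB⟩ := hM h hh
  have hVa : ∀ s, |V s| ≤ B := fun s => by rw [abs_of_nonneg (hB s).1]; exact (hB s).2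
  have hi : Integrable (fun s => V s • ψ s) ρ := by
    refine (hψ.norm.const_mul B).mono' (hV.aestronglyMeasurable.smul hψ.aestronglyMeasurable)
      (Filter.Eventually.of_forall fun s => ?_)
    rw [norm_smul]
    exact mul_le_mul_of_nonneg_right (hVa s) (norm_nonneg _)
  refine ⟨(θ + ∫ s, V s • ψ s ∂ρ).ofLp, fun s a => ?_, ?_⟩
  · rw [← inner_eq_dotProduct, inner_add_right, ← integral_inner hi, ← hr]
    simp only [MDP.bellman, hp, inner_smul_right]
  · rw [dotProduct_self_eq_norm_sq, Real.sqrt_sq (norm_nonneg _)]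
    calc _ ≤ ‖θ‖ + ‖∫ s, V s • ψ s ∂ρ‖ := norm_add_le _ _
      _ ≤ √d + √d * B := add_le_add hθ (hψB V B hV hVa)
      _ = _ := by ring

lemma regGram_mulVec (x : ℕ → Fin d → ℝ) (k : ℕ) (w : Fin d → ℝ) :
    regGram x k *ᵥ w = ∑ t ∈ Finset.Ico 1 k, (x t ⬝ᵥ w) • x t + w := by
  rw [regGram, Matrix.add_mulVec, Matrix.one_mulVec, Matrix.sum_mulVec]
  congr 1
  refine Finset.sum_congr rfl fun t _ => ?_
  rw [Matrix.vecMulVec_mulVec]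
  ext i
  simp [mul_comm]

/-- Each target is φ·w plus noise, and the unregularized Gram matrix is Σ - I. The noise sum
therefore comes with the ridge bias -w. -/
lemma weights_eq {V : S → ℝ} {h : ℕ} {w : Fin d → ℝ}
    (hw : ∀ s a, M.bellman V h s a = (φ h s a).ofLp ⬝ᵥ w) (k : ℕ) :
    weights φ D k V h =
      w + (gram φ D k h)⁻¹ *ᵥ (noiseSum (features φ D h) (M.noise D V h) k - w) := by
  have hA := regGram_posDef (features φ D h) k
  have hAu : IsUnit (regGram (features φ D h) k).det :=
    (Matrix.isUnit_iff_isUnit_det _).1 hA.isUnit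
  have e : ∑ t ∈ Finset.Ico 1 k, (D.reward t h + V (D.state t (h + 1))) •
      (φ h (D.state t h) (D.action t h)).ofLp =
      regGram (features φ D h) k *ᵥ w +
        (noiseSum (features φ D h) (M.noise D V h) k - w) := by
    rw [regGram_mulVec, noiseSum, add_add_sub_cancel, ← Finset.sum_add_distrib]
    refine Finset.sum_congr rfl fun t _ => ?_
    rw [← add_smul, MDP.noise, hw]
    congr 1
    simp only [features]
    ring
  rw [weights, e, gram_eq_regGram, Matrix.mulVec_add, Matrix.mulVec_mulVec,
    Matrix.nonsing_inv_mul _ hAu, Matrix.one_mulVec]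

/-- The error of the least-squares estimate of a Bellman backup. -/
lemma abs_weights_sub_bellman_le (hM : M.IsLinear φ) {h : ℕ} (hh : h ∈ Set.Icc 1 H)
    {V : S → ℝ} (hV : Measurable V) {B : ℝ} (hB : ∀ s, V s ∈ Set.Icc 0 B) {k : ℕ} (hk : 1 ≤ k)
    (s : S) (a : A) :
    |(φ h s a).ofLp ⬝ᵥ weights φ D k V h - M.bellman V h s a| ≤
      (√(invForm (gram φ D k h) (noiseSum (features φ D h) (M.noise D V h) k)
        (noiseSum (features φ D h) (M.noise D V h) k)) + √d * (B + 1)) * ellNorm φ D k h s a := by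
  obtain ⟨w, hw, hwn⟩ := hM.exists_bellman_eq hh hV hB
  have hA := regGram_posDef (features φ D h) k
  rw [weights_eq hw, hw, dotProduct_add, add_sub_cancel_left]
  change |invForm (gram φ D k h) _ _| ≤ _
  rw [gram_eq_regGram]
  refine (abs_invForm_le hA _ _).trans ?_
  rw [mul_comm]
  refine mul_le_mul_of_nonneg_right ?_ (Real.sqrt_nonneg _)
  -- The noise and the ridge bias are separated; since Σ ≥ I, the bias costs only the Euclidean norm
  -- of w.
  have h1 := sqrt_invForm_add_le hA (noiseSum (features φ D h) (M.noise D V h) k) ((-1 : ℝ) • w)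
  rw [sqrt_invForm_smul, abs_neg, abs_one, one_mul, neg_one_smul, ← sub_eq_add_neg] at h1
  refine h1.trans (add_le_add_right ?_ _)
  exact (Real.sqrt_le_sqrt (invForm_regGram_le _ hk w)).trans hwn

lemma abs_noise_sub_le {h : ℕ} (hh : h ∈ Set.Icc 1 H)
    {V V' : S → ℝ} (hV : Measurable V) (hV' : Measurable V') {B ε : ℝ}
    (hB : ∀ s, V s ∈ Set.Icc 0 B) (hB' : ∀ s, V' s ∈ Set.Icc 0 B) (hε : ∀ s, |V s - V' s| ≤ ε)
    (t : ℕ) : |M.noise D V h t - M.noise D V' h t| ≤ 2 * ε := by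
  have hp1 := M.integral_p h hh (D.state t h) (D.action t h)
  have hi := integrable_bdd_mul_density hp1 hV (B := B) fun s => by
    rw [abs_of_nonneg (hB s).1]; exact (hB s).2
  have hi' := integrable_bdd_mul_density hp1 hV' (B := B) fun s => by
    rw [abs_of_nonneg (hB' s).1]; exact (hB' s).2
  have e : M.noise D V h t - M.noise D V' h t = (V (D.state t (h + 1)) - V' (D.state t (h + 1))) -
      ∫ s', (V s' - V' s') * M.p h (D.state t h) (D.action t h) s' ∂ρ := by
    simp only [sub_mul]
    rw [integral_sub hi hi']
    simp only [MDP.noise, MDP.bellman]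
    ring
  have h1 : |∫ s', (V s' - V' s') * M.p h (D.state t h) (D.action t h) s' ∂ρ| ≤ ε := by
    calc _ ≤ ∫ s', ε * M.p h (D.state t h) (D.action t h) s' ∂ρ := by
          rw [← Real.norm_eq_abs]
          refine norm_integral_le_of_norm_le ((integrable_of_integral_eq_one hp1).const_mul ε)
            (Filter.Eventually.of_forall fun s => ?_)
          have h0 := M.p_nonneg h hh (D.state t h) (D.action t h) s
          rw [norm_mul, Real.norm_eq_abs, Real.norm_eq_abs, abs_of_nonneg h0]
          exact mul_le_mul_of_nonneg_right (hε s) h0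
      _ = ε := by rw [integral_const_mul, hp1, mul_one]
  rw [e, two_mul]
  exact (abs_sub _ _).trans (add_le_add (hε _) h1)

/-- Transfers concentration from a cover centre: each noise term moves by at most 2ε, and each
feature has inverse-Gram norm at most 1. -/
lemma sqrt_noise_le_of_close (hM : M.IsLinear φ) {h : ℕ} (hh : h ∈ Set.Icc 1 H)
    {V V' : S → ℝ} (hV : Measurable V) (hV' : Measurable V') {B ε : ℝ} (hε0 : 0 ≤ ε)
    (hB : ∀ s, V s ∈ Set.Icc 0 B) (hB' : ∀ s, V' s ∈ Set.Icc 0 B) (hε : ∀ s, |V s - V' s| ≤ ε)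
    (k : ℕ) :
    √(invForm (gram φ D k h) (noiseSum (features φ D h) (M.noise D V h) k)
        (noiseSum (features φ D h) (M.noise D V h) k)) ≤
      √(invForm (gram φ D k h) (noiseSum (features φ D h) (M.noise D V' h) k)
        (noiseSum (features φ D h) (M.noise D V' h) k)) + k * (2 * ε) := by
  have hA := regGram_posDef (features φ D h) k
  rw [gram_eq_regGram]
  set δ : ℕ → ℝ := fun t => M.noise D V h t - M.noise D V' h t with hδ
  have e : noiseSum (features φ D h) (M.noise D V h) k =
      noiseSum (features φ D h) (M.noise D V' h) k +
        ∑ t ∈ Finset.Ico 1 k, δ t • features φ D h t := by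
    simp only [noiseSum, ← Finset.sum_add_distrib, ← add_smul, hδ, add_sub_cancel]
  rw [e]
  refine (sqrt_invForm_add_le hA _ _).trans (add_le_add_right ?_ _)
  refine (sqrt_invForm_sum_le hA _ _).trans ?_
  calc _ ≤ ∑ t ∈ Finset.Ico 1 k, 2 * ε := by
        refine Finset.sum_le_sum fun t ht => ?_
        have hk1 : 1 ≤ k := by rw [Finset.mem_Ico] at ht; omega
        rw [sqrt_invForm_smul]
        have h1 : √(invForm (regGram (features φ D h) k) (features φ D h t) (features φ D h t)) ≤ 1 :=
          Real.sqrt_le_one.2 ((invForm_regGram_le _ hk1 _).trans (hM.dotProduct_self_le hh _ _))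
        calc _ ≤ 2 * ε * 1 := mul_le_mul (abs_noise_sub_le hh hV hV' hB hB' hε t) h1
              (Real.sqrt_nonneg _) (by linarith)
          _ = _ := mul_one _
    _ ≤ _ := by
        rw [Finset.sum_const, Nat.card_Ico, nsmul_eq_mul]
        refine mul_le_mul_of_nonneg_right ?_ (by linarith)
        exact_mod_cast Nat.sub_le _ _

lemma abs_sqrt_sub_sqrt_le (x y : ℝ) : |√x - √y| ≤ √|x - y| := by
  have h : ∀ x y : ℝ, √x - √y ≤ √|x - y| := fun x y => by
    -- The maximum with 0 handles negative y, for which √y = 0.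
    have h1 : √x ≤ √(y ⊔ 0 + |x - y|) := Real.sqrt_le_sqrt (by
      have := le_abs_self (x - y)
      have := le_max_left y 0
      linarith)
    have h2 : √(y ⊔ 0 + |x - y|) ≤ √(y ⊔ 0) + √|x - y| := by
      refine Real.sqrt_le_iff.2 ⟨by positivity, ?_⟩
      have h4 := Real.sq_sqrt (le_max_right y 0)
      have h5 := Real.sq_sqrt (abs_nonneg (x - y))
      nlinarith [Real.sqrt_nonneg (y ⊔ 0), Real.sqrt_nonneg |x - y|]
    have h3 : √(y ⊔ 0) = √y := by
      rcases le_total 0 y with hy | hy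
      · rw [max_eq_left hy]
      · rw [max_eq_right hy, Real.sqrt_zero, Real.sqrt_eq_zero_of_nonpos hy]
    linarith
  exact abs_sub_le_iff.2 ⟨h x y, by rw [abs_sub_comm]; exact h y x⟩

lemma abs_dotProduct_le_of_coord {v w : Fin d → ℝ} {a b : ℝ} (ha : 0 ≤ a) (hv : ∀ i, |v i| ≤ a)
    (hw : ∀ i, |w i| ≤ b) : |v ⬝ᵥ w| ≤ d * (a * b) := by
  calc _ ≤ ∑ i, |v i * w i| := Finset.abs_sum_le_sum_abs _ _
    _ ≤ ∑ _i : Fin d, a * b := Finset.sum_le_sum fun i _ => by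
        rw [abs_mul]; exact mul_le_mul (hv i) (hw i) (abs_nonneg _) ha
    _ = _ := by simp

lemma MDP.IsLinear.abs_coord_le (hM : M.IsLinear φ) {h : ℕ} (hh : h ∈ Set.Icc 1 H) (s : S) (a : A)
    (i : Fin d) : |(φ h s a).ofLp i| ≤ 1 :=
  (PiLp.norm_apply_le (φ h s a) i).trans ((hM h hh).2.1 s a)

/-- `qEstimate` is Lipschitz, resp. Hölder, in the weights and the inverse Gram matrix. -/
lemma abs_qEstimate_sub_le (hM : M.IsLinear φ) {h : ℕ} (hh : h ∈ Set.Icc 1 H) {β : ℕ → ℝ} {k : ℕ}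
    (hβ : 0 ≤ β k) {D D' : Dataset S A} {V V' : S → ℝ} {e : ℝ}
    (hw : ∀ i, |weights φ D k V h i - weights φ D' k V' h i| ≤ e)
    (hA : ∀ i j, |(gram φ D k h)⁻¹ i j - (gram φ D' k h)⁻¹ i j| ≤ e) (s : S) (a : A) :
    |qEstimate φ H β D k V h s a - qEstimate φ H β D' k V' h s a| ≤ d * e + β k * (d * √e) := by
  have hφ := hM.abs_coord_le hh s a
  have h1 : |(φ h s a).ofLp ⬝ᵥ weights φ D k V h - (φ h s a).ofLp ⬝ᵥ weights φ D' k V' h| ≤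
      d * e := by
    rw [← dotProduct_sub]
    refine (abs_dotProduct_le_of_coord zero_le_one hφ (b := e) fun i => ?_).trans (by simp)
    exact hw i
  have h2 : |bonus φ β D k h s a - bonus φ β D' k h s a| ≤ β k * (d * √e) := by
    unfold bonus
    rw [← mul_sub, abs_mul, abs_of_nonneg hβ]
    refine mul_le_mul_of_nonneg_left ((abs_sqrt_sub_sqrt_le _ _).trans ?_) hβ
    rw [← dotProduct_sub, ← Matrix.sub_mulVec]
    have h3 : |(φ h s a).ofLp ⬝ᵥ ((gram φ D k h)⁻¹ - (gram φ D' k h)⁻¹) *ᵥ (φ h s a).ofLp| ≤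
        d * (1 * (d * e)) := by
      refine abs_dotProduct_le_of_coord zero_le_one hφ fun i => ?_
      rw [Matrix.mulVec, dotProduct_comm]
      simpa using abs_dotProduct_le_of_coord zero_le_one hφ (hA i)
    calc _ ≤ √((d : ℝ) ^ 2 * e) := Real.sqrt_le_sqrt (h3.trans (le_of_eq (by ring)))
      _ = d * √e := by rw [Real.sqrt_mul (by positivity), Real.sqrt_sq (by positivity)]
  unfold qEstimate
  refine (abs_max_sub_max_le_abs _ _ _).trans ?_
  refine (abs_min_sub_min_le_max _ _ _ _).trans ?_
  rw [sub_self, abs_zero, max_eq_left (abs_nonneg _)]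
  have h4 := abs_le.1 h1
  have h5 := abs_le.1 h2
  exact abs_le.2 ⟨by linarith, by linarith⟩

lemma abs_inv_gram_le (D : Dataset S A) {k : ℕ} (hk : 1 ≤ k) (h : ℕ) (i j : Fin d) :
    |(gram φ D k h)⁻¹ i j| ≤ 1 := by
  have hA := regGram_posDef (features φ D h) k
  have e : (gram φ D k h)⁻¹ i j = invForm (gram φ D k h) (Pi.single i 1) (Pi.single j 1) := by
    simp [invForm]
  have h1 : ∀ l : Fin d, √(invForm (regGram (features φ D h) k) (Pi.single l 1) (Pi.single l 1)) ≤ 1 :=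
    fun l => Real.sqrt_le_one.2 ((invForm_regGram_le _ hk _).trans (by simp))
  rw [e]
  refine (abs_invForm_le hA _ _).trans ?_
  exact mul_le_one₀ (h1 i) (Real.sqrt_nonneg _) (h1 j)

/-- Each of the k - 1 targets enters with coefficient e_iᵀ Σ⁻¹ φ_t, at most 1 in absolute value
because Σ ≥ I. This fixes the range of the weights for the cover. -/
lemma abs_weights_le (hM : M.IsLinear φ) {h : ℕ} (hh : h ∈ Set.Icc 1 H) {k : ℕ}
    (hk : 1 ≤ k) {V : S → ℝ} {R : ℝ}
    (hR : ∀ t ∈ Finset.Ico 1 k, |D.reward t h + V (D.state t (h + 1))| ≤ R) (i : Fin d) :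
    |weights φ D k V h i| ≤ (k - 1 : ℕ) * R := by
  have hA := regGram_posDef (features φ D h) k
  have e : weights φ D k V h i = ∑ t ∈ Finset.Ico 1 k, (D.reward t h + V (D.state t (h + 1))) *
      invForm (regGram (features φ D h) k) (Pi.single i 1) (features φ D h t) := by
    simp only [← invForm_smul_right, ← invForm_sum_right]
    simp [invForm, weights, features, gram_eq_regGram]
  rw [e]
  refine (Finset.abs_sum_le_sum_abs _ _).trans ?_
  calc _ ≤ ∑ t ∈ Finset.Ico 1 k, R := by
        refine Finset.sum_le_sum fun t ht => ?_
        have h1 : |invForm (regGram (features φ D h) k) (Pi.single i 1) (features φ D h t)| ≤ 1 := by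
          refine (abs_invForm_le hA _ _).trans (mul_le_one₀ ?_ (Real.sqrt_nonneg _) ?_)
          · exact Real.sqrt_le_one.2 ((invForm_regGram_le _ hk _).trans (by simp))
          · exact Real.sqrt_le_one.2 ((invForm_regGram_le _ hk _).trans
              (hM.dotProduct_self_le hh _ _))
        rw [abs_mul]
        calc _ ≤ R * 1 := mul_le_mul (hR t ht) h1 (abs_nonneg _) ((abs_nonneg _).trans (hR t ht))
          _ = R := mul_one R
    _ = _ := by simp

end Regression

/-! ### Value estimates of BCP-VI: stability, cover and pessimism. -/

section Ensemble

variable {S A : Type*} [MeasurableSpace S] [MeasurableSpace A]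
  {ρ : Measure S} {ν : Measure A} {H d K : ℕ} {M : MDP S A ρ H}
  {φ : ℕ → S → A → EuclideanSpace ℝ (Fin d)} [SigmaFinite ρ] [SigmaFinite ν]
  {D D' : Dataset S A} {β : ℕ → ℝ} {U : ℕ → S → Set A} {π π' : ℕ → ℕ → S → A → ℝ} {k : ℕ}

lemma vHat_of_le (ν : Measure A) (φ : ℕ → S → A → EuclideanSpace ℝ (Fin d)) (β : ℕ → ℝ)
    (D : Dataset S A) (k : ℕ) (σ : ℕ → S → A → ℝ) {h : ℕ} (hh : h ≤ H) (s : S) :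
    vHat ν φ H β D k σ h s = ∫ a, qHat ν φ H β D k σ h s a * σ h s a ∂ν := by
  rw [vHat, if_pos hh]
  rfl

lemma vHat_of_lt (ν : Measure A) (φ : ℕ → S → A → EuclideanSpace ℝ (Fin d)) (β : ℕ → ℝ)
    (D : Dataset S A) (k : ℕ) (σ : ℕ → S → A → ℝ) {h : ℕ} (hh : H < h) (s : S) :
    vHat ν φ H β D k σ h s = 0 := by
  rw [vHat, if_neg (by omega)]

lemma measurable_qHat (hM : M.IsLinear φ) (D : Dataset S A) (k : ℕ) (σ : ℕ → S → A → ℝ) {h : ℕ}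
    (hh : h ∈ Set.Icc 1 H) : Measurable fun z : S × A => qHat ν φ H β D k σ h z.1 z.2 := by
  unfold qHat qEstimate
  refine ((Measurable.sub ?_ ?_).min measurable_const).max measurable_const
  · simp only [dotProduct]
    exact Finset.measurable_fun_sum _ fun i _ => (hM.measurable_coord hh i).mul_const _
  · simp only [bonus_eq]
    exact (measurable_ellNorm hM hh D k).const_mul _

lemma qHat_mem (D : Dataset S A) (k : ℕ) (σ : ℕ → S → A → ℝ) {h : ℕ}
    (hh : h ∈ Set.Icc 1 H) (s : S) (a : A) :
    qHat ν φ H β D k σ h s a ∈ Set.Icc (0 : ℝ) (H - h + 1) := by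
  have h1 : (h : ℝ) ≤ H := by exact_mod_cast hh.2
  exact ⟨le_max_right _ _, max_le (min_le_right _ _) (by linarith)⟩

lemma MDP.IsBCPVIEnsemble.isPolicy (hπ : M.IsBCPVIEnsemble ν φ U β K D π)
    (hk : k ∈ Set.Icc 1 (K + 1)) : IsPolicy ν H (π k) :=
  fun h hh => (hπ k hk h hh).1.1

lemma measurable_vHat (hM : M.IsLinear φ) {σ : ℕ → S → A → ℝ} (hσ : IsPolicy ν H σ)
    (D : Dataset S A) (k : ℕ) {h : ℕ} (h1 : 1 ≤ h) : Measurable (vHat ν φ H β D k σ h) := by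
  by_cases hh : h ≤ H
  · rw [funext (vHat_of_le ν φ β D k σ hh)]
    exact measurable_integral_action' (measurable_qHat hM D k σ ⟨h1, hh⟩) (hσ h ⟨h1, hh⟩).1
  · rw [funext (vHat_of_lt ν φ β D k σ (not_le.1 hh))]
    exact measurable_const

lemma vHat_mem (hM : M.IsLinear φ) {σ : ℕ → S → A → ℝ} (hσ : IsPolicy ν H σ)
    (D : Dataset S A) (k : ℕ) {h : ℕ} (h1 : 1 ≤ h) (s : S) :
    vHat ν φ H β D k σ h s ∈ Set.Icc (0 : ℝ) H := by
  by_cases hh : h ≤ H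
  · rw [vHat_of_le ν φ β D k σ hh]
    have := integral_mul_density_mem ((hσ h ⟨h1, hh⟩).2.2 s) ((hσ h ⟨h1, hh⟩).2.1 s)
      ((measurable_qHat (ν := ν) (β := β) hM D k σ ⟨h1, hh⟩).comp measurable_prodMk_left)
      (fun a => qHat_mem D k σ ⟨h1, hh⟩ s a)
    refine ⟨this.1, this.2.trans ?_⟩
    have h1' : (1 : ℝ) ≤ h := by exact_mod_cast h1
    linarith
  · rw [vHat_of_lt ν φ β D k σ (not_le.1 hh)]
    simp

/-- Greediness makes `vHat` non-expansive in `qHat`, however ties are broken. -/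
lemma abs_vHat_sub_le (hM : M.IsLinear φ) (hπ : M.IsBCPVIEnsemble ν φ U β K D π)
    (hπ' : M.IsBCPVIEnsemble ν φ U β K D' π') (hk : k ∈ Set.Icc 1 (K + 1)) {h : ℕ}
    (hh : h ∈ Set.Icc 1 H) {ε : ℝ}
    (hε : ∀ s a, |qHat ν φ H β D k (π k) h s a - qHat ν φ H β D' k (π' k) h s a| ≤ ε) (s : S) :
    |vHat ν φ H β D k (π k) h s - vHat ν φ H β D' k (π' k) h s| ≤ ε := by
  have key : ∀ {D D' : Dataset S A} {π π' : ℕ → ℕ → S → A → ℝ},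
      M.IsBCPVIEnsemble ν φ U β K D π → M.IsBCPVIEnsemble ν φ U β K D' π' →
      (∀ s a, |qHat ν φ H β D k (π k) h s a - qHat ν φ H β D' k (π' k) h s a| ≤ ε) →
      vHat ν φ H β D k (π k) h s - vHat ν φ H β D' k (π' k) h s ≤ ε := by
    intro D D' π π' hπ hπ' hε
    rw [vHat_of_le ν φ β D k _ hh.2, vHat_of_le ν φ β D' k _ hh.2]
    obtain ⟨hmem, -⟩ := hπ k hk h hh
    obtain ⟨-, hmax⟩ := hπ' k hk h hh
    -- The constrained class does not depend on the data, so the policy of one data set competes in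
    -- the maximization of the other. Only maximal values are compared, hence ties are harmless.
    have h1 := hmax _ hmem s
    have hσ1 := hmem.1.2.2 s
    have hi : ∀ (D : Dataset S A) (π : ℕ → ℕ → S → A → ℝ) {σ : S → A → ℝ},
        ∫ a, σ s a ∂ν = 1 →
        Integrable (fun a => qHat ν φ H β D k (π k) h s a * σ s a) ν := fun D π σ hσ =>
      integrable_bdd_mul_density hσ
        (f := fun a => qHat ν φ H β D k (π k) h s a) (B := (H : ℝ) - h + 1)
        ((measurable_qHat hM D k (π k) hh).comp measurable_prodMk_left) fun a => by
          have := qHat_mem (ν := ν) (φ := φ) (β := β) D k (π k) hh s a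
          rw [abs_of_nonneg this.1]; exact this.2
    have h2 : ∫ a, qHat ν φ H β D k (π k) h s a * π k h s a ∂ν ≤
        ∫ a, qHat ν φ H β D' k (π' k) h s a * π k h s a ∂ν + ε := by
      have e : ε = ∫ a, ε * π k h s a ∂ν := by rw [integral_const_mul, hσ1, mul_one]
      rw [e, ← integral_add (hi D' π' hσ1) ((integrable_of_integral_eq_one hσ1).const_mul ε)]
      refine integral_mono (hi D π hσ1)
        ((hi D' π' hσ1).add ((integrable_of_integral_eq_one hσ1).const_mul ε)) fun a => ?_
      have h3 := (abs_le.1 (hε s a)).2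
      have h4 := mul_le_mul_of_nonneg_right h3 (hmem.1.2.1 s a)
      simp only
      linarith
    linarith
  exact abs_sub_le_iff.2 ⟨key hπ hπ' hε, key hπ' hπ fun s a => by rw [abs_sub_comm]; exact hε s a⟩

/-- The value estimates that occur in the `k`-th pass, over all data sets with rewards in `[0, 1]`,
have a small internal cover. -/
lemma exists_vHat_cover {Ω : Type*} [Nonempty Ω] {D : Ω → Dataset S A}
    {π : Ω → ℕ → ℕ → S → A → ℝ} (hM : M.IsLinear φ)
    (hπ : ∀ ω, M.IsBCPVIEnsemble ν φ U β K (D ω) (π ω)) (hk : k ∈ Set.Icc 1 (K + 1))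
    (hβ : 0 ≤ β k) {h : ℕ} (hh : h ∈ Set.Icc 1 H) (s : Set Ω)
    (hs : ∀ ω ∈ s, ∀ t ∈ Set.Icc 1 K, ∀ h ∈ Set.Icc 1 H, (D ω).reward t h ∈ Set.Icc (0 : ℝ) 1)
    (hK : 1 ≤ K) {m : ℕ} (hm : 1 ≤ m) :
    ∃ T : Finset Ω, T.card ≤ (2 * m * (K * (H + 1)) + 1) ^ (d + d * d) ∧
      ∀ ω ∈ s, ∃ ω' ∈ T, ∀ x, |vHat ν φ H β (D ω) k (π ω k) (h + 1) x -
        vHat ν φ H β (D ω') k (π ω' k) (h + 1) x| ≤ d * (1 / m) + β k * (d * √(1 / m)) := by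
  by_cases hhH : h = H
  · refine ⟨{Classical.arbitrary Ω}, ?_, fun ω _ => ⟨_, Finset.mem_singleton_self _, fun x => ?_⟩⟩
    · rw [Finset.card_singleton]; exact Nat.one_le_pow _ _ (by omega)
    · rw [vHat_of_lt _ _ _ _ _ _ (by omega), vHat_of_lt _ _ _ _ _ _ (by omega), sub_self, abs_zero]
      positivity
  · have hh' : h + 1 ∈ Set.Icc 1 H := ⟨by omega, by have := hh.2; omega⟩
    -- The estimate at step h + 1 sees the data only through these d + d² numbers; the later
    -- estimates enter through the weights alone, so covers are not compounded over steps.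
    let f : Ω → Fin d ⊕ Fin d × Fin d → ℝ := fun ω => Sum.elim
      (fun i => weights φ (D ω) k (vHat ν φ H β (D ω) k (π ω k) (h + 1 + 1)) (h + 1) i)
      (fun ij => (gram φ (D ω) k (h + 1))⁻¹ ij.1 ij.2)
    obtain ⟨T, hT, hcov⟩ := exists_finite_cover s f (m := m) (R := K * (H + 1)) hm (by
      intro ω hω i
      rcases i with i | ⟨i, j⟩
      · have h1 := abs_weights_le (D := D ω) hM hh' hk.1
          (V := vHat ν φ H β (D ω) k (π ω k) (h + 1 + 1)) (R := (H : ℝ) + 1) (fun t ht => by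
            rw [Finset.mem_Ico] at ht
            have hk2 := hk.2
            have h2 := hs ω hω t ⟨ht.1, by omega⟩ (h + 1) hh'
            have h3 := vHat_mem (β := β) hM ((hπ ω).isPolicy hk) (D ω) k
              (h := h + 1 + 1) (by omega) ((D ω).state t (h + 1 + 1))
            simp only [Set.mem_Icc] at h2 h3
            exact abs_le.2 ⟨by linarith, by linarith⟩) i
        refine h1.trans ?_
        push_cast
        refine mul_le_mul_of_nonneg_right ?_ (by positivity)
        have hk2 := hk.2
        exact_mod_cast (by omega : k - 1 ≤ K)
      · refine (abs_inv_gram_le (D ω) hk.1 (h + 1) i j).trans ?_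
        exact_mod_cast Nat.one_le_iff_ne_zero.2 (by positivity))
    refine ⟨T, by simpa using hT, fun ω hω => ?_⟩
    obtain ⟨ω', hω', hclose⟩ := hcov ω hω
    refine ⟨ω', hω', abs_vHat_sub_le hM (hπ ω) (hπ ω') hk hh' fun x a => ?_⟩
    exact abs_qEstimate_sub_le hM hh' hβ (fun i => hclose (Sum.inl i))
      (fun i j => hclose (Sum.inr (i, j))) x a

/-- On the event that the least-squares estimates are accurate, the sub-optimality is bounded by the
mean bonus under the optimal policy. -/
lemma MDP.IsBCPVIEnsemble.subOpt_le (hM : M.IsLinear φ) (hH : 1 ≤ H)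
    (hπ : M.IsBCPVIEnsemble ν φ U β K D π) (hk : k ∈ Set.Icc 1 (K + 1)) (hβ : 0 ≤ β k)
    {πstar : ℕ → S → A → ℝ} (hπs : IsPolicy ν H πstar)
    (hU : ∀ h ∈ Set.Icc 1 H, ∀ s, 0 < M.stateDensity ν πstar h s → ∀ a, 0 < πstar h s a →
      a ∈ U h s)
    (hacc : ∀ h ∈ Set.Icc 1 H, ∀ s a,
      |(φ h s a).ofLp ⬝ᵥ weights φ D k (vHat ν φ H β D k (π k) (h + 1)) h -
        M.bellman (vHat ν φ H β D k (π k) (h + 1)) h s a| ≤ bonus φ β D k h s a) :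
    M.subOpt ν πstar (π k) ≤ 2 * ∑ h ∈ Finset.Icc 1 H,
      ∫ z, bonus φ β D k h z.1 z.2 * M.density ν πstar h z.1 z.2 ∂(ρ.prod ν) := by
  have hpol := hπ.isPolicy hk
  have hVm := fun (h : ℕ) (h1 : 1 ≤ h) => measurable_vHat (β := β) hM hpol D k h1
  -- This range is sharper than in `vHat_mem`: it places the backup at or below the clipping level H
  -- - h + 1.
  have hVmem : ∀ h ∈ Set.Icc 1 H, ∀ s,
      vHat ν φ H β D k (π k) (h + 1) s ∈ Set.Icc (0 : ℝ) (H - h) := by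
    intro h hh s
    by_cases hhH : h = H
    · rw [vHat_of_lt _ _ _ _ _ _ (by omega), hhH]; simp
    · have hh' : h + 1 ∈ Set.Icc 1 H := ⟨by omega, by have := hh.2; omega⟩
      rw [vHat_of_le ν φ β D k _ hh'.2]
      have := integral_mul_density_mem ((hpol _ hh').2.2 s) ((hpol _ hh').2.1 s)
        ((measurable_qHat (ν := ν) (β := β) hM D k (π k) hh').comp measurable_prodMk_left)
        (fun a => qHat_mem D k (π k) hh' s a)
      push_cast at this
      exact ⟨this.1, this.2.trans (by linarith)⟩
  have hT := fun h hh s a => M.bellman_mem hh (hVm (h + 1) (by omega)) (hVmem h hh) s a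
  refine MDP.subOpt_le_sum_bonus hM hH hπs hpol (Q := qHat ν φ H β D k (π k))
    (b := fun h s a => bonus φ β D k h s a) (V := vHat ν φ H β D k (π k))
    (fun h hh s => vHat_of_le ν φ β D k _ hh.2 s)
    (fun s => vHat_of_lt ν φ β D k _ (Nat.lt_succ_self H) s)
    (fun h hh => measurable_qHat hM D k (π k) hh) (fun h hh s a => qHat_mem D k (π k) hh s a)
    (fun h hh => (measurable_ellNorm hM hh D k).const_mul _) (Bb := β k) ?_ ?_ ?_ ?_
  · intro h hh s a
    have := ellNorm_mem hM hh D hk.1 s a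
    simp only [bonus_eq]
    rw [abs_mul, abs_of_nonneg hβ, abs_of_nonneg this.1]
    exact mul_le_of_le_one_right hβ this.2
  -- Clipping at 0 preserves the lower estimate because the backup is nonnegative.
  · intro h hh s a
    have h1 := (abs_le.1 (hacc h hh s a)).2
    refine max_le ((min_le_left _ _).trans ?_) (hT h hh s a).1
    linarith
  -- Clipping at H - h + 1 costs nothing because the backup does not exceed that level.
  · intro h hh s a
    have h1 := (abs_le.1 (hacc h hh s a)).1
    have h2 := (hT h hh s a).2
    have h3 : 0 ≤ bonus φ β D k h s a := mul_nonneg hβ (Real.sqrt_nonneg _)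
    have h4 : M.bellman (vHat ν φ H β D k (π k) (h + 1)) h s a - 2 * bonus φ β D k h s a ≤
        qHat ν φ H β D k (π k) h s a :=
      le_max_of_le_left (le_min (by linarith) (by linarith))
    linarith
  · intro h hh s hs
    classical
    have hds := M.measurable_stateDensity' hπs hh
    have hset : MeasurableSet {s | 0 < M.stateDensity ν πstar h s} :=
      measurableSet_lt measurable_const hds
    -- The policy `πstar` itself may violate the support constraint at feasible states that it never
    -- visits. It is replaced there by the extracted policy, which satisfies the constraint.
    let σ : S → A → ℝ := fun s a =>
      if 0 < M.stateDensity ν πstar h s then πstar h s a else π k h s a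
    have hσ : σ ∈ M.constrainedPolicies ν U h := by
      refine ⟨⟨?_, fun s a => ?_, fun s => ?_⟩, fun s hf a ha => ?_⟩
      · exact Measurable.ite (measurable_fst hset) (hπs h hh).1 (hpol h hh).1
      · simp only [σ]
        split_ifs
        · exact (hπs h hh).2.1 s a
        · exact (hpol h hh).2.1 s a
      · simp only [σ]
        split_ifs
        · exact (hπs h hh).2.2 s
        · exact (hpol h hh).2.2 s
      · by_cases h0 : 0 < M.stateDensity ν πstar h s
        · simp only [σ, if_pos h0] at ha
          exact hU h hh s h0 a ha
        · simp only [σ, if_neg h0] at ha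
          exact (hπ k hk h hh).1.2 s hf a ha
    have := (hπ k hk h hh).2 σ hσ s
    simp only [σ, if_pos hs] at this
    rw [vHat_of_le ν φ β D k _ hh.2]
    exact this

end Ensemble

/-! ### Constants and the final rate. -/

section Numerics

variable {d H K k : ℕ}

lemma sqrt_le_self_of_one_le {x : ℝ} (hx : 1 ≤ x) : √x ≤ x :=
  Real.sqrt_le_iff.2 ⟨by linarith, by nlinarith⟩

lemma one_le_log_of_five_le {n : ℕ} (hn : 5 ≤ n) : 1 ≤ Real.log n := by
  have h5 : (5 : ℝ) ≤ n := by exact_mod_cast hn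
  rw [Real.le_log_iff_exp_le (by linarith)]
  linarith [Real.exp_one_lt_d9]

lemma five_le_mul (hd : 1 ≤ d) (hH : 1 ≤ H) (hK : 5 ≤ K) : 5 ≤ d * H * K :=
  hK.trans (Nat.le_mul_of_pos_left K (Nat.mul_pos hd hH))

lemma log_le_two_mul_log (hd : 1 ≤ d) (hH : 1 ≤ H) (hK : 5 ≤ K) (hk : 1 ≤ k) (hk' : k ≤ K + 1) :
    Real.log k ≤ 2 * Real.log (d * H * K : ℕ) := by
  have hn := five_le_mul hd hH hK
  have h1 : K ≤ d * H * K := Nat.le_mul_of_pos_left K (Nat.mul_pos hd hH)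
  have h2 : k ≤ (d * H * K) ^ 2 := by nlinarith
  have h3 : (k : ℝ) ≤ ((d * H * K : ℕ) : ℝ) ^ 2 := by exact_mod_cast h2
  calc _ ≤ Real.log (((d * H * K : ℕ) : ℝ) ^ 2) :=
        Real.log_le_log (by exact_mod_cast hk) h3
    _ = _ := by rw [Real.log_pow]; norm_num

/-- With δ = 1/K the logarithm is that of n·k, where n = dHK. -/
lemma betaParam_eq (c₁ : ℝ) (d H K k : ℕ) :
    betaParam c₁ d H (1 / K) k = c₁ * (d * H) * Real.log ((d * H * K : ℕ) * k) := by
  unfold betaParam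
  congr 2
  rw [div_div_eq_mul_div, div_one]
  push_cast
  ring

lemma le_betaParam (hd : 1 ≤ d) (hH : 1 ≤ H) (hK : 5 ≤ K) (hk : 1 ≤ k) :
    40 * (d * H) * Real.log (d * H * K : ℕ) ≤ betaParam 40 d H (1 / K) k := by
  have hn := five_le_mul hd hH hK
  have hn' : (0 : ℝ) < (d * H * K : ℕ) := by exact_mod_cast (by omega : 0 < d * H * K)
  have hk' : (1 : ℝ) ≤ k := by exact_mod_cast hk
  rw [betaParam_eq]
  gcongr
  exact le_mul_of_one_le_right hn'.le hk'

lemma betaParam_nonneg (hd : 1 ≤ d) (hH : 1 ≤ H) (hK : 1 ≤ K) (hk : 1 ≤ k) :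
    0 ≤ betaParam 40 d H (1 / K) k := by
  rw [betaParam_eq]
  have h1 : 1 ≤ d * H * K * k := Nat.mul_pos (Nat.mul_pos (Nat.mul_pos hd hH) hK) hk
  have : 0 ≤ Real.log ((d * H * K : ℕ) * k) := Real.log_nonneg (by exact_mod_cast h1)
  positivity

lemma betaParam_mono (hd : 1 ≤ d) (hH : 1 ≤ H) (hK : 1 ≤ K) (hk : 1 ≤ k) {l : ℕ} (hkl : k ≤ l) :
    betaParam 40 d H (1 / K) k ≤ betaParam 40 d H (1 / K) l := by
  rw [betaParam_eq, betaParam_eq]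
  have h1 : 0 < d * H * K * k := Nat.mul_pos (Nat.mul_pos (Nat.mul_pos hd hH) hK) hk
  have : (0 : ℝ) < (d * H * K : ℕ) * k := by exact_mod_cast h1
  gcongr

/-- The three terms are the noise at a cover centre, the error of the cover at ε = 1/K, and the
ridge bias. They are at most 19, 4 and 2 times dHL, where L = log(dHK) ≥ 1, against the 40
available. -/
lemma width_le_betaParam (hd : 1 ≤ d) (hH : 1 ≤ H) (hK : 5 ≤ K) (hk : 1 ≤ k) (hk' : k ≤ K + 1) :
    √(((H : ℝ) + 1) ^ 2 * (d * Real.log k + 2 * (41 * d ^ 2 * Real.log (d * H * K : ℕ)))) +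
      k * (2 * (1 / K)) + √d * (H + 1) ≤ betaParam 40 d H (1 / K) k := by
  refine le_trans ?_ (le_betaParam hd hH hK hk)
  have hlog := log_le_two_mul_log hd hH hK hk hk'
  have hL := one_le_log_of_five_le (five_le_mul hd hH hK)
  set L := Real.log (d * H * K : ℕ)
  have hd1 : (1 : ℝ) ≤ d := by exact_mod_cast hd
  have hH1 : (1 : ℝ) ≤ H := by exact_mod_cast hH
  have hK5 : (5 : ℝ) ≤ K := by exact_mod_cast hK
  have hkK : (k : ℝ) ≤ K + 1 := by exact_mod_cast hk'
  have hdH : 1 ≤ (d : ℝ) * H := one_le_mul_of_one_le_of_one_le hd1 hH1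
  have h1 : √(((H : ℝ) + 1) ^ 2 * (d * Real.log k + 2 * (41 * d ^ 2 * L))) ≤ 19 * (d * H * L) := by
    rw [Real.sqrt_le_left (by positivity)]
    have e1 : (d : ℝ) * Real.log k ≤ d ^ 2 * (2 * L) := by
      calc (d : ℝ) * Real.log k ≤ d * (2 * L) := by gcongr
        _ ≤ d ^ 2 * (2 * L) := by gcongr; exact le_self_pow₀ hd1 two_ne_zero
    have e2 : ((H : ℝ) + 1) ^ 2 ≤ (2 * H) ^ 2 := by gcongr; linarith
    -- 336 = 4·(2 + 82), and 361 = 19² is the next square.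
    calc _ ≤ (2 * (H : ℝ)) ^ 2 * (d ^ 2 * (2 * L) + 2 * (41 * d ^ 2 * L)) := by gcongr
      _ = 336 * (H ^ 2 * d ^ 2) * L := by ring
      _ ≤ 361 * (H ^ 2 * d ^ 2) * L ^ 2 := by
          gcongr
          · norm_num
          · exact le_self_pow₀ hL two_ne_zero
      _ = _ := by ring
  have h2 : (k : ℝ) * (2 * (1 / K)) ≤ 4 := by
    rw [mul_one_div, mul_div_assoc', div_le_iff₀ (by linarith)]
    linarith
  have h3 : √(d : ℝ) * (H + 1) ≤ 2 * (d * H) := by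
    have : √(d : ℝ) ≤ d := sqrt_le_self_of_one_le hd1
    nlinarith
  have h4 : (d : ℝ) * H ≤ d * H * L := le_mul_of_one_le_right (by linarith) hL
  nlinarith

lemma cover_radius_le (hd : 1 ≤ d) (hH : 1 ≤ H) (hK : 5 ≤ K) (hk' : k ≤ K + 1)
    (hk : 1 ≤ k) :
    d * (1 / ((25600 * (d * H * K) ^ 10 : ℕ) : ℝ)) + betaParam 40 d H (1 / K) k *
      (d * √(1 / ((25600 * (d * H * K) ^ 10 : ℕ) : ℝ))) ≤ 1 / K := by
  have hn := five_le_mul hd hH hK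
  have hdK : d * K ≤ d * H * K := Nat.mul_le_mul_right K (Nat.le_mul_of_pos_right d hH)
  have hdH : d * H ≤ d * H * K := Nat.le_mul_of_pos_right _ (by omega)
  have hKn : K ≤ d * H * K := Nat.le_mul_of_pos_left K (Nat.mul_pos hd hH)
  rw [betaParam_eq]
  set n := d * H * K with hndef
  have hn5 : (5 : ℝ) ≤ n := by exact_mod_cast hn
  have hn0 : (0 : ℝ) < n := by linarith
  have hdK' : (d : ℝ) * K ≤ n := by exact_mod_cast hdK
  have hdH' : (d : ℝ) * H ≤ n := by exact_mod_cast hdH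
  have hKn' : (K : ℝ) ≤ n := by exact_mod_cast hKn
  have hK5 : (5 : ℝ) ≤ K := by exact_mod_cast hK
  have hkK : (k : ℝ) ≤ K + 1 := by exact_mod_cast hk'
  have hk1 : (1 : ℝ) ≤ k := by exact_mod_cast hk
  -- The resolution is a perfect square, (160 n⁵)², because the bonus is only 1/2-Hölder in the
  -- inverse Gram matrix. Against β ≤ 80 n³ this makes the bonus error at most d / (2n²).
  have hsq : √(1 / ((25600 * n ^ 10 : ℕ) : ℝ)) = 1 / (160 * (n : ℝ) ^ 5) := by
    rw [Real.sqrt_eq_iff_eq_sq (by positivity) (by positivity)]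
    push_cast
    rw [div_pow]
    ring
  have hlog : Real.log ((n : ℝ) * k) ≤ 2 * (n : ℝ) ^ 2 := by
    refine (Real.log_le_self (by positivity)).trans ?_
    nlinarith
  have hlog0 : 0 ≤ Real.log ((n : ℝ) * k) := Real.log_nonneg (by nlinarith)
  rw [hsq]
  have h1 : (d : ℝ) * (1 / ((25600 * n ^ 10 : ℕ) : ℝ)) ≤ 1 / (2 * K) := by
    rw [mul_one_div, div_le_div_iff₀ (by positivity) (by positivity)]
    push_cast
    have : (n : ℝ) ≤ (n : ℝ) ^ 10 := le_self_pow₀ (by linarith) (by norm_num)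
    nlinarith
  have h2 : 40 * ((d : ℝ) * H) * Real.log ((n : ℝ) * k) * (d * (1 / (160 * (n : ℝ) ^ 5))) ≤
      1 / (2 * K) := by
    calc _ ≤ 40 * (n : ℝ) * (2 * (n : ℝ) ^ 2) * (d * (1 / (160 * (n : ℝ) ^ 5))) := by gcongr
      _ = d / (2 * (n : ℝ) ^ 2) := by field_simp; norm_num
      _ ≤ _ := by
        rw [div_le_div_iff₀ (by positivity) (by positivity)]
        nlinarith
  have h3 : (1 : ℝ) / (2 * K) + 1 / (2 * K) = 1 / K := by field_simp; norm_num
  linarith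

/-- The exponent 41 d² is 38 d² for the cover, from (n¹⁹)^(d + d²), plus 3 d² for the K(K + 1)H of
the union bound over passes and steps. -/
lemma cover_card_le (hd : 1 ≤ d) (hH : 1 ≤ H) (hK : 5 ≤ K) :
    (((2 * (25600 * (d * H * K) ^ 10) * (K * (H + 1)) + 1) ^ (d + d * d) : ℕ) : ℝ) *
      Real.exp (-(41 * d ^ 2 * Real.log (d * H * K : ℕ))) ≤ 1 / (K * ((K + 1 : ℕ) * H)) := by
  have hn := five_le_mul hd hH hK
  have hHK : H * K ≤ d * H * K := Nat.mul_le_mul_right K (Nat.le_mul_of_pos_left H hd)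
  have hKn : K ≤ d * H * K := Nat.le_mul_of_pos_left K (Nat.mul_pos hd hH)
  set n := d * H * K with hndef
  have hn0 : (0 : ℝ) < n := by exact_mod_cast (by omega : 0 < n)
  have e1 : 2 * (25600 * n ^ 10) * (K * (H + 1)) + 1 ≤ n ^ 19 := by
    have h1 : K * (H + 1) ≤ 2 * n := by nlinarith
    have h2 : 1 ≤ n ^ 11 := Nat.one_le_pow _ _ (by omega)
    have h3 : 5 ^ 8 ≤ n ^ 8 := Nat.pow_le_pow_left hn 8
    calc _ ≤ 2 * (25600 * n ^ 10) * (2 * n) + n ^ 11 :=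
          add_le_add (Nat.mul_le_mul_left _ h1) h2
      _ = 102401 * n ^ 11 := by ring
      _ ≤ n ^ 8 * n ^ 11 := Nat.mul_le_mul_right _ (le_trans (by norm_num) h3)
      _ = n ^ 19 := by ring
  have e2 : (2 * (25600 * n ^ 10) * (K * (H + 1)) + 1) ^ (d + d * d) ≤ n ^ (38 * d ^ 2) := by
    calc _ ≤ (n ^ 19) ^ (d + d * d) := Nat.pow_le_pow_left e1 _
      _ = n ^ (19 * (d + d * d)) := (pow_mul _ _ _).symm
      _ ≤ _ := Nat.pow_le_pow_right (by omega) (by nlinarith)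
  have e3 : K * ((K + 1) * H) ≤ n ^ (3 * d ^ 2) := by
    calc K * ((K + 1) * H) = (K + 1) * (H * K) := by ring
      _ ≤ (2 * n) * n := Nat.mul_le_mul (by omega) hHK
      _ ≤ n ^ 3 := by nlinarith [sq_nonneg n]
      _ ≤ _ := Nat.pow_le_pow_right (by omega) (by nlinarith [Nat.one_le_pow 2 d hd])
  have e4 : Real.exp (41 * d ^ 2 * Real.log n) = (n : ℝ) ^ (41 * d ^ 2) := by
    rw [← Real.exp_log (pow_pos hn0 (41 * d ^ 2)), Real.log_pow]
    push_cast
    rfl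
  have hK0 : (0 : ℝ) < K := by exact_mod_cast (by omega : 0 < K)
  have hH0 : (0 : ℝ) < H := by exact_mod_cast hH
  rw [Real.exp_neg, e4, le_div_iff₀ (by positivity), ← div_eq_mul_inv, div_mul_eq_mul_div,
    div_le_one (by positivity)]
  calc _ ≤ ((n ^ (38 * d ^ 2) : ℕ) : ℝ) * ((n ^ (3 * d ^ 2) : ℕ) : ℝ) := by
        refine mul_le_mul (by exact_mod_cast e2) (by exact_mod_cast e3) (by positivity)
          (by positivity)
    _ = _ := by push_cast; ring

/-- The high-probability bound on the sub-optimality. -/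
noncomputable def subOptBound (κ : ℝ) (d H K : ℕ) : ℝ :=
  2 * betaParam 40 d H (1 / K) (K + 1) / K *
    (κ * (2 * √(2 * (K + 1 : ℕ) * d * Real.log (K + 1 : ℕ)) + 2 * Real.log (K * H : ℕ)))

lemma rpow_three_halves (d : ℕ) : (d : ℝ) ^ (3 / 2 : ℝ) = d * √d := by
  rw [Real.sqrt_eq_rpow, show (3 / 2 : ℝ) = 1 + 1 / 2 by norm_num,
    Real.rpow_add' (by positivity) (by norm_num), Real.rpow_one]

/-- The added 2H/K is the cost of the bad event in expectation. -/
lemma subOptBound_add_le_rate (hd : 1 ≤ d) (hH : 1 ≤ H) (hK : 5 ≤ K) {κ : ℝ} (hκ : 1 ≤ κ) :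
    subOptBound κ d H K + 2 * H / K ≤ rate 2000 2 κ H d K := by
  have hlogK := log_le_two_mul_log hd hH hK (k := K + 1) (by omega) le_rfl
  have hn := five_le_mul hd hH hK
  have hL := one_le_log_of_five_le hn
  have hHK : K * H ≤ d * H * K := by
    rw [mul_comm K H]; exact Nat.mul_le_mul_right K (Nat.le_mul_of_pos_left H hd)
  have hKn : K ≤ d * H * K := Nat.le_mul_of_pos_left K (Nat.mul_pos hd hH)
  have e0 : ((d : ℝ) * H * K) = (d * H * K : ℕ) := by push_cast; ring
  unfold subOptBound rate
  rw [betaParam_eq, rpow_three_halves, e0]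
  set n := d * H * K
  set L := Real.log n
  have hn5 : (5 : ℝ) ≤ n := by exact_mod_cast hn
  have hKn' : (K : ℝ) ≤ n := by exact_mod_cast hKn
  have hK5 : (5 : ℝ) ≤ K := by exact_mod_cast hK
  have hd1 : (1 : ℝ) ≤ d := by exact_mod_cast hd
  have hH1 : (1 : ℝ) ≤ H := by exact_mod_cast hH
  have hsd : 1 ≤ √(d : ℝ) := Real.one_le_sqrt.2 hd1
  have hsK : 1 ≤ √(K : ℝ) := Real.one_le_sqrt.2 (by linarith)
  have h1 : Real.log (n * (K + 1 : ℕ)) ≤ 3 * L := by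
    calc _ ≤ Real.log ((n : ℝ) ^ 3) := by
          refine Real.log_le_log (by positivity) ?_
          push_cast
          nlinarith [mul_nonneg (by linarith : (0:ℝ) ≤ n) (by linarith : (0:ℝ) ≤ n)]
      _ = _ := by rw [Real.log_pow]; push_cast; rfl
  have h2 : √(2 * (K + 1 : ℕ) * d * Real.log (K + 1 : ℕ)) ≤ 3 * (√K * √d * (1 + L)) := by
    rw [Real.sqrt_le_left (by positivity)]
    calc _ ≤ 2 * (2 * K) * d * (2 * L) := by
          gcongr
          push_cast
          linarith
      _ = 8 * (K * d * L) := by ring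
      _ ≤ 9 * (K * d * (1 + L) ^ 2) := by
          gcongr
          · norm_num
          · nlinarith
      _ = _ := by
          rw [mul_pow, mul_pow, mul_pow, Real.sq_sqrt (by linarith), Real.sq_sqrt (by linarith)]
          ring
  have h3 : Real.log (K * H : ℕ) ≤ √K * √d * (1 + L) := by
    have h4 : Real.log (K * H : ℕ) ≤ L :=
      Real.log_le_log (by exact_mod_cast Nat.mul_pos (by omega) hH) (by exact_mod_cast hHK)
    have h5 : 1 ≤ √(K : ℝ) * √d := one_le_mul_of_one_le_of_one_le hsK hsd
    have h6 := mul_le_mul h5 (by linarith : L ≤ 1 + L) (by linarith) (by linarith)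
    linarith
  have hlog0 : 0 ≤ Real.log (n * (K + 1 : ℕ)) := Real.log_nonneg (by push_cast; nlinarith)
  -- 1920 = 2·40·3·(6 + 2), the last factor collecting the potential term and the deviation term.
  have h7 : 2 * (40 * ((d : ℝ) * H) * Real.log (n * (K + 1 : ℕ))) / K *
      (κ * (2 * √(2 * (K + 1 : ℕ) * d * Real.log (K + 1 : ℕ)) + 2 * Real.log (K * H : ℕ))) ≤
      1920 * (κ * H * (d * √d) / √K) * (1 + L) ^ 2 := by
    calc _ ≤ 2 * (40 * ((d : ℝ) * H) * (3 * (1 + L))) / K *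
          (κ * (2 * (3 * (√K * √d * (1 + L))) + 2 * (√K * √d * (1 + L)))) := by
          gcongr
          linarith
      _ = 1920 * (κ * H * (d * √d) * (√K / K)) * (1 + L) ^ 2 := by ring
      _ = _ := by rw [Real.sqrt_div_self', mul_one_div]
  have h8 : 2 * (H : ℝ) / K ≤ 2 * (κ * H * (d * √d) / √K) * (1 + L) ^ 2 := by
    have h9 : (H : ℝ) ≤ κ * H * (d * √d) := by
      have : 1 ≤ κ * (d * √d) :=
        one_le_mul_of_one_le_of_one_le hκ (one_le_mul_of_one_le_of_one_le hd1 hsd)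
      nlinarith
    have h10 : √(K : ℝ) ≤ K := sqrt_le_self_of_one_le (by linarith)
    have h11 : (H : ℝ) / K ≤ κ * H * (d * √d) / √K :=
      div_le_div₀ (by positivity) h9 (by linarith) h10
    have h12 : 1 ≤ (1 + L) ^ 2 := by nlinarith
    calc 2 * (H : ℝ) / K = 2 * (H / K) * 1 := by ring
      _ ≤ _ := by gcongr
  have h13 : 0 ≤ (κ * H * (d * √d) / √K) * (1 + L) ^ 2 := by positivity
  linarith

lemma horizon_le_rate (hd : 1 ≤ d) (hH : 1 ≤ H) (hK : 1 ≤ K) (hK' : K < 5) {κ : ℝ} (hκ : 1 ≤ κ) :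
    (H : ℝ) ≤ rate 2000 2 κ H d K := by
  have e0 : ((d : ℝ) * H * K) = (d * H * K : ℕ) := by push_cast; ring
  unfold rate
  rw [rpow_three_halves, e0]
  have hd1 : (1 : ℝ) ≤ d := by exact_mod_cast hd
  have hH1 : (1 : ℝ) ≤ H := by exact_mod_cast hH
  have hK1 : (1 : ℝ) ≤ K := by exact_mod_cast hK
  have hK5 : (K : ℝ) ≤ 5 := by exact_mod_cast hK'.le
  have hL : 0 ≤ Real.log (d * H * K : ℕ) :=
    Real.log_nonneg (by exact_mod_cast Nat.mul_pos (Nat.mul_pos hd hH) hK)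
  have hsd : 1 ≤ √(d : ℝ) := Real.one_le_sqrt.2 hd1
  have hsK : 0 < √(K : ℝ) := Real.sqrt_pos.2 (by linarith)
  have hsK' : √(K : ℝ) ≤ 5 := (sqrt_le_self_of_one_le hK1).trans hK5
  have h1 : (H : ℝ) ≤ κ * H * (d * √d) := by
    have : 1 ≤ κ * (d * √d) :=
      one_le_mul_of_one_le_of_one_le hκ (one_le_mul_of_one_le_of_one_le hd1 hsd)
    nlinarith
  have h2 : (H : ℝ) / 5 ≤ κ * H * (d * √d) / √K := div_le_div₀ (by positivity) h1 hsK hsK'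
  have h3 : 1 ≤ (1 + Real.log (d * H * K : ℕ)) ^ 2 := by nlinarith
  calc (H : ℝ) ≤ 2000 * (H / 5) * 1 := by linarith
    _ ≤ _ := by gcongr

end Numerics

/-! ### The good event and its consequences. -/

section GoodEvent

variable {S A Ω : Type*} [MeasurableSpace S] [MeasurableSpace A] [MeasurableSpace Ω]
  {P : Measure Ω} [IsProbabilityMeasure P]
  {ρ : Measure S} {ν : Measure A} {H d K : ℕ} {M : MDP S A ρ H}
  {φ : ℕ → S → A → EuclideanSpace ℝ (Fin d)} [SigmaFinite ρ] [SigmaFinite ν]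
  {D : Ω → Dataset S A} {μ : ℕ → Ω → ℕ → S → A → ℝ} {U : ℕ → S → Set A}
  {πhat : Ω → ℕ → ℕ → S → A → ℝ} {πstar : ℕ → S → A → ℝ}

/-- The data sets all of whose rewards lie in `[0, 1]`. -/
def goodRewards (D : Ω → Dataset S A) (H K : ℕ) : Set Ω :=
  {ω | ∀ t ∈ Set.Icc 1 K, ∀ h ∈ Set.Icc 1 H, (D ω).reward t h ∈ Set.Icc (0 : ℝ) 1}

lemma IsAdaptiveData.goodRewards_compl (hD : IsAdaptiveData M ν P K D μ) :
    P.real (goodRewards D H K)ᶜ = 0 := by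
  have h : ∀ᵐ ω ∂P, ω ∈ goodRewards D H K := by
    have h1 : ∀ᵐ ω ∂P, ∀ t h, t ∈ Set.Icc 1 K → h ∈ Set.Icc 1 H →
        (D ω).reward t h ∈ Set.Icc (0 : ℝ) 1 := by
      refine ae_all_iff.2 fun t => ae_all_iff.2 fun h => ?_
      by_cases ht : t ∈ Set.Icc 1 K
      · by_cases hh : h ∈ Set.Icc 1 H
        · filter_upwards [hD.reward_mem t ht h hh] with ω hω _ _ using hω
        · exact Filter.Eventually.of_forall fun ω _ h2 => absurd h2 hh
      · exact Filter.Eventually.of_forall fun ω h2 _ => absurd h2 ht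
    filter_upwards [h1] with ω hω t ht h hh using hω t h ht hh
  have h2 : P (goodRewards D H K)ᶜ = 0 := h
  simp [Measure.real, h2]

/-- The least-squares estimates of the `k`-th pass are accurate at step `h`. -/
def MDP.Accurate (M : MDP S A ρ H) (ν : Measure A) (φ : ℕ → S → A → EuclideanSpace ℝ (Fin d))
    (β : ℕ → ℝ) (D : Dataset S A) (k : ℕ) (π : ℕ → S → A → ℝ) (h : ℕ) : Prop :=
  ∀ s a, |(φ h s a).ofLp ⬝ᵥ weights φ D k (vHat ν φ H β D k π (h + 1)) h -
    M.bellman (vHat ν φ H β D k π (h + 1)) h s a| ≤ bonus φ β D k h s a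

lemma IsAdaptiveData.measureReal_not_accurate_le (hD : IsAdaptiveData M ν P K D μ)
    (hM : M.IsLinear φ) (hd : 1 ≤ d) (hH : 1 ≤ H) (hK : 5 ≤ K)
    (hπ : ∀ ω, M.IsBCPVIEnsemble ν φ U (betaParam 40 d H (1 / K)) K (D ω) (πhat ω))
    {k h : ℕ} (hk : k ∈ Set.Icc 1 (K + 1)) (hh : h ∈ Set.Icc 1 H) :
    P.real {ω ∈ goodRewards D H K |
      ¬ M.Accurate ν φ (betaParam 40 d H (1 / K)) (D ω) k (πhat ω k) h} ≤
      1 / (K * ((K + 1 : ℕ) * H)) := by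
  have hΩ : Nonempty Ω := P.nonempty_of_neZero
  set β := betaParam 40 d H (1 / K) with hβdef
  have hβ0 : 0 ≤ β k := betaParam_nonneg hd hH (by omega) hk.1
  have hm : 1 ≤ 25600 * (d * H * K) ^ 10 :=
    Nat.mul_pos (by norm_num) (Nat.pow_pos (Nat.mul_pos (Nat.mul_pos hd hH) (by omega)))
  obtain ⟨T, hT, hcov⟩ := exists_vHat_cover (D := D) (π := πhat) hM hπ hk hβ0 hh
    (goodRewards D H K) (fun ω hω => hω) (by omega) hm
  set u : ℝ := 41 * d ^ 2 * Real.log (d * H * K : ℕ) with hu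
  -- For a fixed centre ω' the function `V ω'` is deterministic, so concentration applies to it. No
  -- measurability of V in ω is needed.
  let V : Ω → S → ℝ := fun ω => vHat ν φ H β (D ω) k (πhat ω k) (h + 1)
  have hVm : ∀ ω, Measurable (V ω) := fun ω =>
    measurable_vHat hM ((hπ ω).isPolicy hk) (D ω) k (by omega)
  have hVB : ∀ ω s, V ω s ∈ Set.Icc (0 : ℝ) H := fun ω s =>
    vHat_mem hM ((hπ ω).isPolicy hk) (D ω) k (by omega) s
  have hVH : ∀ ω, h = H → ∀ s, V ω s = 0 := fun ω hhH s =>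
    vHat_of_lt _ _ _ _ _ _ (by omega) s
  let E : Ω → Set Ω := fun ω' => {ω | ((H : ℝ) + 1) ^ 2 * (d * Real.log k + 2 * u) <
    invForm (gram φ (D ω) k h)
      (noiseSum (features φ (D ω) h) (M.noise (D ω) (V ω') h) k)
      (noiseSum (features φ (D ω) h) (M.noise (D ω) (V ω') h) k)}
  have hsub : {ω ∈ goodRewards D H K | ¬ M.Accurate ν φ β (D ω) k (πhat ω k) h} ⊆
      ⋃ ω' ∈ T, E ω' := by
    rintro ω ⟨hω, hacc⟩
    obtain ⟨ω', hω', hclose⟩ := hcov ω hω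
    refine Set.mem_biUnion hω' ?_
    by_contra hE
    apply hacc
    intro s a
    have hE' : invForm (gram φ (D ω) k h)
        (noiseSum (features φ (D ω) h) (M.noise (D ω) (V ω') h) k)
        (noiseSum (features φ (D ω) h) (M.noise (D ω) (V ω') h) k) ≤
        ((H : ℝ) + 1) ^ 2 * (d * Real.log k + 2 * u) := not_lt.1 fun h => hE h
    refine (abs_weights_sub_bellman_le hM hh (hVm ω) (hVB ω) hk.1 s a).trans ?_
    rw [bonus_eq]
    refine mul_le_mul_of_nonneg_right ?_ (Real.sqrt_nonneg _)
    have h1 := sqrt_noise_le_of_close (D := D ω) hM hh (hVm ω) (hVm ω') (ε := 1 / K) (by positivity)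
      (hVB ω) (hVB ω') (fun x => (hclose x).trans (cover_radius_le hd hH hK hk.2 hk.1)) k
    have h2 := Real.sqrt_le_sqrt hE'
    have h3 := width_le_betaParam hd hH hK hk.1 hk.2
    simp only [← hβdef] at h3
    linarith
  calc _ ≤ P.real (⋃ ω' ∈ T, E ω') := measureReal_mono hsub (measure_ne_top _ _)
    _ ≤ ∑ ω' ∈ T, P.real (E ω') := measureReal_biUnion_finset_le _ _
    _ ≤ ∑ ω' ∈ T, Real.exp (-u) := Finset.sum_le_sum fun ω' _ =>
        hD.noise_concentration hM hh (hVm ω') (hVH ω') (by positivity) (hVB ω') hk u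
    _ = T.card * Real.exp (-u) := by rw [Finset.sum_const, nsmul_eq_mul]
    _ ≤ (((2 * (25600 * (d * H * K) ^ 10) * (K * (H + 1)) + 1) ^ (d + d * d) : ℕ) : ℝ) *
        Real.exp (-u) := by
        gcongr
    _ ≤ _ := cover_card_le hd hH hK

/-- The event on which the sub-optimality is not controlled. -/
def MDP.badEvent (M : MDP S A ρ H) (ν : Measure A) (φ : ℕ → S → A → EuclideanSpace ℝ (Fin d))
    (β : ℕ → ℝ) (K : ℕ) (D : Ω → Dataset S A) (μ : ℕ → Ω → ℕ → S → A → ℝ)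
    (πhat : Ω → ℕ → ℕ → S → A → ℝ) : Set Ω :=
  (goodRewards D H K)ᶜ ∪
  ((⋃ k ∈ Finset.Icc 1 (K + 1), ⋃ h ∈ Finset.Icc 1 H,
    {ω ∈ goodRewards D H K | ¬ M.Accurate ν φ β (D ω) k (πhat ω k) h}) ∪
  ⋃ h ∈ Finset.Icc 1 H, {ω | 2 * √(2 * (K + 1 : ℕ) * d * Real.log (K + 1 : ℕ)) +
    2 * Real.log (K * H : ℕ) <
      ∑ t ∈ Finset.Ico 1 (K + 1), M.meanEllNorm ν φ (D ω) (μ t ω) t h})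

lemma IsAdaptiveData.measureReal_badEvent_le (hD : IsAdaptiveData M ν P K D μ)
    (hM : M.IsLinear φ) (hd : 1 ≤ d) (hH : 1 ≤ H) (hK : 5 ≤ K)
    (hπ : ∀ ω, M.IsBCPVIEnsemble ν φ U (betaParam 40 d H (1 / K)) K (D ω) (πhat ω)) :
    P.real (M.badEvent ν φ (betaParam 40 d H (1 / K)) K D μ πhat) ≤ 2 / K := by
  have hK0 : (0 : ℝ) < K := by exact_mod_cast (by omega : 0 < K)
  have hH0 : (0 : ℝ) < H := by exact_mod_cast hH
  refine (measureReal_union_le _ _).trans ?_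
  rw [hD.goodRewards_compl, zero_add]
  refine (measureReal_union_le _ _).trans ?_
  have h1 : P.real (⋃ k ∈ Finset.Icc 1 (K + 1), ⋃ h ∈ Finset.Icc 1 H,
      {ω ∈ goodRewards D H K |
        ¬ M.Accurate ν φ (betaParam 40 d H (1 / K)) (D ω) k (πhat ω k) h}) ≤ 1 / K := by
    calc _ ≤ ∑ k ∈ Finset.Icc 1 (K + 1), ∑ h ∈ Finset.Icc 1 H,
          (1 / (K * ((K + 1 : ℕ) * H)) : ℝ) := by
          refine (measureReal_biUnion_finset_le _ _).trans (Finset.sum_le_sum fun k hk => ?_)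
          refine (measureReal_biUnion_finset_le _ _).trans (Finset.sum_le_sum fun h hh => ?_)
          exact hD.measureReal_not_accurate_le hM hd hH hK hπ (by simpa using hk)
            (by simpa using hh)
      _ = 1 / K := by
          simp only [Finset.sum_const, Nat.card_Icc, nsmul_eq_mul, Nat.add_sub_cancel]
          field_simp
  have h2 : P.real (⋃ h ∈ Finset.Icc 1 H,
      {ω | 2 * √(2 * (K + 1 : ℕ) * d * Real.log (K + 1 : ℕ)) + 2 * Real.log (K * H : ℕ) <
        ∑ t ∈ Finset.Ico 1 (K + 1), M.meanEllNorm ν φ (D ω) (μ t ω) t h}) ≤ 1 / K := by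
    have he : Real.exp (-Real.log (K * H : ℕ)) = 1 / (K * H) := by
      rw [Real.exp_neg, Real.exp_log (by exact_mod_cast Nat.mul_pos (by omega) hH)]
      push_cast
      rw [one_div]
    calc _ ≤ ∑ h ∈ Finset.Icc 1 H, (1 / (K * H) : ℝ) := by
          refine (measureReal_biUnion_finset_le _ _).trans (Finset.sum_le_sum fun h hh => ?_)
          rw [← he]
          exact hD.sum_meanEllNorm hM (by simpa using hh) _
      _ = 1 / K := by
          simp only [Finset.sum_const, Nat.card_Icc, nsmul_eq_mul, Nat.add_sub_cancel]
          field_simp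
  calc _ ≤ (1 / K + 1 / K : ℝ) := add_le_add h1 h2
    _ = _ := by ring

lemma MDP.minDensity_le (M : MDP S A ρ H) {t h : ℕ} (ht : t ∈ Set.Icc 1 K) (ω : Ω) {s : S} {a : A}
    (hpos : 0 < M.density ν (μ t ω) h s a) : M.minDensity ν K μ h ≤ M.density ν (μ t ω) h s a :=
  csInf_le ⟨0, fun _ ⟨_, _, _, _, _, _, h0⟩ => h0.le⟩ ⟨t, ht, ω, s, a, rfl, hpos⟩

lemma MDP.density_le_of_opc (hπs : IsPolicy ν H πstar)
    (hone : ∀ h ∈ Set.Icc 1 H, ∀ s a, M.density ν πstar h s a ≤ 1)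
    (hopc : M.OPC ν K μ πstar) (hmin : ∀ h ∈ Set.Icc 1 H, 0 < M.minDensity ν K μ h)
    {t h : ℕ} (ht : t ∈ Set.Icc 1 K) (hh : h ∈ Set.Icc 1 H) (ω : Ω) (hμ : IsPolicy ν H (μ t ω))
    (s : S) (a : A) :
    M.density ν πstar h s a ≤ (M.minDensity ν K μ h)⁻¹ * M.density ν (μ t ω) h s a := by
  have hm := hmin h hh
  rcases (M.density_nonneg hπs hh s a).eq_or_lt with h0 | h0
  · rw [← h0]
    exact mul_nonneg (inv_nonneg.2 hm.le) (M.density_nonneg hμ hh s a)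
  · have h1 := M.minDensity_le (μ := μ) ht ω (hopc t ht ω h hh s a h0)
    refine (hone h hh s a).trans ?_
    rw [inv_mul_eq_div, one_le_div hm]
    exact h1

/-- Both densities have mass 1, so integrating the density comparison gives 1 ≤ κ_h for each h. -/
lemma MDP.one_le_kappa (hM : M.IsLinear φ) (hH : 1 ≤ H) (hK : 1 ≤ K) [Nonempty Ω]
    (hμ : ∀ t ∈ Set.Icc 1 K, ∀ ω, IsPolicy ν H (μ t ω))
    (hπs : IsPolicy ν H πstar)
    (hone : ∀ h ∈ Set.Icc 1 H, ∀ s a, M.density ν πstar h s a ≤ 1)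
    (hopc : M.OPC ν K μ πstar) (hmin : ∀ h ∈ Set.Icc 1 H, 0 < M.minDensity ν K μ h) :
    1 ≤ M.kappa ν K μ := by
  have h1 : ∀ h ∈ Set.Icc 1 H, 1 ≤ (M.minDensity ν K μ h)⁻¹ := by
    intro h hh
    have h1K : 1 ∈ Set.Icc 1 K := ⟨le_rfl, hK⟩
    obtain ω := Classical.arbitrary Ω
    have hd1 := MDP.integral_density hM hπs hh
    have hd2 := MDP.integral_density hM (hμ 1 h1K ω) hh
    calc (1 : ℝ) = ∫ z, M.density ν πstar h z.1 z.2 ∂(ρ.prod ν) := hd1.symm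
      _ ≤ ∫ z, (M.minDensity ν K μ h)⁻¹ * M.density ν (μ 1 ω) h z.1 z.2 ∂(ρ.prod ν) :=
          integral_mono (integrable_of_integral_eq_one hd1)
            ((integrable_of_integral_eq_one hd2).const_mul _) fun z =>
            MDP.density_le_of_opc hπs hone hopc hmin h1K hh ω (hμ 1 h1K ω) z.1 z.2
      _ = _ := by rw [integral_const_mul, hd2, mul_one]
  have h2 : 1 ∈ Finset.Icc 1 H := by simp [hH]
  unfold MDP.kappa
  refine (h1 1 ⟨le_rfl, hH⟩).trans (Finset.single_le_sum
    (f := fun h => (M.minDensity ν K μ h)⁻¹) (fun h hh => ?_) h2)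
  exact zero_le_one.trans (h1 h (by simpa using hh))

/-- Off the bad event, the sub-optimality of the `k`-th policy is bounded by the conditional mean
bonuses of any earlier episode. -/
lemma MDP.subOpt_le_sum_meanEllNorm (hM : M.IsLinear φ) (hd : 1 ≤ d) (hH : 1 ≤ H) (hK : 1 ≤ K)
    (hμ : ∀ t ∈ Set.Icc 1 K, ∀ ω, IsPolicy ν H (μ t ω))
    (hπ : ∀ ω, M.IsBCPVIEnsemble ν φ (behaviorSupport K μ) (betaParam 40 d H (1 / K)) K
      (D ω) (πhat ω))
    (hπs : IsPolicy ν H πstar)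
    (hone : ∀ h ∈ Set.Icc 1 H, ∀ s a, M.density ν πstar h s a ≤ 1)
    (hopc : M.OPC ν K μ πstar) (hmin : ∀ h ∈ Set.Icc 1 H, 0 < M.minDensity ν K μ h)
    {ω : Ω} (hω : ω ∉ M.badEvent ν φ (betaParam 40 d H (1 / K)) K D μ πhat)
    {t k : ℕ} (ht : t ∈ Set.Icc 1 K) (htk : t ≤ k) (hk : k ≤ K + 1) :
    M.subOpt ν πstar (πhat ω k) ≤ 2 * betaParam 40 d H (1 / K) (K + 1) *
      ∑ h ∈ Finset.Icc 1 H, (M.minDensity ν K μ h)⁻¹ * M.meanEllNorm ν φ (D ω) (μ t ω) t h := by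
  set β := betaParam 40 d H (1 / K) with hβ
  have hk1 : 1 ≤ k := ht.1.trans htk
  have hkm : k ∈ Set.Icc 1 (K + 1) := ⟨hk1, hk⟩
  have hβ0 : 0 ≤ β k := betaParam_nonneg hd hH hK hk1
  have hβle : β k ≤ β (K + 1) := betaParam_mono hd hH hK hk1 hk
  simp only [MDP.badEvent, Set.mem_union, not_or, Set.mem_compl_iff, not_not, Set.mem_iUnion,
    not_exists] at hω
  obtain ⟨hω1, hω2, -⟩ := hω
  have hacc : ∀ h ∈ Set.Icc 1 H, M.Accurate ν φ β (D ω) k (πhat ω k) h := by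
    intro h hh
    by_contra hc
    exact hω2 k (by simpa using hkm) h (by simpa using hh) ⟨hω1, hc⟩
  refine ((hπ ω).subOpt_le hM hH hkm hβ0 hπs ?_ hacc).trans ?_
  · intro h hh s hs a ha
    -- Concentrability puts every action that `πstar` takes at a visited state into the behaviour
    -- support.
    have h1 : 0 < M.density ν (μ t ω) h s a := hopc t ht ω h hh s a (mul_pos hs ha)
    refine ⟨t, ht, ω, ?_⟩
    exact pos_of_mul_pos_right h1 (M.stateDensity_nonneg (hμ t ht ω) hh s)
  · rw [mul_assoc]
    refine mul_le_mul_of_nonneg_left ?_ zero_le_two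
    rw [Finset.mul_sum]
    refine Finset.sum_le_sum fun h hh => ?_
    have hh' : h ∈ Set.Icc 1 H := by simpa using hh
    have hdμ := MDP.integral_density hM (hμ t ht ω) hh'
    have hds := MDP.integral_density hM hπs hh'
    have hell : ∀ (l : ℕ), 1 ≤ l → ∀ z : S × A, |ellNorm φ (D ω) l h z.1 z.2| ≤ 1 :=
      fun l hl z => by
        have := ellNorm_mem hM hh' (D ω) hl z.1 z.2
        rw [abs_of_nonneg this.1]; exact this.2
    have hi1 := integrable_bdd_mul_density hds (measurable_ellNorm hM hh' (D ω) k) (hell k hk1)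
    have hi2 := integrable_bdd_mul_density hdμ (measurable_ellNorm hM hh' (D ω) t) (hell t ht.1)
    have h1 : ∫ z, ellNorm φ (D ω) k h z.1 z.2 * M.density ν πstar h z.1 z.2 ∂(ρ.prod ν) ≤
        (M.minDensity ν K μ h)⁻¹ * M.meanEllNorm ν φ (D ω) (μ t ω) t h := by
      unfold MDP.meanEllNorm
      rw [← integral_const_mul]
      refine integral_mono hi1 (hi2.const_mul _) fun z => ?_
      -- Change of measure to episode t, combined with the decrease of the elliptical norm from t to
      -- k.
      have h2 := MDP.density_le_of_opc hπs hone hopc hmin ht hh' ω (hμ t ht ω) z.1 z.2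
      have h3 := ellNorm_antitone (φ := φ) (D ω) (h := h) ht.1 htk z.1 z.2
      have h4 := (ellNorm_mem hM hh' (D ω) ht.1 z.1 z.2).1
      calc _ ≤ ellNorm φ (D ω) t h z.1 z.2 *
            ((M.minDensity ν K μ h)⁻¹ * M.density ν (μ t ω) h z.1 z.2) :=
            mul_le_mul h3 h2 (M.density_nonneg hπs hh' z.1 z.2) h4
        _ = _ := by ring
    have h5 : 0 ≤ ∫ z, ellNorm φ (D ω) k h z.1 z.2 * M.density ν πstar h z.1 z.2 ∂(ρ.prod ν) :=
      integral_nonneg fun z => mul_nonneg (Real.sqrt_nonneg _) (M.density_nonneg hπs hh' z.1 z.2)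
    simp only [bonus_eq, mul_assoc]
    rw [integral_const_mul]
    exact mul_le_mul hβle h1 h5 (hβ0.trans hβle)

/-- Off the bad event, both outputs are near-optimal. -/
lemma MDP.subOptMix_subOptLast_le (hM : M.IsLinear φ) (hd : 1 ≤ d) (hH : 1 ≤ H) (hK : 1 ≤ K)
    (hμ : ∀ t ∈ Set.Icc 1 K, ∀ ω, IsPolicy ν H (μ t ω))
    (hπ : ∀ ω, M.IsBCPVIEnsemble ν φ (behaviorSupport K μ) (betaParam 40 d H (1 / K)) K
      (D ω) (πhat ω))
    (hπs : IsPolicy ν H πstar)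
    (hone : ∀ h ∈ Set.Icc 1 H, ∀ s a, M.density ν πstar h s a ≤ 1)
    (hopc : M.OPC ν K μ πstar) (hmin : ∀ h ∈ Set.Icc 1 H, 0 < M.minDensity ν K μ h)
    {ω : Ω} (hω : ω ∉ M.badEvent ν φ (betaParam 40 d H (1 / K)) K D μ πhat) :
    M.subOptMix ν πstar K (πhat ω) ≤ subOptBound (M.kappa ν K μ) d H K ∧
      M.subOptLast ν πstar K (πhat ω) ≤ subOptBound (M.kappa ν K μ) d H K := by
  have hK0 : (0 : ℝ) < K := by exact_mod_cast hK
  set β := betaParam 40 d H (1 / K) with hβ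
  have hβ0 : 0 ≤ β (K + 1) := betaParam_nonneg hd hH hK (by omega)
  set c : ℕ → ℝ := fun t => 2 * β (K + 1) * ∑ h ∈ Finset.Icc 1 H,
    (M.minDensity ν K μ h)⁻¹ * M.meanEllNorm ν φ (D ω) (μ t ω) t h with hc
  have hIcc : Finset.Icc 1 K = Finset.Ico 1 (K + 1) := by ext; simp
  have hsum : (1 / K : ℝ) * ∑ t ∈ Finset.Icc 1 K, c t ≤ subOptBound (M.kappa ν K μ) d H K := by
    have h1 : ∀ h ∈ Finset.Icc 1 H,
        ∑ t ∈ Finset.Ico 1 (K + 1), M.meanEllNorm ν φ (D ω) (μ t ω) t h ≤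
          2 * √(2 * (K + 1 : ℕ) * d * Real.log (K + 1 : ℕ)) + 2 * Real.log (K * H : ℕ) := by
      intro h hh
      by_contra hcon
      exact hω (Or.inr (Or.inr (Set.mem_biUnion hh (not_le.1 hcon))))
    rw [hIcc, hc, ← Finset.mul_sum, Finset.sum_comm]
    simp only [← Finset.mul_sum]
    unfold subOptBound MDP.kappa
    rw [Finset.sum_mul, ← mul_assoc, one_div_mul_eq_div]
    refine mul_le_mul_of_nonneg_left (Finset.sum_le_sum fun h hh => ?_) (by positivity)
    exact mul_le_mul_of_nonneg_left (h1 h hh)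
      (inv_nonneg.2 (hmin h (by simpa using hh)).le)
  have hle := fun t k ht htk hk => MDP.subOpt_le_sum_meanEllNorm hM hd hH hK hμ hπ hπs hone hopc
    hmin hω (t := t) (k := k) ht htk hk
  constructor
  -- Mixture: the bound for pass t uses episode t itself.
  · refine le_trans ?_ hsum
    unfold MDP.subOptMix
    refine mul_le_mul_of_nonneg_left (Finset.sum_le_sum fun t ht => ?_) (by positivity)
    have ht' : t ∈ Set.Icc 1 K := by simpa using ht
    exact hle t t ht' le_rfl (ht'.2.trans (Nat.le_succ K))
  -- Last iterate: pass K + 1 is bounded through every episode t ≤ K, and these K bounds are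
  -- averaged.
  · refine le_trans ?_ hsum
    have h2 : ∑ _t ∈ Finset.Icc 1 K, M.subOptLast ν πstar K (πhat ω) ≤
        ∑ t ∈ Finset.Icc 1 K, c t := Finset.sum_le_sum fun t ht => by
      have ht' : t ∈ Set.Icc 1 K := by simpa using ht
      exact hle t (K + 1) ht' (ht'.2.trans (Nat.le_succ K)) le_rfl
    rw [Finset.sum_const, Nat.card_Icc, Nat.add_sub_cancel, nsmul_eq_mul] at h2
    rw [one_div_mul_eq_div, le_div_iff₀ hK0]
    linarith

lemma MDP.measurable_subOpt (M : MDP S A ρ H) (hπs : IsPolicy ν H πstar) {k : ℕ}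
    (hm : ∀ h ∈ Set.Icc 1 H, Measurable fun x : Ω × S × A => πhat x.1 k h x.2.1 x.2.2) :
    Measurable fun ω => M.subOpt ν πstar (πhat ω k) := by
  unfold MDP.subOpt
  refine (StronglyMeasurable.integral_prod_right'
    (f := fun x : Ω × S => (M.value ν πstar 1 x.2 - M.value ν (πhat x.1 k) 1 x.2) * M.d₁ x.2)
    (Measurable.stronglyMeasurable ?_)).measurable
  exact (((M.measurable_value' hπs le_rfl).comp measurable_snd).sub
    (M.measurable_value (π := fun ω => πhat ω k) hm le_rfl)).mul
    (M.measurable_d₁.comp measurable_snd)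

/-- A random variable bounded by `B` off an event `s`, and by `b` everywhere. -/
lemma integral_le_of_le_off {f : Ω → ℝ} (hf : Integrable f P) {B b : ℝ} (hB : 0 ≤ B)
    (s : Set Ω) (h1 : ∀ ω ∉ s, f ω ≤ B) (h2 : ∀ ω, f ω ≤ b) :
    ∫ ω, f ω ∂P ≤ B + b * P.real s := by
  -- The event may be non-measurable, so a measurable hull of equal measure replaces it.
  have hm := measurableSet_toMeasurable P s
  have hi : Integrable (fun ω => B + (toMeasurable P s).indicator (fun _ => b) ω) P :=
    (integrable_const B).add ((integrable_const b).indicator hm)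
  calc _ ≤ ∫ ω, (B + (toMeasurable P s).indicator (fun _ => b) ω) ∂P := by
        refine integral_mono hf hi fun ω => ?_
        by_cases hω : ω ∈ toMeasurable P s
        · simp only [Set.indicator_of_mem hω]
          linarith [h2 ω]
        · simp only [Set.indicator_of_notMem hω, add_zero]
          exact h1 ω fun h => hω (subset_toMeasurable P s h)
    _ = _ := by
        rw [integral_add (integrable_const B) ((integrable_const b).indicator hm),
          integral_indicator hm]
        simp [Measure.real, mul_comm]

end GoodEvent

end BCPVI

/-! ### Assembly of the two claims. -/

theorem corollary1 :
    ∃ c₁ > (0 : ℝ), ∃ C > (0 : ℝ), ∃ q : ℕ,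
      ∀ (S : Type u) (A : Type v) (Ω : Type w)
        [MeasurableSpace S] [MeasurableSpace A] [MeasurableSpace Ω]
        (ρ : Measure S) (ν : Measure A) (P : Measure Ω)
        [SigmaFinite ρ] [SigmaFinite ν] [IsProbabilityMeasure P]
        (H d K : ℕ) (_ : 1 ≤ H) (_ : 1 ≤ d) (_ : 1 ≤ K)
        (M : BCPVI.MDP S A ρ H) (φ : ℕ → S → A → EuclideanSpace ℝ (Fin d)) (_ : M.IsLinear φ)
        (D : Ω → BCPVI.Dataset S A) (μ : ℕ → Ω → ℕ → S → A → ℝ)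
        (_ : BCPVI.IsAdaptiveData M ν P K D μ)
        (πstar : ℕ → S → A → ℝ) (_ : M.IsOptimal ν πstar)
        (_ : ∀ h ∈ Set.Icc 1 H, ∀ s a, M.density ν πstar h s a ≤ 1)
        (_ : M.OPC ν K μ πstar)
        (_ : ∀ h ∈ Set.Icc 1 H, 0 < M.minDensity ν K μ h)
        (πhat : Ω → ℕ → ℕ → S → A → ℝ)
        (_ : ∀ ω, M.IsBCPVIEnsemble ν φ (BCPVI.behaviorSupport K μ)
          (BCPVI.betaParam c₁ d H (1 / K)) K (D ω) (πhat ω))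
        (_ : ∀ k ∈ Set.Icc 1 (K + 1), ∀ h ∈ Set.Icc 1 H,
          Measurable fun x : Ω × S × A => πhat x.1 k h x.2.1 x.2.2),
        1 - 4 / (K : ℝ) ≤ P.real {ω |
            max (M.subOptMix ν πstar K (πhat ω)) (M.subOptLast ν πstar K (πhat ω)) ≤
              BCPVI.rate C q (M.kappa ν K μ) H d K} ∧
        Integrable (fun ω => M.subOptMix ν πstar K (πhat ω)) P ∧
        Integrable (fun ω => M.subOptLast ν πstar K (πhat ω)) P ∧
        max (∫ ω, M.subOptMix ν πstar K (πhat ω) ∂P) (∫ ω, M.subOptLast ν πstar K (πhat ω) ∂P) ≤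
          BCPVI.rate C q (M.kappa ν K μ) H d K := by
  refine ⟨40, by norm_num, 2000, by norm_num, 2, ?_⟩
  intro S A Ω _ _ _ ρ ν P _ _ _ H d K hH hd hK M φ hM D μ hD πstar hopt hone hopc hmin πhat hπ hm
  have hΩ : Nonempty Ω := P.nonempty_of_neZero
  have hπs := hopt.1
  have hκ : 1 ≤ M.kappa ν K μ :=
    BCPVI.MDP.one_le_kappa hM hH hK hD.isPolicy hπs hone hopc hmin
  have hK0 : (0 : ℝ) < K := by exact_mod_cast hK
  have habs : ∀ ω, ∀ k ∈ Set.Icc 1 (K + 1), |M.subOpt ν πstar (πhat ω k)| ≤ H := fun ω k hk =>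
    M.abs_subOpt_le hH hπs ((hπ ω).isPolicy hk)
  have hmem : ∀ k ∈ Finset.Icc 1 K, k ∈ Set.Icc 1 (K + 1) := fun k hk => by
    rw [Finset.mem_Icc] at hk
    exact ⟨hk.1, by omega⟩
  have hmeas := fun k hk => M.measurable_subOpt (k := k) hπs (hm k hk)
  have hlast1 : K + 1 ∈ Set.Icc 1 (K + 1) := ⟨by omega, le_rfl⟩
  have hintk : ∀ k ∈ Set.Icc 1 (K + 1), Integrable (fun ω => M.subOpt ν πstar (πhat ω k)) P :=
    fun k hk => Integrable.of_bound (hmeas k hk).aestronglyMeasurable H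
      (Filter.Eventually.of_forall fun ω => habs ω k hk)
  have hmixi : Integrable (fun ω => M.subOptMix ν πstar K (πhat ω)) P :=
    (integrable_finsetSum _ fun k hk => hintk k (hmem k hk)).const_mul _
  have hlasti : Integrable (fun ω => M.subOptLast ν πstar K (πhat ω)) P := hintk _ hlast1
  have hlastH : ∀ ω, M.subOptLast ν πstar K (πhat ω) ≤ H := fun ω =>
    (le_abs_self _).trans (habs ω _ hlast1)
  have hmixH : ∀ ω, M.subOptMix ν πstar K (πhat ω) ≤ H := fun ω => by
    unfold BCPVI.MDP.subOptMix
    rw [one_div_mul_eq_div, div_le_iff₀ hK0]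
    calc _ ≤ ∑ _k ∈ Finset.Icc 1 K, (H : ℝ) :=
          Finset.sum_le_sum fun k hk => (le_abs_self _).trans (habs ω k (hmem k hk))
      _ = _ := by simp [mul_comm]
  -- The threshold 5 > e ensures log(dHK) ≥ 1. Below it the rate exceeds H, so both bounds hold for
  -- every ω.
  rcases lt_or_ge K 5 with hK5 | hK5
  · have hrate := BCPVI.horizon_le_rate hd hH hK hK5 hκ
    have hall : ∀ ω, max (M.subOptMix ν πstar K (πhat ω)) (M.subOptLast ν πstar K (πhat ω)) ≤
        BCPVI.rate 2000 2 (M.kappa ν K μ) H d K := fun ω =>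
      max_le ((hmixH ω).trans hrate) ((hlastH ω).trans hrate)
    refine ⟨?_, hmixi, hlasti, max_le ?_ ?_⟩
    · have huniv : {ω | max (M.subOptMix ν πstar K (πhat ω)) (M.subOptLast ν πstar K (πhat ω)) ≤
          BCPVI.rate 2000 2 (M.kappa ν K μ) H d K} = Set.univ := Set.eq_univ_of_forall hall
      rw [huniv, probReal_univ]
      linarith [div_pos (by norm_num : (0 : ℝ) < 4) hK0]
    · refine le_trans ?_ hrate
      simpa using integral_mono hmixi (integrable_const (H : ℝ)) hmixH
    · refine le_trans ?_ hrate
      simpa using integral_mono hlasti (integrable_const (H : ℝ)) hlastH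
  · set bad := M.badEvent ν φ (BCPVI.betaParam 40 d H (1 / K)) K D μ πhat with hbad
    have hPbad : P.real bad ≤ 2 / K := hD.measureReal_badEvent_le hM hd hH hK5 hπ
    have hgood := fun ω (hω : ω ∉ bad) => BCPVI.MDP.subOptMix_subOptLast_le hM hd hH hK
      hD.isPolicy hπ hπs hone hopc hmin hω
    have hrate := BCPVI.subOptBound_add_le_rate hd hH hK5 hκ
    set B := BCPVI.subOptBound (M.kappa ν K μ) d H K with hBdef
    have hB0 : 0 ≤ B := by
      have h1 := BCPVI.betaParam_nonneg hd hH hK (k := K + 1) (by omega)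
      have h2 : 0 ≤ Real.log (K * H : ℕ) :=
        Real.log_nonneg (by exact_mod_cast Nat.mul_pos hK hH)
      rw [hBdef]
      unfold BCPVI.subOptBound
      positivity
    have hHK : 0 ≤ 2 * (H : ℝ) / K := by positivity
    have hexp : ∀ f : Ω → ℝ, Integrable f P → (∀ ω ∉ bad, f ω ≤ B) → (∀ ω, f ω ≤ H) →
        ∫ ω, f ω ∂P ≤ BCPVI.rate 2000 2 (M.kappa ν K μ) H d K := by
      intro f hf h1 h2
      have h3 := BCPVI.integral_le_of_le_off hf hB0 bad h1 h2
      have h4 : (H : ℝ) * P.real bad ≤ H * (2 / K) :=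
        mul_le_mul_of_nonneg_left hPbad (Nat.cast_nonneg H)
      have h5 : (H : ℝ) * (2 / K) = 2 * H / K := by ring
      linarith
    refine ⟨?_, hmixi, hlasti, max_le
      (hexp _ hmixi (fun ω hω => (hgood ω hω).1) hmixH)
      (hexp _ hlasti (fun ω hω => (hgood ω hω).2) hlastH)⟩
    -- Covering Ω and using subadditivity avoids complements, since the bad event need not be
    -- measurable.
    have hcov : (Set.univ : Set Ω) ⊆ {ω |
        max (M.subOptMix ν πstar K (πhat ω)) (M.subOptLast ν πstar K (πhat ω)) ≤
          BCPVI.rate 2000 2 (M.kappa ν K μ) H d K} ∪ bad := by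
      intro ω _
      by_cases hω : ω ∈ bad
      · exact Or.inr hω
      · have hr : max (M.subOptMix ν πstar K (πhat ω)) (M.subOptLast ν πstar K (πhat ω)) ≤
            BCPVI.rate 2000 2 (M.kappa ν K μ) H d K :=
          max_le ((hgood ω hω).1.trans (by linarith)) ((hgood ω hω).2.trans (by linarith))
        exact Or.inl hr
    have h1 := (measureReal_mono hcov).trans (measureReal_union_le (μ := P) _ _)
    rw [probReal_univ] at h1
    have h2 : (2 : ℝ) / K ≤ 4 / K := by gcongr; norm_num
    linarith
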